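/- Let $M$ be a smooth compact Riemannian manifold without boundary and let $f:M\to M$ be a $C^1$-diffeomorphism (not assumed to preserve a volume form). **Definitions.** A *dominated splitting* $TM=E\oplus F$ for $f$ is a decomposition into two continuous subbundles with $E(x)\neq 0\neq F(x)$ for all $x$, both $Df$-invariant, such that for some $N\ge 1$ one has $\|Df^N(x)v\|<\tfrac12\|Df^N(x)u\|$ for all $x\in M$ and all unit vectors $v\in E(x)$, $u\in F(x)$. The diffeomorphism $f$ is *weakly partially hyperbolic* with splitting $TM=E\oplus E^{uu}$ if this splitting is dominated and $E^{uu}$ is expanded exponentially fast: there are $C>0$, $\lambda>1$ with $\|Df^n(x)v\|\ge C\lambda^n\|v\|$ for all $x\in M$, $v\in E^{uu}(x)$, $n\ge 0$. The bundle $E^{uu}$ is then uniquely integrable; the leaf $W^{uu}(x)$ of the unstable foliation $\mathcal W^{uu}$ is the set of points that can be joined to $x$ by a $C^1$ curve tangent to $E^{uu}$. The foliation $\mathcal W^{uu}$ is *dynamically minimal* if for every $x\in M$ the set $\bigcup_{n\in\mathbb Z}W^{uu}(f^n(x))$ is dense in $M$. A periodic point $p$ is *hyperbolic* if over its orbit $O(p)$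 there is a $Df$-invariant splitting $T_{O(p)}M=E^s\oplus E^u$ with $E^s$ contracted and $E^u$ expanded exponentially fast by $Df$. Its stable manifold is the immersed submanifold $W^s(p)=\{y: d(f^n(y),f^n(p))\to 0 \text{ as } n\to+\infty\}$; its unstable manifold $W^u(p)$ is the stable manifold for $f^{-1}$; and $W^{s}(O(p))$, $W^u(O(p))$ are the unions of these over $O(p)$. Hyperbolic periodic points $p,q$ are *homoclinically related* if $W^s(O(p))$ and $W^u(O(q))$ have a point $y$ of transverse intersection (the two tangent spaces at $y$ span $T_yM$) and so do $W^u(O(p))$ and $W^s(O(q))$. The *homoclinic class* $H(p)$ is the closure of the set of hyperbolic periodic points homoclinically related to $p$. A *plaque family* tangent to a subbundle $E$ is a continuous map $\mathcal W:E\to M$ such that each $\mathcal W_x=\mathcal W|_{E(x)}:E(x)\to M$ is a $C^1$-embedding with $\mathcal W_x(0)=x$ whose image is tangent to $E(x)$ at $x$, and such that $(\mathcal W_x)_{x\in M}$ is a continuous family of $C^1$-embeddings: $(x,v,w)\mapsto D\mathcal W_x(v)w$ is continuous on $E\oplus E$ and the plaques $\mathcal W_x(E(x))$ (also denoted $\mathcal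 W_x$) vary continuously with $x$ in the Hausdorff distance. It is *trapped* for $f$ if $f(\overline{\mathcal W_x})\subset\mathcal W_{f(x)}$ for all $x\in M$. The diffeomorphism $f$ is *chain-hyperbolic* with respect to the splitting $TM=E\oplus F$ if this splitting is dominated and 1. there is a hyperbolic periodic point $p$ with $H(p)=M$; 2. there are a plaque family $(\mathcal W^E_x)_{x\in M}$ tangent to $E$ and trapped for $f$, and a plaque family $(\mathcal W^F_x)_{x\in M}$ tangent to $F$ and trapped for $f^{-1}$; 3. there are hyperbolic periodic points $q_s,q_u$, homoclinically related to $p$, with $\mathcal W^E_{q_s}\subset W^s(q_s)$ and $\mathcal W^F_{q_u}\subset W^u(q_u)$. **Proposition.** If $f$ is weakly partially hyperbolic with splitting $TM=E\oplus E^{uu}$ and chain-hyperbolic with respect to the same splitting, then its unstable foliation $\mathcal W^{uu}$ is dynamically minimal: for every $x\in M$ the set $\bigcup_{n\in\mathbb Z}W^{uu}(f^n(x))$ is dense in $M$. -/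

import Mathlib

open Bundle Manifold Set Filter Topology Function
open scoped ContDiff ENNReal

noncomputable section

namespace ChainHyp

/-- Tangent space at `x` of a manifold modelled on `ℝ^d`. -/
abbrev Tan (d : ℕ) {M : Type*} [TopologicalSpace M] [ChartedSpace (EuclideanSpace ℝ (Fin d)) M]
    (x : M) : Type := TangentSpace (𝓡 d) x

/-- A `C^1`-diffeomorphism of `M`. -/
abbrev Diff1 (d : ℕ) (M : Type*) [TopologicalSpace M]
    [ChartedSpace (EuclideanSpace ℝ (Fin d)) M] : Type _ :=
  Diffeomorph (𝓡 d) (𝓡 d) M M 1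

section Topological

variable {d : ℕ} {M : Type*} [TopologicalSpace M] [ChartedSpace (EuclideanSpace ℝ (Fin d)) M]

/-- The derivative `Df^n(x)` of the `n`-th iterate, `n ≥ 0`. -/
def dIter (f : Diff1 d M) (n : ℕ) (x : M) : Tan d x →L[ℝ] Tan d (f^[n] x) :=
  mfderiv (𝓡 d) (𝓡 d) (f^[n]) x

/-- The family of subspaces `E` is a continuous subbundle of `TM`: locally it is spanned by a
continuous frame. -/
def IsSubbundle [IsManifold (𝓡 d) 1 M] (E : (x : M) → Submodule ℝ (Tan d x)) : Prop :=
  ∀ x₀ : M, ∃ U ∈ 𝓝 x₀, ∃ (k : ℕ) (s : Fin k → (x : M) → Tan d x),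
    (∀ i, ContinuousOn (fun x => (⟨x, s i x⟩ : TangentBundle (𝓡 d) M)) U) ∧
    ∀ x ∈ U, LinearIndependent ℝ (fun i => s i x) ∧
      Submodule.span ℝ (range fun i => s i x) = E x

/-- `Df (E(x)) = E(f(x))` for every `x`. -/
def IsInvariantBundle (f : Diff1 d M) (E : (x : M) → Submodule ℝ (Tan d x)) : Prop :=
  ∀ x : M, (E x).map (mfderiv (𝓡 d) (𝓡 d) f x : Tan d x →ₗ[ℝ] Tan d (f x)) = E (f x)

/-- The leaf through `x` of the foliation tangent to a (uniquely integrable) subbundle `F`: all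
points that can be joined to `x` by a `C^1` curve tangent to `F`. -/
def leaf (F : (x : M) → Submodule ℝ (Tan d x)) (x : M) : Set M :=
  {y | ∃ γ : ℝ → M, ContMDiff 𝓘(ℝ, ℝ) (𝓡 d) 1 γ ∧
    (∀ t : ℝ, mfderiv 𝓘(ℝ, ℝ) (𝓡 d) γ t (1 : ℝ) ∈ F (γ t)) ∧ γ 0 = x ∧ γ 1 = y}

/-- The foliation tangent to `F` is dynamically minimal: for every `x`, the union of the leaves
through the points of the full orbit of `x` is dense. -/
def IsDynamicallyMinimal (f : Diff1 d M) (F : (x : M) → Submodule ℝ (Tan d x)) : Prop :=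
  ∀ x : M, Dense (⋃ n : ℤ, leaf F ((f.toEquiv ^ n : Equiv.Perm M) x))

end Topological

section Riemannian

variable {d : ℕ} {M : Type*} [EMetricSpace M] [ChartedSpace (EuclideanSpace ℝ (Fin d)) M]
  [IsManifold (𝓡 d) ∞ M] [RiemannianBundle (fun x : M => TangentSpace (𝓡 d) x)]

/-- `TM = E ⊕ F` is a dominated splitting for `f`. -/
structure IsDominatedSplitting (f : Diff1 d M) (E F : (x : M) → Submodule ℝ (Tan d x)) :
    Prop where
  subbundle_left : IsSubbundle E
  subbundle_right : IsSubbundle F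
  isCompl : ∀ x, IsCompl (E x) (F x)
  nontrivial_left : ∀ x, E x ≠ ⊥
  nontrivial_right : ∀ x, F x ≠ ⊥
  invariant_left : IsInvariantBundle f E
  invariant_right : IsInvariantBundle f F
  dominated : ∃ N : ℕ, 1 ≤ N ∧ ∀ x : M, ∀ v ∈ E x, ∀ u ∈ F x, ‖v‖ = 1 → ‖u‖ = 1 →
    ‖dIter f N x v‖ < 1 / 2 * ‖dIter f N x u‖

/-- On the set `K`, the vectors of `E` are contracted exponentially fast by `Df`. -/
def IsContractedOn (f : Diff1 d M) (K : Set M) (E : (x : M) → Submodule ℝ (Tan d x)) : Prop :=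
  ∃ C lam : ℝ, 0 < C ∧ 0 < lam ∧ lam < 1 ∧
    ∀ x ∈ K, ∀ v ∈ E x, ∀ n : ℕ, ‖dIter f n x v‖ ≤ C * lam ^ n * ‖v‖

/-- On the set `K`, the vectors of `F` are expanded exponentially fast by `Df`. -/
def IsExpandedOn (f : Diff1 d M) (K : Set M) (F : (x : M) → Submodule ℝ (Tan d x)) : Prop :=
  ∃ C lam : ℝ, 0 < C ∧ 1 < lam ∧
    ∀ x ∈ K, ∀ v ∈ F x, ∀ n : ℕ, C * lam ^ n * ‖v‖ ≤ ‖dIter f n x v‖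

/-- `f` is weakly partially hyperbolic with splitting `TM = E ⊕ F`, where `F = E^{uu}`. -/
structure IsWeaklyPartiallyHyperbolic (f : Diff1 d M)
    (E F : (x : M) → Submodule ℝ (Tan d x)) : Prop where
  dominated : IsDominatedSplitting f E F
  expanded : IsExpandedOn f univ F

/-- The (finite) forward orbit of a periodic point. -/
def orbit (f : Diff1 d M) (p : M) : Set M := range fun n : ℕ => f^[n] p

/-- `p` is a hyperbolic periodic point: over its orbit there is an invariant splitting
`E^{ss} ⊕ E^{uu}` with `E^{ss}` contracted and `E^{uu}` expanded exponentially fast. (Only the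
values of the two families on the orbit matter.) -/
def IsHyperbolicPeriodic (f : Diff1 d M) (p : M) : Prop :=
  p ∈ periodicPts f ∧ ∃ Es Eu : (x : M) → Submodule ℝ (Tan d x),
    (∀ x ∈ orbit f p, IsCompl (Es x) (Eu x) ∧
      (Es x).map (mfderiv (𝓡 d) (𝓡 d) f x : Tan d x →ₗ[ℝ] Tan d (f x)) = Es (f x) ∧
      (Eu x).map (mfderiv (𝓡 d) (𝓡 d) f x : Tan d x →ₗ[ℝ] Tan d (f x)) = Eu (f x)) ∧
    IsContractedOn f (orbit f p) Es ∧ IsExpandedOn f (orbit f p) Eu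

/-- The stable manifold (as a set) of the point `p`. -/
def stableManifold (f : Diff1 d M) (p : M) : Set M :=
  {y | Tendsto (fun n : ℕ => edist (f^[n] y) (f^[n] p)) atTop (𝓝 0)}

/-- The unstable manifold of `p` is its stable manifold for `f⁻¹`. -/
def unstableManifold (f : Diff1 d M) (p : M) : Set M := stableManifold f.symm p

/-- The tangent space at `y` of the immersed manifold `stableManifold f p` (`p` hyperbolic
periodic): the velocities at `y` of the `C^1` curves in it. The curves have to be continuous for
the intrinsic topology of the immersed manifold, that is, some iterate of the (compact) curve lies
in a local stable manifold; this is expressed by the uniform convergence of their iterates to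
the orbit of `p`. -/
def stableTangent (f : Diff1 d M) (p y : M) : Submodule ℝ (Tan d y) :=
  Submodule.span ℝ {v | ∃ γ : ℝ → M, ContMDiff 𝓘(ℝ, ℝ) (𝓡 d) 1 γ ∧
    (∀ ε : ℝ≥0∞, 0 < ε → ∃ N : ℕ, ∀ n ≥ N, ∀ t : ℝ, edist (f^[n] (γ t)) (f^[n] p) < ε) ∧
    (⟨γ 0, mfderiv 𝓘(ℝ, ℝ) (𝓡 d) γ 0 (1 : ℝ)⟩ : TangentBundle (𝓡 d) M) = ⟨y, v⟩}

/-- The tangent space at `y` of the unstable manifold of `p`. -/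
def unstableTangent (f : Diff1 d M) (p y : M) : Submodule ℝ (Tan d y) :=
  stableTangent f.symm p y

/-- The stable manifold of the orbit of `p` and the unstable manifold of the orbit of `q` have a
point `y` of transverse intersection. -/
def StableMeetsUnstable (f : Diff1 d M) (p q : M) : Prop :=
  ∃ p' ∈ orbit f p, ∃ q' ∈ orbit f q, ∃ y ∈ stableManifold f p' ∩ unstableManifold f q',
    stableTangent f p' y ⊔ unstableTangent f q' y = ⊤

/-- The hyperbolic periodic points `p` and `q` are homoclinically related. -/
def HomoclinicallyRelated (f : Diff1 d M) (p q : M) : Prop :=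
  IsHyperbolicPeriodic f p ∧ IsHyperbolicPeriodic f q ∧
    StableMeetsUnstable f p q ∧ StableMeetsUnstable f q p

/-- The homoclinic class `H(p)`. -/
def homoclinicClass (f : Diff1 d M) (p : M) : Set M :=
  closure {q | HomoclinicallyRelated f p q}

/-- The total space of the subbundle `E`, with the topology induced by `TM`. -/
abbrev TotE (E : (x : M) → Submodule ℝ (Tan d x)) : Type _ :=
  {u : TangentBundle (𝓡 d) M // u.2 ∈ E u.1}

/-- The total space of the Whitney sum `E ⊕ E` (triples `(x, v, w)` with `v, w ∈ E(x)`), with the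
topology induced by `TM ⊕ TM`. -/
abbrev TotEE (E : (x : M) → Submodule ℝ (Tan d x)) : Type _ :=
  {u : TotalSpace (EuclideanSpace ℝ (Fin d) × EuclideanSpace ℝ (Fin d))
      ((fun x : M => TangentSpace (𝓡 d) x) ×ᵇ (fun x : M => TangentSpace (𝓡 d) x)) //
    u.2.1 ∈ E u.1 ∧ u.2.2 ∈ E u.1}

/-- `W` is a plaque family tangent to `E`; the plaque at `x` is the image of `W x`.
The last three fields say that `W` is continuous on `E` and that the `W x` form a continuous
family of `C^1`-embeddings: the fibre derivative `(x, v, w) ↦ D(W_x)(v) w` is continuous on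
`E ⊕ E`, and the plaque depends continuously on `x` also near its boundary (the domains `E(x)` are
not compact), that is, with respect to the Hausdorff distance. -/
structure IsPlaqueFamily (E : (x : M) → Submodule ℝ (Tan d x)) (W : (x : M) → E x → M) :
    Prop where
  contMDiff : ∀ x, ContMDiff 𝓘(ℝ, E x) (𝓡 d) 1 (W x)
  injective_mfderiv : ∀ x (v : E x), Injective (mfderiv 𝓘(ℝ, E x) (𝓡 d) (W x) v)
  isEmbedding : ∀ x, IsEmbedding (W x)
  map_zero : ∀ x, W x 0 = x
  tangent : ∀ x, (mfderiv 𝓘(ℝ, E x) (𝓡 d) (W x) 0).range = E (W x 0)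
  continuous : Continuous fun u : TotE E => W u.1.1 ⟨u.1.2, u.2⟩
  continuous_deriv : Continuous fun u : TotEE E =>
    (⟨W u.1.1 ⟨u.1.2.1, u.2.1⟩,
      mfderiv 𝓘(ℝ, E u.1.1) (𝓡 d) (W u.1.1) ⟨u.1.2.1, u.2.1⟩ (⟨u.1.2.2, u.2.2⟩ : E u.1.1)⟩ :
      TangentBundle (𝓡 d) M)
  continuous_plaque : ∀ x, Tendsto
    (fun y => Metric.hausdorffEDist (range (W y)) (range (W x))) (𝓝 x) (𝓝 0)

/-- The plaque family `W` is trapped for `f`. -/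
def IsTrapped (f : Diff1 d M) {E : (x : M) → Submodule ℝ (Tan d x)} (W : (x : M) → E x → M) :
    Prop :=
  ∀ x, f '' closure (range (W x)) ⊆ range (W (f x))

/-- `f` is chain-hyperbolic with respect to the splitting `TM = E ⊕ F`. -/
def IsChainHyperbolic (f : Diff1 d M) (E F : (x : M) → Submodule ℝ (Tan d x)) : Prop :=
  ∃ p : M, IsHyperbolicPeriodic f p ∧ homoclinicClass f p = univ ∧
    IsDominatedSplitting f E F ∧
    ∃ (WE : (x : M) → E x → M) (WF : (x : M) → F x → M),
      IsPlaqueFamily E WE ∧ IsTrapped f WE ∧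
      IsPlaqueFamily F WF ∧ IsTrapped f.symm WF ∧
      ∃ qs qu : M, HomoclinicallyRelated f p qs ∧ HomoclinicallyRelated f p qu ∧
        range (WE qs) ⊆ stableManifold f qs ∧ range (WF qu) ⊆ unstableManifold f qu

end Riemannian

end ChainHyp

end

/-!
# Dynamical minimality of the unstable foliation

Write `F` for the expanded bundle, `W` for its plaque family (trapped for `f⁻¹`), `WE` for the plaque
family of `E` (trapped for `f`), and `qs` for the periodic point whose plaque `WE qs` lies in its
stable manifold. No stable manifold theorem and no inclination lemma is used; the plaques of `F`
replace the local unstable manifolds.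

*Small plaques of `F` are local leaves.* Since `F` is expanded and `W` is trapped, a small plaque is
contracted by `f⁻ⁿ` inside the family (`IsPlaqueFamily.exists_backward_contraction`). So its tangent
vectors stay, at all negative times, in a cone around `F`, and domination puts them into `F`
(`IsWeaklyPartiallyHyperbolic.exists_plaqueD_mem`, `IsPlaqueFamily.mem_leaf`).

*Points attracted to `qs` are dense.* Let `G` be the set of points whose forward orbit accumulates on
`qs`. By trapping, `G` contains with a point its whole plaque of `E`. If the orbit of `y` accumulates
on the closure of `G`, then by the local product structure (`exists_local_product`) a small plaque of
`F` at a far iterate of `y` meets `G`, and pulling back by the contraction shows that `y` is in the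
closure of `G` (`mem_closure_of_mem_limitSet`). Following the heteroclinic points from `qs` to `p` and
from `p` to the periodic points related to it gives `dense_setOf_mem_limitSet`. Again by the local
product structure every leaf meets `G`, so the closure `Λ` of the leaves through a full orbit contains
`qs`. This `Λ` is closed, invariant and saturated by small plaques of `F` (`IsSaturatedBy`).

*Saturated sets contain unstable manifolds.* If the positive iterates of the vectors of `E` at a
hyperbolic periodic point `q` are bounded (`IsBoundedAt`), then `E` at `q` is contained in the stable
space, so the plaque of `F` at `q` is a graph over the unstable space, and a cone estimate shows that
it contains all points whose negative iterates stay near the orbit of `q`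
(`HyperbolicChart.exists_plaque_eq`). Hence the unstable manifold of `q` is tangent to `F`, and it is
contained in `Λ` as soon as `q` is.

*Boundedness.* Vectors tangent to a curve that stays close to the orbit of `q` have bounded iterates,
by a cone estimate applied to the chords of the curve. Vectors with bounded iterates belong to `E`, by
domination and the expansion of `F`. If they fill `E` at one point attracted by `q`, then the cone
estimate passes to the limit and holds for `E` at `q` (`HyperbolicChart.isBoundedAt`). At `qs` this
applies to points of the plaque of `E`, after Baire's theorem. At `p` it applies to a transverse
intersection of its stable manifold with the unstable manifold of `qs`, which is tangent to `F`.

So `Λ` contains `qs`, then `p`, then all periodic points related to `p`, which are dense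
(`IsSaturatedBy.eq_univ`).
-/


noncomputable section

namespace ChainHyp

set_option linter.unusedSectionVars false

/-! ### Tangent vectors in charts, and the tangent map of an iterate -/

section

section Coordinates

variable {d : ℕ} {M : Type*} [TopologicalSpace M] [ChartedSpace (EuclideanSpace ℝ (Fin d)) M]

variable (d) in
/-- The derivative at `x` of the preferred chart at `z`, as a map from `T_x M` to the model. -/
def chartD (z x : M) : Tan d x →L[ℝ] EuclideanSpace ℝ (Fin d) :=
  mfderiv (𝓡 d) 𝓘(ℝ, EuclideanSpace ℝ (Fin d)) (extChartAt (𝓡 d) z) x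

variable [IsManifold (𝓡 d) ∞ M]

theorem chartD_eq {z x : M} (hx : x ∈ (extChartAt (𝓡 d) z).source) :
    chartD d z x = (trivializationAt (EuclideanSpace ℝ (Fin d))
      (TangentSpace (𝓡 d)) z).continuousLinearMapAt ℝ x := by
  rw [extChartAt_source] at hx
  exact (TangentBundle.continuousLinearMapAt_trivializationAt hx).symm

theorem isInvertible_chartD {z x : M} (hx : x ∈ (extChartAt (𝓡 d) z).source) :
    (chartD d z x).IsInvertible :=
  isInvertible_mfderiv_extChartAt hx

theorem chartD_injective {z x : M} (hx : x ∈ (extChartAt (𝓡 d) z).source) :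
    Injective (chartD d z x) := (isInvertible_chartD hx).bijective.1

theorem chartD_surjective {z x : M} (hx : x ∈ (extChartAt (𝓡 d) z).source) :
    Surjective (chartD d z x) := (isInvertible_chartD hx).bijective.2

/-- The coordinate of a tangent vector in the preferred chart at `z`. -/
def coord (z : M) (u : TangentBundle (𝓡 d) M) : EuclideanSpace ℝ (Fin d) := chartD d z u.1 u.2

/-- Convergence in `TM` is convergence of the base points together with convergence of the
coordinates in a chart. -/
theorem tendsto_tangentBundle_iff {ι : Type*} {l : Filter ι} {u : ι → TangentBundle (𝓡 d) M}
    {u₀ : TangentBundle (𝓡 d) M} {z : M} (hz : u₀.1 ∈ (extChartAt (𝓡 d) z).source) :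
    Tendsto u l (𝓝 u₀) ↔ Tendsto (fun i => (u i).1) l (𝓝 u₀.1) ∧
      Tendsto (fun i => coord z (u i)) l (𝓝 (coord z u₀)) := by
  set e := trivializationAt (EuclideanSpace ℝ (Fin d)) (TangentSpace (𝓡 d) : M → Type _) z
  have key : ∀ u : TangentBundle (𝓡 d) M, u.1 ∈ (extChartAt (𝓡 d) z).source →
      coord z u = (e u).2 := by
    intro u hu
    rw [coord, chartD_eq hu]
    have h : u.1 ∈ e.baseSet := by simpa [e] using hu
    exact congrFun (Bundle.Trivialization.coe_linearMapAt_of_mem _ h) u.2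
  have h : u₀.1 ∈ e.baseSet := by simpa [e] using hz
  rw [e.tendsto_nhds_iff (e.mem_source.2 h), key _ hz]
  refine and_congr_right fun h1 => tendsto_congr' ?_
  filter_upwards [h1 ((isOpen_extChartAt_source z).mem_nhds hz)] with i hi
  exact (key _ hi).symm

/-- The derivative, read in a chart, of a map from a normed space to the manifold. -/
theorem hasFDerivAt_extChartAt_comp {V : Type*} [NormedAddCommGroup V] [NormedSpace ℝ V]
    {h : V → M} {a : V} (hh : MDifferentiableAt 𝓘(ℝ, V) (𝓡 d) h a) {z : M}
    (hz : h a ∈ (extChartAt (𝓡 d) z).source) :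
    HasFDerivAt (fun v => extChartAt (𝓡 d) z (h v))
      ((chartD d z (h a)).comp (mfderiv 𝓘(ℝ, V) (𝓡 d) h a) : V →L[ℝ] EuclideanSpace ℝ (Fin d))
      a := by
  rw [extChartAt_source] at hz
  have h1 := (mdifferentiableAt_extChartAt (I := 𝓡 d) hz).hasMFDerivAt.comp a hh.hasMFDerivAt
  exact h1.hasFDerivAt

end Coordinates

section Tangent

variable {d : ℕ} {M : Type*} [TopologicalSpace M] [ChartedSpace (EuclideanSpace ℝ (Fin d)) M]

/-- The total space of a family of subspaces, as a subset of `TM`. -/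
def bundleSet (E : (x : M) → Submodule ℝ (Tan d x)) : Set (TangentBundle (𝓡 d) M) :=
  {u | u.2 ∈ E u.1}

/-- The tangent map of the `n`-th iterate of a `C^1`-diffeomorphism, as a self-map of `TM`. Passing to
`TM` avoids transporting vectors along equalities between base points. -/
def tmap (f : Diff1 d M) (n : ℕ) : TangentBundle (𝓡 d) M → TangentBundle (𝓡 d) M :=
  fun u => ⟨f^[n] u.1, dIter f n u.1 u.2⟩

theorem contMDiff_iterate (f : Diff1 d M) (n : ℕ) : ContMDiff (𝓡 d) (𝓡 d) 1 (f^[n]) := by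
  induction n with
  | zero => exact contMDiff_id
  | succ n ih => rw [Function.iterate_succ']; exact f.contMDiff.comp ih

theorem mdifferentiable_iterate (f : Diff1 d M) (n : ℕ) :
    MDifferentiable (𝓡 d) (𝓡 d) (f^[n]) := (contMDiff_iterate f n).mdifferentiable one_ne_zero

theorem continuous_iterate (f : Diff1 d M) (n : ℕ) : Continuous (f^[n]) :=
  (contMDiff_iterate f n).continuous

theorem tmap_eq_tangentMap (f : Diff1 d M) (n : ℕ) :
    tmap f n = tangentMap (𝓡 d) (𝓡 d) (f^[n]) := rfl

theorem tmap_add (f : Diff1 d M) (m n : ℕ) (u : TangentBundle (𝓡 d) M) :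
    tmap f (m + n) u = tmap f m (tmap f n u) := by
  simp only [tmap_eq_tangentMap, Function.iterate_add]
  rw [tangentMap_comp (mdifferentiable_iterate f m) (mdifferentiable_iterate f n)]; rfl

theorem tmap_zero (f : Diff1 d M) (u : TangentBundle (𝓡 d) M) : tmap f 0 u = u := by
  rw [tmap_eq_tangentMap]
  exact congrFun tangentMap_id u

theorem iterate_symm_iterate (f : Diff1 d M) (n : ℕ) (x : M) : f^[n] (f.symm^[n] x) = x :=
  (Function.RightInverse.iterate (f.apply_symm_apply : Function.RightInverse f.symm f) n) x

theorem symm_iterate_iterate (f : Diff1 d M) (n : ℕ) (x : M) : f.symm^[n] (f^[n] x) = x :=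
  (Function.LeftInverse.iterate (f.symm_apply_apply : Function.LeftInverse f.symm f) n) x

theorem tmap_symm_tmap (f : Diff1 d M) (n : ℕ) (u : TangentBundle (𝓡 d) M) :
    tmap f.symm n (tmap f n u) = u := by
  have h := tangentMap_comp (mdifferentiable_iterate f.symm n) (mdifferentiable_iterate f n)
  have h2 : (f.symm^[n]) ∘ (f^[n]) = @id M := funext (symm_iterate_iterate f n)
  rw [h2, tangentMap_id] at h
  exact (congrFun h u).symm

theorem tmap_tmap_symm (f : Diff1 d M) (n : ℕ) (u : TangentBundle (𝓡 d) M) :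
    tmap f n (tmap f.symm n u) = u := by
  have h := tangentMap_comp (mdifferentiable_iterate f n) (mdifferentiable_iterate f.symm n)
  have h2 : (f^[n]) ∘ (f.symm^[n]) = @id M := funext (iterate_symm_iterate f n)
  rw [h2, tangentMap_id] at h
  exact (congrFun h u).symm

theorem dIter_injective (f : Diff1 d M) (n : ℕ) (x : M) : Injective (dIter f n x) := by
  intro v w h
  have h1 : tmap f n ⟨x, v⟩ = tmap f n ⟨x, w⟩ := by simp only [tmap, h]
  have h2 := congrArg (tmap f.symm n) h1
  rw [tmap_symm_tmap, tmap_symm_tmap] at h2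
  exact (TotalSpace.mk_inj.1 h2)

theorem tmap_mem_bundleSet {f : Diff1 d M} {E : (x : M) → Submodule ℝ (Tan d x)}
    (hE : IsInvariantBundle f E) (n : ℕ) {u : TangentBundle (𝓡 d) M} (hu : u ∈ bundleSet E) :
    tmap f n u ∈ bundleSet E := by
  induction n with
  | zero => rwa [tmap_zero]
  | succ n ih =>
    rw [Nat.add_comm, tmap_add]
    have h := hE (tmap f n u).1
    change _ ∈ E (f _)
    rw [← h]
    exact Submodule.mem_map.2 ⟨_, ih, rfl⟩

theorem exists_tmap_eq {f : Diff1 d M} {E : (x : M) → Submodule ℝ (Tan d x)}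
    (hE : IsInvariantBundle f E) {x y : M} (hxy : f x = y) {w : Tan d y} (hw : w ∈ E y) :
    ∃ v ∈ E x, tmap f 1 ⟨x, v⟩ = ⟨y, w⟩ := by
  subst hxy
  rw [← hE x] at hw
  obtain ⟨v, hv, rfl⟩ := Submodule.mem_map.1 hw
  exact ⟨v, hv, rfl⟩

theorem tmap_symm_mem_bundleSet {f : Diff1 d M} {E : (x : M) → Submodule ℝ (Tan d x)}
    (hE : IsInvariantBundle f E) (n : ℕ) {u : TangentBundle (𝓡 d) M} (hu : u ∈ bundleSet E) :
    tmap f.symm n u ∈ bundleSet E := by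
  induction n with
  | zero => rwa [tmap_zero]
  | succ n ih =>
    rw [Nat.add_comm, tmap_add]
    set w := tmap f.symm n u
    obtain ⟨v, hv, hvw⟩ := exists_tmap_eq hE (f.apply_symm_apply w.1) ih
    rw [show w = tmap f 1 ⟨f.symm w.1, v⟩ from hvw.symm, tmap_symm_tmap]
    exact hv

end Tangent

section Norm

variable {d : ℕ} {M : Type*} [TopologicalSpace M] [ChartedSpace (EuclideanSpace ℝ (Fin d)) M]
  [RiemannianBundle (fun x : M => TangentSpace (𝓡 d) x)]

/-- The Riemannian norm, as a function on `TM`. -/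
def nrm (u : TangentBundle (𝓡 d) M) : ℝ := ‖u.2‖

theorem continuous_nrm [IsManifold (𝓡 d) ∞ M]
    [IsContinuousRiemannianBundle (EuclideanSpace ℝ (Fin d))
      (fun x : M => TangentSpace (𝓡 d) x)] : Continuous (nrm : TangentBundle (𝓡 d) M → ℝ) := by
  have h : Continuous fun u : TangentBundle (𝓡 d) M => (inner ℝ u.2 u.2 : ℝ) :=
    Continuous.inner_bundle (F := EuclideanSpace ℝ (Fin d)) (b := fun u : TangentBundle (𝓡 d) M => u.1)
      (v := fun u => u.2) (w := fun u => u.2) continuous_id continuous_id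
  have h2 := h.sqrt
  refine h2.congr fun u => ?_
  rw [real_inner_self_eq_norm_sq, Real.sqrt_sq (norm_nonneg _)]; rfl

end Norm

end

/-! ### Local frames of a subbundle and plaques in coordinates -/

section

section Frames

variable {d : ℕ} {M : Type*} [TopologicalSpace M] [ChartedSpace (EuclideanSpace ℝ (Fin d)) M]
  [IsManifold (𝓡 d) ∞ M]

/-- A continuous local trivialization of the family of subspaces `E` around `z`: an open set `U`
around `z`, contained in the chart domain at `z`, and linear isomorphisms `j x` from `ℝ^k` onto
`E x` for `x ∈ U`, depending continuously on `x` (`j x` is arbitrary for `x ∉ U`). -/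
structure LocalFrame (E : (x : M) → Submodule ℝ (Tan d x)) (z : M) where
  /-- The dimension of the fibres over `U`. -/
  rank : ℕ
  /-- The domain of the frame. -/
  U : Set M
  isOpen : IsOpen U
  mem : z ∈ U
  subset : U ⊆ (extChartAt (𝓡 d) z).source
  /-- The isomorphisms onto the fibres. -/
  j : (x : M) → (Fin rank → ℝ) →ₗ[ℝ] E x
  bijective : ∀ x ∈ U, Bijective (j x)
  continuousOn : ContinuousOn
    (fun p : M × (Fin rank → ℝ) => (⟨p.1, (j p.1 p.2 : Tan d p.1)⟩ : TangentBundle (𝓡 d) M))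
    (U ×ˢ univ)

theorem IsSubbundle.nonempty_localFrame {E : (x : M) → Submodule ℝ (Tan d x)}
    (hE : IsSubbundle E) (z : M) : Nonempty (LocalFrame E z) := by
  classical
  obtain ⟨V, hV, k, s, hs, hsE⟩ := hE z
  set U := interior V ∩ (extChartAt (𝓡 d) z).source with hU
  have hUo : IsOpen U := isOpen_interior.inter (isOpen_extChartAt_source z)
  have hUV : U ⊆ V := fun x hx => interior_subset hx.1
  have hmem : ∀ x ∈ U, ∀ i, s i x ∈ E x := fun x hx i => by
    rw [← (hsE x (hUV hx)).2]; exact Submodule.subset_span ⟨i, rfl⟩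
  let t : (x : M) → Fin k → E x := fun x i => if hx : x ∈ U then ⟨s i x, hmem x hx i⟩ else 0
  have ht : ∀ x ∈ U, ∀ i, (t x i : Tan d x) = s i x := fun x hx i => by simp [t, hx]
  refine ⟨⟨k, U, hUo, ⟨mem_interior_iff_mem_nhds.2 hV, mem_extChartAt_source z⟩,
    fun x hx => hx.2, fun x => Fintype.linearCombination ℝ (t x), ?_, ?_⟩⟩
  · intro x hx
    have hli := (hsE x (hUV hx)).1
    have hco : ∀ c, ((Fintype.linearCombination ℝ (t x) c : E x) : Tan d x)
        = Fintype.linearCombination ℝ (fun i => s i x) c := by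
      intro c
      simp [Fintype.linearCombination_apply, ht x hx]
    constructor
    · intro c c' h
      have h1 := congrArg Subtype.val h
      rw [hco, hco] at h1
      exact (linearIndependent_iff_injective_fintypeLinearCombination.1 hli) h1
    · rintro ⟨v, hv⟩
      rw [← (hsE x (hUV hx)).2, ← Fintype.range_linearCombination] at hv
      obtain ⟨c, hc⟩ := hv
      exact ⟨c, Subtype.ext ((hco c).trans hc)⟩
  · rintro ⟨x, c⟩ ⟨hx, -⟩
    have hx' : x ∈ (extChartAt (𝓡 d) z).source := hx.2
    refine (tendsto_tangentBundle_iff (z := z) hx').2 ⟨(continuous_fst.tendsto _).mono_left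
      nhdsWithin_le_nhds, ?_⟩
    have h1 : ∀ p ∈ U ×ˢ (univ : Set (Fin k → ℝ)),
        chartD d z p.1 ((Fintype.linearCombination ℝ (t p.1) p.2 : E p.1) : Tan d p.1)
        = ∑ i, p.2 i • chartD d z p.1 (s i p.1) := by
      rintro ⟨y, e⟩ ⟨hy, -⟩
      simp [Fintype.linearCombination_apply, ht y hy]
    have h2 : Tendsto (fun p : M × (Fin k → ℝ) => ∑ i, p.2 i • chartD d z p.1 (s i p.1))
        (𝓝[U ×ˢ univ] (x, c)) (𝓝 (∑ i, c i • chartD d z x (s i x))) := by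
      refine tendsto_finsetSum _ fun i _ => Tendsto.smul ?_ ?_
      · exact (((continuous_apply i).comp continuous_snd).tendsto (x, c)).mono_left
          nhdsWithin_le_nhds
      · have h3 := ((tendsto_tangentBundle_iff (z := z) hx').1
          (((hs i).mono hUV) x hx)).2
        refine h3.comp (tendsto_nhdsWithin_iff.2 ⟨(continuous_fst.tendsto _).mono_left
          nhdsWithin_le_nhds, ?_⟩)
        filter_upwards [self_mem_nhdsWithin] with p hp using hp.1
    have h4 := h1 (x, c) ⟨hx, mem_univ _⟩
    simp only at h4
    change Tendsto _ _ (𝓝 (chartD d z x ((Fintype.linearCombination ℝ (t x) c : E x) : Tan d x)))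
    rw [h4]
    refine h2.congr' ?_
    filter_upwards [self_mem_nhdsWithin] with p hp using (h1 p hp).symm

variable {E : (x : M) → Submodule ℝ (Tan d x)} {z : M}

theorem LocalFrame.isOpen_prod (fr : LocalFrame E z) :
    IsOpen (fr.U ×ˢ (univ : Set (Fin fr.rank → ℝ))) := fr.isOpen.prod isOpen_univ

/-- The coordinate expression of a local frame. -/
def LocalFrame.A (fr : LocalFrame E z) (x : M) :
    (Fin fr.rank → ℝ) →L[ℝ] EuclideanSpace ℝ (Fin d) :=
  LinearMap.toContinuousLinearMap
    ((chartD d z x : Tan d x →ₗ[ℝ] EuclideanSpace ℝ (Fin d)) ∘ₗ (E x).subtype ∘ₗ fr.j x)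

theorem LocalFrame.continuousOn_A (fr : LocalFrame E z) : ContinuousOn fr.A fr.U := by
  rw [continuousOn_clm_apply]
  intro c x hx
  have h := fr.continuousOn (x, c) ⟨hx, mem_univ _⟩
  have h2 := ((tendsto_tangentBundle_iff (z := z) (fr.subset hx)).1 h).2
  exact h2.comp (tendsto_nhdsWithin_iff.2 ⟨((continuous_id.prodMk continuous_const).tendsto
    x).mono_left nhdsWithin_le_nhds, by
      filter_upwards [self_mem_nhdsWithin] with y hy using ⟨hy, mem_univ _⟩⟩)

/-- A continuous function which is homogeneous in the second variable and negative on a punctured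
fibre is negative on the nearby punctured fibres. -/
theorem eventually_neg_of_homogeneous {X : Type*} [TopologicalSpace X] {k : ℕ} {x₀ : X}
    {N : X → (Fin k → ℝ) → ℝ}
    (hc : ∀ c, ContinuousAt (uncurry N) (x₀, c))
    (hh : ∀ x c, ∀ t : ℝ, 0 < t → N x (t • c) = t * N x c)
    (h0 : ∀ c, c ≠ 0 → N x₀ c < 0) : ∀ᶠ x in 𝓝 x₀, ∀ c, c ≠ 0 → N x c < 0 := by
  have h1 : ∀ᶠ x in 𝓝 x₀, ∀ c ∈ Metric.sphere (0 : Fin k → ℝ) 1, N x c < 0 := by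
    refine (isCompact_sphere _ _).eventually_forall_of_forall_eventually fun c hc1 => ?_
    have : N x₀ c < 0 := h0 c (by rintro rfl; simp at hc1)
    exact (hc c).eventually (gt_mem_nhds this)
  filter_upwards [h1] with x hx c hc0
  have hn : 0 < ‖c‖ := norm_pos_iff.2 hc0
  have h2 := hx (‖c‖⁻¹ • c) (by simp [norm_smul, hn.ne'])
  rw [hh _ _ _ (inv_pos.2 hn)] at h2
  by_contra! h3
  have := mul_nonneg (inv_pos.2 hn).le h3
  linarith

/-- A family of continuous seminorms is continuous in the operator sense. -/
theorem eventually_abs_sub_le_of_homogeneous {X : Type*} [TopologicalSpace X] {k : ℕ} {x₀ : X}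
    {N : X → (Fin k → ℝ) → ℝ}
    (hc : ∀ c, ContinuousAt (uncurry N) (x₀, c))
    (hh : ∀ x c, ∀ t : ℝ, 0 < t → N x (t • c) = t * N x c) (h0 : ∀ x, N x 0 = 0)
    {η : ℝ} (hη : 0 < η) : ∀ᶠ x in 𝓝 x₀, ∀ c, |N x c - N x₀ c| ≤ η * ‖c‖ := by
  have h1 := eventually_neg_of_homogeneous (x₀ := x₀)
    (N := fun x c => |N x c - N x₀ c| - η * ‖c‖) (fun c => by
      have h2 : ContinuousAt (fun p : X × (Fin k → ℝ) => N x₀ p.2) (x₀, c) := by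
        have h3 : Tendsto (fun p : X × (Fin k → ℝ) => (x₀, p.2)) (𝓝 (x₀, c)) (𝓝 (x₀, c)) :=
          (continuous_const.prodMk continuous_snd).tendsto (x₀, c)
        exact (hc c).tendsto.comp h3
      exact ((hc c).sub h2).abs.sub (continuousAt_const.mul continuousAt_snd.norm))
    (fun x c t ht => by
      rw [hh x c t ht, hh x₀ c t ht, ← mul_sub, abs_mul, abs_of_pos ht, norm_smul,
        Real.norm_of_nonneg ht.le]; ring)
    (fun c hc0 => by simpa using mul_pos hη (norm_pos_iff.2 hc0))
  filter_upwards [h1] with x hx c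
  rcases eq_or_ne c 0 with rfl | hc0
  · simp [h0]
  · have := hx c hc0; linarith

end Frames

section Plaques

variable {d : ℕ} {M : Type*} [EMetricSpace M] [ChartedSpace (EuclideanSpace ℝ (Fin d)) M]
  [IsManifold (𝓡 d) ∞ M] [RiemannianBundle (fun x : M => TangentSpace (𝓡 d) x)]
  {E : (x : M) → Submodule ℝ (Tan d x)} {W : (x : M) → E x → M} {z : M}

/-- The tangent vector at `W x b` that is the image of `w ∈ E x` under the derivative of the plaque
`W x` at `b`. -/
def plaqueD (W : (x : M) → E x → M) (x : M) (b w : E x) : TangentBundle (𝓡 d) M :=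
  ⟨W x b, mfderiv 𝓘(ℝ, E x) (𝓡 d) (W x) b w⟩

/-- The size of `b ∈ E x`, measured by the derivative of the plaque `W x` at the origin. Since
`IsPlaqueFamily` prescribes only the range of this derivative, the vectors that `Df` contracts or
expands are its values, not the vectors `b`. -/
def plaqueSize (W : (x : M) → E x → M) (x : M) (b : E x) : ℝ := nrm (plaqueD W x 0 b)

/-- The parametrization of a plaque, in the coordinates given by a frame and a chart. -/
def plaqueMap (W : (x : M) → E x → M) (fr : LocalFrame E z) (x : M) (c : Fin fr.rank → ℝ) :
    EuclideanSpace ℝ (Fin d) := extChartAt (𝓡 d) z (W x (fr.j x c))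

/-- The derivative of `plaqueMap` in its last variable. -/
def plaqueMapD (W : (x : M) → E x → M) (fr : LocalFrame E z) (x : M) (c : Fin fr.rank → ℝ) :
    (Fin fr.rank → ℝ) →L[ℝ] EuclideanSpace ℝ (Fin d) :=
  ((chartD d z (W x (fr.j x c))).comp (mfderiv 𝓘(ℝ, E x) (𝓡 d) (W x) (fr.j x c))).comp
    (LinearMap.toContinuousLinearMap (fr.j x))

theorem plaqueMapD_apply (fr : LocalFrame E z) (x : M) (c w : Fin fr.rank → ℝ) :
    plaqueMapD W fr x c w = coord z (plaqueD W x (fr.j x c) (fr.j x w)) :=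
  rfl

namespace IsPlaqueFamily

variable (hW : IsPlaqueFamily E W) (fr : LocalFrame E z)
include hW

theorem hasFDerivAt_plaqueMap {x : M} {c : Fin fr.rank → ℝ}
    (h : W x (fr.j x c) ∈ (extChartAt (𝓡 d) z).source) :
    HasFDerivAt (plaqueMap W fr x) (plaqueMapD W fr x c) c := by
  have h1 : MDifferentiableAt 𝓘(ℝ, E x) (𝓡 d) (W x) (fr.j x c) :=
    ((hW.contMDiff x).mdifferentiable one_ne_zero) _
  exact (hasFDerivAt_extChartAt_comp h1 h).comp c
    (LinearMap.toContinuousLinearMap (fr.j x)).hasFDerivAt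

theorem continuousAt_plaque {x : M} (hx : x ∈ fr.U) (c : Fin fr.rank → ℝ) :
    ContinuousAt (fun p : M × (Fin fr.rank → ℝ) => W p.1 (fr.j p.1 p.2)) (x, c) := by
  have h1 : ContinuousAt (fun p : M × (Fin fr.rank → ℝ) =>
      (⟨⟨p.1, fr.j p.1 p.2⟩, (fr.j p.1 p.2).2⟩ : TotE E)) (x, c) :=
    tendsto_subtype_rng.2 (fr.continuousOn.continuousAt (fr.isOpen_prod.mem_nhds ⟨hx, mem_univ _⟩))
  exact hW.continuous.continuousAt.comp h1

theorem continuousAt_plaqueD {x : M} (hx : x ∈ fr.U) (c w : Fin fr.rank → ℝ) :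
    ContinuousAt (fun p : M × (Fin fr.rank → ℝ) × (Fin fr.rank → ℝ) =>
      plaqueD W p.1 (fr.j p.1 p.2.1) (fr.j p.1 p.2.2)) (x, c, w) := by
  have hc : ∀ e, ContinuousAt (fun p : M × (Fin fr.rank → ℝ) =>
      (⟨p.1, (fr.j p.1 p.2 : Tan d p.1)⟩ : TangentBundle (𝓡 d) M)) (x, e) := fun e =>
    fr.continuousOn.continuousAt (fr.isOpen_prod.mem_nhds ⟨hx, mem_univ _⟩)
  have h1 : ContinuousAt (fun p : M × (Fin fr.rank → ℝ) × (Fin fr.rank → ℝ) =>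
      (⟨⟨p.1, (fr.j p.1 p.2.1, fr.j p.1 p.2.2)⟩, (fr.j p.1 p.2.1).2, (fr.j p.1 p.2.2).2⟩ :
        TotEE E)) (x, c, w) := by
    refine tendsto_subtype_rng.2 ?_
    have hind : IsInducing (fun p : TotalSpace (EuclideanSpace ℝ (Fin d) × EuclideanSpace ℝ (Fin d))
        ((fun x : M => TangentSpace (𝓡 d) x) ×ᵇ (fun x : M => TangentSpace (𝓡 d) x)) =>
        ((⟨p.1, p.2.1⟩ : TangentBundle (𝓡 d) M), (⟨p.1, p.2.2⟩ : TangentBundle (𝓡 d) M))) := ⟨rfl⟩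
    refine hind.tendsto_nhds_iff.2 ?_
    refine Tendsto.prodMk_nhds ?_ ?_
    · exact (hc c).tendsto.comp ((continuous_fst.prodMk
        (continuous_fst.comp continuous_snd)).tendsto (x, c, w))
    · exact (hc w).tendsto.comp ((continuous_fst.prodMk
        (continuous_snd.comp continuous_snd)).tendsto (x, c, w))
  exact hW.continuous_deriv.continuousAt.comp h1

theorem continuousAt_plaqueMapD {x : M} (hx : x ∈ fr.U) (c : Fin fr.rank → ℝ)
    (h : W x (fr.j x c) ∈ (extChartAt (𝓡 d) z).source) :
    ContinuousAt (fun p : M × (Fin fr.rank → ℝ) => plaqueMapD W fr p.1 p.2) (x, c) := by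
  have key : ∀ w, ContinuousAt (fun p : M × (Fin fr.rank → ℝ) => plaqueMapD W fr p.1 p.2 w)
      (x, c) := by
    intro w
    have h1 := hW.continuousAt_plaqueD fr hx c w
    have h2 := ((tendsto_tangentBundle_iff (z := z) h).1 h1).2
    have h3 : Tendsto (fun p : M × (Fin fr.rank → ℝ) => (p.1, p.2, w)) (𝓝 (x, c))
        (𝓝 (x, c, w)) :=
      (continuous_fst.prodMk (continuous_snd.prodMk continuous_const)).tendsto (x, c)
    exact h2.comp h3
  exact continuousAt_clm_apply.2 key

theorem plaqueMapD_injective {x : M} (hx : x ∈ fr.U) (c : Fin fr.rank → ℝ)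
    (h : W x (fr.j x c) ∈ (extChartAt (𝓡 d) z).source) : Injective (plaqueMapD W fr x c) :=
  (chartD_injective h).comp ((hW.injective_mfderiv x _).comp (fr.bijective x hx).1)

theorem map_j_zero (x : M) : W x (fr.j x 0) = x := by
  rw [_root_.map_zero, hW.map_zero]

theorem mem_source_zero {x : M} (hx : x ∈ fr.U) :
    W x (fr.j x 0) ∈ (extChartAt (𝓡 d) z).source := by
  rw [hW.map_j_zero]; exact fr.subset hx

theorem plaqueD_zero_mem (x : M) (b : E x) : plaqueD W x 0 b ∈ bundleSet E := by
  have h : mfderiv 𝓘(ℝ, E x) (𝓡 d) (W x) 0 b ∈ (mfderiv 𝓘(ℝ, E x) (𝓡 d) (W x) 0).range := ⟨b, rfl⟩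
  rw [hW.tangent x] at h
  exact h

theorem exists_plaqueD_zero {x y : M} (hy : W x 0 = y) {v : Tan d y} (hv : v ∈ E y) :
    ∃ b, plaqueD W x 0 b = ⟨y, v⟩ := by
  subst hy
  rw [← hW.tangent x] at hv
  obtain ⟨b, rfl⟩ := hv
  exact ⟨b, rfl⟩

theorem exists_plaqueMapD_zero_eq {x : M} (hx : x ∈ fr.U) {v : Tan d x} (hv : v ∈ E x) :
    ∃ c, plaqueMapD W fr x 0 c = chartD d z x v := by
  obtain ⟨b, hb⟩ := hW.exists_plaqueD_zero (hW.map_zero x) hv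
  obtain ⟨c, rfl⟩ := (fr.bijective x hx).2 b
  refine ⟨c, ?_⟩
  rw [plaqueMapD_apply, _root_.map_zero, hb]; rfl

theorem exists_chartD_eq {x : M} (c : Fin fr.rank → ℝ) :
    ∃ v ∈ E x, chartD d z x v = plaqueMapD W fr x 0 c := by
  have h := hW.plaqueD_zero_mem x (fr.j x c)
  have h1 : (plaqueD W x 0 (fr.j x c)).1 = x := hW.map_zero x
  rw [plaqueMapD_apply, _root_.map_zero]
  generalize plaqueD W x 0 (fr.j x c) = u at h h1
  subst h1
  exact ⟨u.2, h, rfl⟩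

end IsPlaqueFamily

theorem plaqueD_smul (x : M) (b w : E x) (t : ℝ) :
    plaqueD W x b (t • w) = ⟨(plaqueD W x b w).1, t • (plaqueD W x b w).2⟩ :=
  congrArg (TotalSpace.mk (W x b)) ((mfderiv 𝓘(ℝ, E x) (𝓡 d) (W x) b).map_smul t w)

theorem plaqueSize_nonneg (x : M) (b : E x) : 0 ≤ plaqueSize W x b :=
  norm_nonneg (plaqueD W x 0 b).2

theorem nrm_smul (u : TangentBundle (𝓡 d) M) (t : ℝ) :
    nrm (⟨u.1, t • u.2⟩ : TangentBundle (𝓡 d) M) = |t| * nrm u :=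
  norm_smul t u.2

theorem plaqueSize_smul (x : M) (b : E x) (t : ℝ) :
    plaqueSize W x (t • b) = |t| * plaqueSize W x b := by
  rw [plaqueSize, plaqueD_smul, nrm_smul]; rfl

theorem plaqueSize_zero (x : M) : plaqueSize W x 0 = 0 := by
  have := plaqueSize_smul (W := W) x 0 0
  simpa using this

theorem IsPlaqueFamily.plaqueSize_pos (hW : IsPlaqueFamily E W) {x : M} {b : E x} (hb : b ≠ 0) :
    0 < plaqueSize W x b := by
  refine lt_of_le_of_ne (plaqueSize_nonneg x b) fun h => hb ?_
  have h1 : (plaqueD W x 0 b).2 = 0 := norm_eq_zero.1 h.symm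
  exact hW.injective_mfderiv x 0 (h1.trans (mfderiv 𝓘(ℝ, E x) (𝓡 d) (W x) 0).map_zero.symm)

theorem IsPlaqueFamily.continuousAt_plaqueSize [IsContinuousRiemannianBundle
    (EuclideanSpace ℝ (Fin d)) (fun x : M => TangentSpace (𝓡 d) x)] (hW : IsPlaqueFamily E W)
    (fr : LocalFrame E z) {x : M} (hx : x ∈ fr.U) (c : Fin fr.rank → ℝ) :
    ContinuousAt (fun p : M × (Fin fr.rank → ℝ) => plaqueSize W p.1 (fr.j p.1 p.2)) (x, c) := by
  have h1 := continuous_nrm.continuousAt.comp (hW.continuousAt_plaqueD fr hx 0 c)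
  have h2 : Tendsto (fun p : M × (Fin fr.rank → ℝ) =>
      (p.1, ((0 : Fin fr.rank → ℝ)), p.2)) (𝓝 (x, c)) (𝓝 (x, 0, c)) :=
    (continuous_fst.prodMk (continuous_const.prodMk continuous_snd)).tendsto (x, c)
  have h3 := h1.tendsto.comp h2
  simpa only [ContinuousAt, Function.comp_def, _root_.map_zero] using! h3

end Plaques

end

/-! ### Uniform strict differentiability of plaques at their centres -/

section

section Approximation

/-- A family of maps whose derivative is jointly continuous at `(x₀, 0)` is uniformly strictly
differentiable there. -/
theorem exists_approx_of_continuousAt_fderiv {X V H : Type*} [TopologicalSpace X]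
    [NormedAddCommGroup V] [NormedSpace ℝ V] [NormedAddCommGroup H] [NormedSpace ℝ H]
    {x₀ : X} {G : X → V → H} {G' : X → V → V →L[ℝ] H}
    (hG : ∀ᶠ p in 𝓝 (x₀, (0 : V)), HasFDerivAt (G p.1) (G' p.1 p.2) p.2)
    (hG' : ContinuousAt (fun p : X × V => G' p.1 p.2) (x₀, 0)) {η : ℝ} (hη : 0 < η) :
    ∃ r > 0, ∀ᶠ x in 𝓝 x₀, ∀ c ∈ Metric.closedBall (0 : V) r, ∀ c' ∈ Metric.closedBall (0 : V) r,
      ‖G x c - G x c' - G' x₀ 0 (c - c')‖ ≤ η * ‖c - c'‖ := by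
  have h1 : ∀ᶠ p in 𝓝 (x₀, (0 : V)), HasFDerivAt (G p.1) (G' p.1 p.2) p.2 ∧
      ‖G' p.1 p.2 - G' x₀ 0‖ ≤ η := by
    refine hG.and ?_
    have h2 : Tendsto (fun p : X × V => ‖G' p.1 p.2 - G' x₀ 0‖) (𝓝 (x₀, 0)) (𝓝 0) := by
      have h := (hG'.tendsto.sub_const (G' x₀ 0)).norm
      simpa using h
    exact (h2.eventually (gt_mem_nhds hη)).mono fun p hp => hp.le
  rw [nhds_prod_eq, eventually_prod_iff] at h1
  obtain ⟨P, hP, Q, hQ, hPQ⟩ := h1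
  obtain ⟨r, hr, hrQ⟩ := Metric.nhds_basis_closedBall.eventually_iff.1 hQ
  refine ⟨r, hr, hP.mono fun x hx c hc c' hc' => ?_⟩
  exact (convex_closedBall (0 : V) r).norm_image_sub_le_of_norm_hasFDerivWithin_le'
    (fun e he => (hPQ hx (hrQ he)).1.hasFDerivWithinAt) (fun e he => (hPQ hx (hrQ he)).2) hc' hc

theorem exists_pos_mul_norm_le {V H : Type*} [NormedAddCommGroup V] [NormedSpace ℝ V]
    [FiniteDimensional ℝ V] [NormedAddCommGroup H] [NormedSpace ℝ H]
    {A : V →L[ℝ] H} (hA : Injective A) : ∃ a > 0, ∀ c, a * ‖c‖ ≤ ‖A c‖ := by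
  obtain ⟨K, hK, h⟩ := (A : V →ₗ[ℝ] H).injective_iff_antilipschitz.1 hA
  refine ⟨(K : ℝ)⁻¹, by positivity, fun c => ?_⟩
  have := h.le_mul_dist c 0
  rw [dist_zero_right, LinearMap.map_zero, dist_zero_right] at this
  rw [inv_mul_le_iff₀ (by positivity)]
  exact this

end Approximation

variable {d : ℕ} {M : Type*} [EMetricSpace M] [ChartedSpace (EuclideanSpace ℝ (Fin d)) M]
  [IsManifold (𝓡 d) ∞ M] [RiemannianBundle (fun x : M => TangentSpace (𝓡 d) x)]
  {E : (x : M) → Submodule ℝ (Tan d x)} {W : (x : M) → E x → M} {z : M}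

theorem IsPlaqueFamily.eventually_mem_source (hW : IsPlaqueFamily E W) (fr : LocalFrame E z) :
    ∀ᶠ p : M × (Fin fr.rank → ℝ) in 𝓝 (z, 0),
      p.1 ∈ fr.U ∧ W p.1 (fr.j p.1 p.2) ∈ (extChartAt (𝓡 d) z).source :=
  (continuousAt_fst.eventually (fr.isOpen.mem_nhds fr.mem)).and
    ((hW.continuousAt_plaque fr fr.mem 0).eventually
      ((isOpen_extChartAt_source z).mem_nhds (hW.mem_source_zero fr fr.mem)))

/-- The plaques near `z` are uniformly strictly differentiable at their centres: in coordinates they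
are uniformly close to their linear part at `z`. -/
theorem IsPlaqueFamily.exists_approx (hW : IsPlaqueFamily E W) (fr : LocalFrame E z) {η : ℝ}
    (hη : 0 < η) :
    ∃ r > 0, ∀ᶠ x in 𝓝 z, ∀ c ∈ Metric.closedBall (0 : Fin fr.rank → ℝ) r,
      ∀ c' ∈ Metric.closedBall (0 : Fin fr.rank → ℝ) r,
      ‖plaqueMap W fr x c - plaqueMap W fr x c' - plaqueMapD W fr z 0 (c - c')‖
        ≤ η * ‖c - c'‖ :=
  exists_approx_of_continuousAt_fderiv
    ((hW.eventually_mem_source fr).mono fun _ hp => hW.hasFDerivAt_plaqueMap fr hp.2)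
    (hW.continuousAt_plaqueMapD fr fr.mem 0 (hW.mem_source_zero fr fr.mem)) hη

/-- Uniform strict differentiability of a plaque family composed with a `C^1` map `h`. -/
theorem IsPlaqueFamily.exists_approx_comp (hW : IsPlaqueFamily E W) (fr : LocalFrame E z)
    {h : M → M} (hh : ContMDiff (𝓡 d) (𝓡 d) 1 h) :
    ∃ A : (Fin fr.rank → ℝ) →L[ℝ] EuclideanSpace ℝ (Fin d),
      (∀ c, A c = coord (h z) (tangentMap (𝓡 d) (𝓡 d) h (plaqueD W z 0 (fr.j z c)))) ∧
      ∀ η > 0, ∃ r > 0, ∀ᶠ x in 𝓝 z, ∀ c ∈ Metric.closedBall (0 : Fin fr.rank → ℝ) r,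
      ∀ c' ∈ Metric.closedBall (0 : Fin fr.rank → ℝ) r,
      ‖extChartAt (𝓡 d) (h z) (h (W x (fr.j x c))) - extChartAt (𝓡 d) (h z) (h (W x (fr.j x c')))
        - A (c - c')‖ ≤ η * ‖c - c'‖ := by
  have hhd : MDifferentiable (𝓡 d) (𝓡 d) h := hh.mdifferentiable one_ne_zero
  let G' : (x : M) → (Fin fr.rank → ℝ) → (Fin fr.rank → ℝ) →L[ℝ] EuclideanSpace ℝ (Fin d) :=
    fun x c => ((chartD d (h z) (h (W x (fr.j x c)))).comp
      ((mfderiv (𝓡 d) (𝓡 d) h (W x (fr.j x c))).comp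
        (mfderiv 𝓘(ℝ, E x) (𝓡 d) (W x) (fr.j x c)))).comp
      (LinearMap.toContinuousLinearMap (fr.j x))
  have hG'a : ∀ x c w, G' x c w
      = coord (h z) (tangentMap (𝓡 d) (𝓡 d) h (plaqueD W x (fr.j x c) (fr.j x w))) :=
    fun x c w => rfl
  have hz : h (W z (fr.j z 0)) ∈ (extChartAt (𝓡 d) (h z)).source := by
    rw [hW.map_j_zero]; exact mem_extChartAt_source _
  have hcont : ContinuousAt (fun p : M × (Fin fr.rank → ℝ) => h (W p.1 (fr.j p.1 p.2))) (z, 0) :=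
    hh.continuous.continuousAt.comp (hW.continuousAt_plaque fr fr.mem 0)
  refine ⟨G' z 0, fun c => by rw [hG'a, _root_.map_zero], fun η hη => ?_⟩
  refine exists_approx_of_continuousAt_fderiv
    (G := fun x c => extChartAt (𝓡 d) (h z) (h (W x (fr.j x c)))) (G' := G') ?_ ?_ hη
  · filter_upwards [hcont.eventually ((isOpen_extChartAt_source (h z)).mem_nhds hz)] with p hp
    have h1 : MDifferentiableAt 𝓘(ℝ, E p.1) (𝓡 d) (W p.1) (fr.j p.1 p.2) :=
      ((hW.contMDiff p.1).mdifferentiable one_ne_zero) _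
    have h2 := hasFDerivAt_extChartAt_comp (h := h ∘ W p.1) ((hhd _).comp _ h1) hp
    rw [mfderiv_comp _ (hhd _) h1] at h2
    exact h2.comp p.2 (LinearMap.toContinuousLinearMap (fr.j p.1)).hasFDerivAt
  · refine continuousAt_clm_apply.2 fun w => ?_
    have h1 : ContinuousAt (fun p : M × (Fin fr.rank → ℝ) × (Fin fr.rank → ℝ) =>
        tangentMap (𝓡 d) (𝓡 d) h (plaqueD W p.1 (fr.j p.1 p.2.1) (fr.j p.1 p.2.2))) (z, 0, w) :=
      (hh.continuous_tangentMap le_rfl).continuousAt.comp (hW.continuousAt_plaqueD fr fr.mem 0 w)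
    have h2 := ((tendsto_tangentBundle_iff (z := h z) hz).1 h1).2
    have h3 : Tendsto (fun p : M × (Fin fr.rank → ℝ) => (p.1, p.2, w)) (𝓝 (z, 0))
        (𝓝 (z, 0, w)) :=
      (continuous_fst.prodMk (continuous_snd.prodMk continuous_const)).tendsto (z, 0)
    exact h2.comp h3

end

/-! ### Sizes of vectors in frames and contraction of plaques near a point -/

section

variable {d : ℕ} {M : Type*} [EMetricSpace M] [ChartedSpace (EuclideanSpace ℝ (Fin d)) M]
  [IsManifold (𝓡 d) ∞ M] [RiemannianBundle (fun x : M => TangentSpace (𝓡 d) x)]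
  [IsContinuousRiemannianBundle (EuclideanSpace ℝ (Fin d)) (fun x : M => TangentSpace (𝓡 d) x)]
  {E : (x : M) → Submodule ℝ (Tan d x)} {W : (x : M) → E x → M} {z : M}

instance (x : M) : FiniteDimensional ℝ (Tan d x) :=
  inferInstanceAs (FiniteDimensional ℝ (EuclideanSpace ℝ (Fin d)))

theorem continuous_of_continuousAt_uncurry {X Y Z : Type*} [TopologicalSpace X]
    [TopologicalSpace Y] [TopologicalSpace Z] {f : X → Y → Z} {x : X}
    (h : ∀ y, ContinuousAt (uncurry f) (x, y)) : Continuous (f x) :=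
  continuous_iff_continuousAt.2 fun y => (h y).tendsto.comp
    ((continuous_const.prodMk continuous_id).tendsto y)

theorem plaqueSize_add_le (x : M) (b b' : E x) :
    plaqueSize W x (b + b') ≤ plaqueSize W x b + plaqueSize W x b' :=
  (congrArg (fun v : Tan d (W x 0) => ‖v‖)
    ((mfderiv 𝓘(ℝ, E x) (𝓡 d) (W x) 0).map_add b b')).trans_le
    (norm_add_le (E := Tan d (W x 0)) _ _)

/-- `plaqueSize` in the coordinates of a frame. -/
def frameSize (W : (x : M) → E x → M) (fr : LocalFrame E z) (x : M) (c : Fin fr.rank → ℝ) : ℝ :=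
  plaqueSize W x (fr.j x c)

theorem frameSize_zero (fr : LocalFrame E z) (x : M) : frameSize W fr x 0 = 0 := by
  rw [frameSize, _root_.map_zero, plaqueSize_zero]

theorem frameSize_smul (fr : LocalFrame E z) (x : M) (c : Fin fr.rank → ℝ) {t : ℝ} (ht : 0 < t) :
    frameSize W fr x (t • c) = t * frameSize W fr x c := by
  rw [frameSize, map_smul, plaqueSize_smul, abs_of_pos ht]; rfl

theorem frameSize_add_le (fr : LocalFrame E z) (x : M) (c c' : Fin fr.rank → ℝ) :
    frameSize W fr x (c + c') ≤ frameSize W fr x c + frameSize W fr x c' := by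
  rw [frameSize, map_add]; exact plaqueSize_add_le x _ _

theorem IsPlaqueFamily.frameSize_pos (hW : IsPlaqueFamily E W) (fr : LocalFrame E z) {x : M}
    (hx : x ∈ fr.U) {c : Fin fr.rank → ℝ} (hc : c ≠ 0) : 0 < frameSize W fr x c :=
  hW.plaqueSize_pos fun h => hc ((fr.bijective x hx).1 (h.trans (_root_.map_zero _).symm))

theorem IsPlaqueFamily.continuousAt_frameSize (hW : IsPlaqueFamily E W) (fr : LocalFrame E z)
    (c : Fin fr.rank → ℝ) : ContinuousAt (uncurry (frameSize W fr)) (z, c) :=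
  hW.continuousAt_plaqueSize fr fr.mem c

theorem IsPlaqueFamily.continuous_frameSize (hW : IsPlaqueFamily E W) (fr : LocalFrame E z) :
    Continuous (frameSize W fr z) :=
  continuous_of_continuousAt_uncurry (hW.continuousAt_frameSize fr)

theorem IsPlaqueFamily.eventually_abs_frameSize_sub_le (hW : IsPlaqueFamily E W)
    (fr : LocalFrame E z) {η : ℝ} (hη : 0 < η) :
    ∀ᶠ x in 𝓝 z, ∀ c, |frameSize W fr x c - frameSize W fr z c| ≤ η * ‖c‖ :=
  eventually_abs_sub_le_of_homogeneous (hW.continuousAt_frameSize fr)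
    (fun x c _ ht => frameSize_smul fr x c ht) (frameSize_zero fr) hη

/-- The sizes at the points near `z` are bounded below by one multiple of the norm of the coordinates,
by compactness of the unit sphere. -/
theorem IsPlaqueFamily.exists_pos_le_frameSize (hW : IsPlaqueFamily E W) (fr : LocalFrame E z) :
    ∃ m > 0, ∀ᶠ x in 𝓝 z, ∀ c, m * ‖c‖ ≤ frameSize W fr x c := by
  have h1 : ∃ m > 0, ∀ c, c ≠ 0 → m * ‖c‖ < frameSize W fr z c := by
    rcases (Metric.sphere (0 : Fin fr.rank → ℝ) 1).eq_empty_or_nonempty with he | hne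
    · refine ⟨1, one_pos, fun c hc0 => ?_⟩
      have : ‖c‖⁻¹ • c ∈ Metric.sphere (0 : Fin fr.rank → ℝ) 1 := by
        simp [norm_smul, norm_ne_zero_iff.2 hc0]
      rw [he] at this; exact this.elim
    · obtain ⟨c₀, hc₀, hmin⟩ := (isCompact_sphere (0 : Fin fr.rank → ℝ) 1).exists_isMinOn hne
        (hW.continuous_frameSize fr).continuousOn
      have hc00 : c₀ ≠ 0 := by rintro rfl; simp at hc₀
      have hpos : 0 < frameSize W fr z c₀ := hW.frameSize_pos fr fr.mem hc00
      refine ⟨frameSize W fr z c₀ / 2, half_pos hpos, fun c h0 => ?_⟩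
      have hn : 0 < ‖c‖ := norm_pos_iff.2 h0
      have h2 : frameSize W fr z c₀ ≤ frameSize W fr z (‖c‖⁻¹ • c) :=
        hmin (show ‖c‖⁻¹ • c ∈ Metric.sphere (0 : Fin fr.rank → ℝ) 1 by simp [norm_smul, hn.ne'])
      rw [frameSize_smul _ _ _ (inv_pos.2 hn), inv_mul_eq_div, le_div_iff₀ hn] at h2
      nlinarith
  obtain ⟨m, hm, hmc⟩ := h1
  refine ⟨m, hm, ?_⟩
  have h2 := eventually_neg_of_homogeneous (x₀ := z)
    (N := fun x c => m * ‖c‖ - frameSize W fr x c)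
    (fun c => (continuousAt_const.mul continuousAt_snd.norm).sub (hW.continuousAt_frameSize fr c))
    (fun x c t ht => by
      rw [norm_smul, frameSize_smul _ _ _ ht, Real.norm_of_nonneg ht.le]; ring)
    (fun c hc0 => sub_neg.2 (hmc c hc0))
  filter_upwards [h2] with x hx c
  rcases eq_or_ne c 0 with rfl | h0
  · rw [norm_zero, mul_zero, frameSize_zero]
  · exact (sub_neg.1 (hx c h0)).le

theorem IsPlaqueFamily.exists_frameSize_le (hW : IsPlaqueFamily E W)
    (fr : LocalFrame E z) : ∃ C > 0, ∀ c, frameSize W fr z c ≤ C * ‖c‖ := by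
  have hcz := hW.continuous_frameSize fr
  -- near `t = 0` the function `t * frameSize W fr z c` is at most the norm of `c`
  have h := eventually_abs_sub_le_of_homogeneous (x₀ := (0 : ℝ))
    (N := fun t c => t * frameSize W fr z c)
    (fun c => (continuous_fst.mul (hcz.comp continuous_snd)).continuousAt)
    (fun x c t ht => by rw [frameSize_smul _ _ _ ht]; ring)
    (fun x => by rw [frameSize_zero, mul_zero]) one_pos
  obtain ⟨ε, hε, h⟩ := Metric.eventually_nhds_iff.1 h
  have h2 := h (y := ε / 2) (by simp [abs_of_pos hε, hε])
  refine ⟨(ε / 2)⁻¹, by positivity, fun c => ?_⟩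
  have h3 := h2 c
  rw [zero_mul, sub_zero] at h3
  have h4 := (le_abs_self _).trans h3
  rw [← div_eq_inv_mul, le_div_iff₀ (by positivity)]
  linarith

/-- If `h` maps a point of a plaque to a point of a plaque, both close to the centres, then in
coordinates the second point is controlled by the linear part of `h`. -/
theorem IsPlaqueFamily.exists_local_estimate (hW : IsPlaqueFamily E W)
    {h : M → M} (hh : ContMDiff (𝓡 d) (𝓡 d) 1 h)
    (hinv : ∀ u ∈ bundleSet E, tangentMap (𝓡 d) (𝓡 d) h u ∈ bundleSet E) {κ₀ κ : ℝ}
    (hκ₀ : 0 ≤ κ₀) (hκ : κ₀ < κ)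
    (hcontr : ∀ u ∈ bundleSet E, nrm (tangentMap (𝓡 d) (𝓡 d) h u) ≤ κ₀ * nrm u)
    (fr : LocalFrame E z) (fr' : LocalFrame E (h z)) :
    ∃ K ≥ 1, ∃ r > 0, ∀ᶠ x in 𝓝 z, ∀ c c', ‖c‖ ≤ r → ‖c'‖ ≤ r →
      W (h x) (fr'.j (h x) c') = h (W x (fr.j x c)) →
      ‖c'‖ ≤ K * ‖c‖ ∧ frameSize W fr' (h x) c' ≤ κ * frameSize W fr x c := by
  obtain ⟨A, hA, happ⟩ := hW.exists_approx_comp fr hh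
  obtain ⟨a, ha, haA⟩ := exists_pos_mul_norm_le (hW.plaqueMapD_injective fr' fr'.mem 0
    (hW.mem_source_zero fr' fr'.mem))
  set A' := plaqueMapD W fr' (h z) 0 with hA'
  -- `B c` is the vector that the plaque at `h z` sends to `A c`; by hypothesis its size is at most
  -- `κ₀` times that of `c`
  have hB : ∀ c, ∃ c', A' c' = A c ∧
      frameSize W fr' (h z) c' ≤ κ₀ * frameSize W fr z c := by
    intro c
    have h1 := hinv _ (hW.plaqueD_zero_mem z (fr.j z c))
    have h2 : W (h z) 0 = (tangentMap (𝓡 d) (𝓡 d) h (plaqueD W z 0 (fr.j z c))).1 := by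
      rw [hW.map_zero]; exact congrArg h (hW.map_zero z).symm
    obtain ⟨b, hb⟩ := hW.exists_plaqueD_zero h2 h1
    obtain ⟨c', rfl⟩ := (fr'.bijective (h z) fr'.mem).2 b
    refine ⟨c', ?_, ?_⟩
    · rw [hA', plaqueMapD_apply, _root_.map_zero, hb, hA]
    · rw [frameSize, plaqueSize, hb]
      exact hcontr _ (hW.plaqueD_zero_mem z (fr.j z c))
  choose B hBA hBs using hB
  obtain ⟨m, hm, hmx⟩ := hW.exists_pos_le_frameSize fr
  obtain ⟨C, hC, hCc⟩ := hW.exists_frameSize_le fr'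
  -- `K` bounds the linear growth in coordinates, `Q` collects the errors of size `η`.
  set K : ℝ := 2 * ‖A‖ / a + 1 with hK
  have hK1 : 1 ≤ K := by rw [hK]; have : 0 ≤ 2 * ‖A‖ / a := by positivity
                         linarith
  set Q : ℝ := κ₀ + K + C * ((1 + K) / a) with hQ
  have hQ0 : 0 < Q := by positivity
  obtain ⟨η, hη, hη1, hη2⟩ : ∃ η > 0, η ≤ a / 2 ∧ η * Q ≤ (κ - κ₀) * m := by
    refine ⟨min (a / 2) ((κ - κ₀) * m / Q), lt_min (by positivity)
      (div_pos (mul_pos (by linarith) hm) hQ0), min_le_left _ _, ?_⟩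
    rw [← le_div_iff₀ hQ0]; exact min_le_right _ _
  obtain ⟨r₁, hr₁, h1⟩ := happ η hη
  obtain ⟨r₂, hr₂, h2⟩ := hW.exists_approx fr' hη
  have hs1 := hW.eventually_abs_frameSize_sub_le fr hη
  have hs2 := hW.eventually_abs_frameSize_sub_le fr' hη
  have hcz := hh.continuous.tendsto z
  refine ⟨K, hK1, min r₁ r₂, lt_min hr₁ hr₂, ?_⟩
  filter_upwards [h1, hcz.eventually h2, hs1, hcz.eventually hs2, hmx] with x h1 h2 hs1 hs2 hmx
  -- up to errors of order `η`, the point with coordinate `c'` is the one with coordinate `B c`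
  have key : ∀ c c', ‖c‖ ≤ min r₁ r₂ → ‖c'‖ ≤ min r₁ r₂ →
      W (h x) (fr'.j (h x) c') = h (W x (fr.j x c)) →
      ‖c'‖ ≤ K * ‖c‖ ∧ ‖c' - B c‖ ≤ η * ((1 + K) / a) * ‖c‖ := by
    intro c c' hc hc' hcc
    have e1 := h1 c (by simpa using hc.trans (min_le_left _ _)) 0 (by simpa using hr₁.le)
    have e2 := h2 c' (by simpa using hc'.trans (min_le_right _ _)) 0 (by simpa using hr₂.le)
    simp only [sub_zero, plaqueMap, _root_.map_zero, hW.map_zero] at e1 e2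
    rw [hcc] at e2
    have e3 : ‖A' c' - A c‖ ≤ η * ‖c‖ + η * ‖c'‖ := by
      rw [show A' c' - A c = (extChartAt (𝓡 d) (h z) (h (W x (fr.j x c)))
        - extChartAt (𝓡 d) (h z) (h x) - A c) - (extChartAt (𝓡 d) (h z) (h (W x (fr.j x c)))
        - extChartAt (𝓡 d) (h z) (h x) - A' c') by abel]
      exact (norm_sub_le _ _).trans (add_le_add e1 e2)
    have e4 : a * ‖c'‖ ≤ ‖A‖ * ‖c‖ + (η * ‖c‖ + η * ‖c'‖) :=
      calc a * ‖c'‖ ≤ ‖A' c'‖ := haA c'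
        _ = ‖A c + (A' c' - A c)‖ := by rw [add_sub_cancel]
        _ ≤ ‖A‖ * ‖c‖ + (η * ‖c‖ + η * ‖c'‖) :=
          (norm_add_le _ _).trans (add_le_add (A.le_opNorm c) e3)
    have e5 : ‖c'‖ ≤ K * ‖c‖ := by
      have g1 : η * ‖c‖ ≤ a / 2 * ‖c‖ := mul_le_mul_of_nonneg_right hη1 (norm_nonneg _)
      have g2 : η * ‖c'‖ ≤ a / 2 * ‖c'‖ := mul_le_mul_of_nonneg_right hη1 (norm_nonneg _)
      have g3 : a * K = 2 * ‖A‖ + a := by rw [hK]; field_simp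
      have g4 : a * ‖c'‖ ≤ a * (K * ‖c‖) := by rw [← mul_assoc, g3]; nlinarith
      exact le_of_mul_le_mul_left g4 ha
    refine ⟨e5, ?_⟩
    have e6 : a * ‖c' - B c‖ ≤ η * ‖c‖ + η * (K * ‖c‖) := by
      refine (haA _).trans ?_
      rw [map_sub, hBA]
      exact e3.trans (by gcongr)
    rw [show η * ((1 + K) / a) * ‖c‖ = (η * ‖c‖ + η * (K * ‖c‖)) / a by ring, le_div_iff₀ ha]
    linarith
  intro c c' hc hc' hcc
  obtain ⟨g1, g2⟩ := key c c' hc hc' hcc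
  refine ⟨g1, ?_⟩
  have f1 := (abs_le.1 (hs2 c')).2
  have f2 := (abs_le.1 (hs1 c)).1
  have f3 : frameSize W fr' (h z) c' ≤ frameSize W fr' (h z) (B c)
      + frameSize W fr' (h z) (c' - B c) := by
    simpa using frameSize_add_le (W := W) fr' (h z) (B c) (c' - B c)
  have f4 := hCc (c' - B c)
  have f5 := hBs c
  have f6 : C * ‖c' - B c‖ ≤ C * (η * ((1 + K) / a) * ‖c‖) := by gcongr
  have f7 : η * ‖c'‖ ≤ η * (K * ‖c‖) := by gcongr
  have f8 : κ₀ * frameSize W fr z c ≤ κ₀ * (frameSize W fr x c + η * ‖c‖) := by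
    gcongr; linarith
  have f9 : η * Q * ‖c‖ ≤ (κ - κ₀) * m * ‖c‖ := by gcongr
  have f10 : (κ - κ₀) * (m * ‖c‖) ≤ (κ - κ₀) * frameSize W fr x c :=
    mul_le_mul_of_nonneg_left (hmx c) (by linarith)
  have f11 : η * Q * ‖c‖ = κ₀ * (η * ‖c‖) + η * (K * ‖c‖) + C * (η * ((1 + K) / a) * ‖c‖) := by
    rw [hQ]; ring
  nlinarith

/-- If a `C^1` map `h` contracts `E` and maps each plaque into the plaque at the image point, then
it contracts the points of the plaques that are close to the centres. -/
theorem IsPlaqueFamily.exists_local_contraction (hE : IsSubbundle E) (hW : IsPlaqueFamily E W)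
    {h : M → M} (hh : ContMDiff (𝓡 d) (𝓡 d) 1 h)
    (hinv : ∀ u ∈ bundleSet E, tangentMap (𝓡 d) (𝓡 d) h u ∈ bundleSet E) {κ₀ κ : ℝ}
    (hκ₀ : 0 ≤ κ₀) (hκ : κ₀ < κ)
    (hcontr : ∀ u ∈ bundleSet E, nrm (tangentMap (𝓡 d) (𝓡 d) h u) ≤ κ₀ * nrm u)
    (htrap : ∀ x b, h (W x b) ∈ range (W (h x))) (z : M) :
    ∃ δ > 0, ∀ᶠ x in 𝓝 z, ∀ b : E x, plaqueSize W x b ≤ δ →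
      ∃ b', W (h x) b' = h (W x b) ∧ plaqueSize W (h x) b' ≤ κ * plaqueSize W x b := by
  obtain ⟨fr⟩ := hE.nonempty_localFrame z
  obtain ⟨fr'⟩ := hE.nonempty_localFrame (h z)
  obtain ⟨K, hK1, r, hr0, hkey⟩ := hW.exists_local_estimate hh hinv hκ₀ hκ hcontr fr fr'
  obtain ⟨m, hm, hmx⟩ := hW.exists_pos_le_frameSize fr
  -- a radius so small that `K` times it is less than `r`
  set ρ := r / (2 * K) with hρ
  have hρ0 : 0 < ρ := by positivity
  have hρr : K * ρ < r := by
    rw [hρ]; field_simp; linarith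
  refine ⟨m * ρ, by positivity, ?_⟩
  filter_upwards [hkey, hmx, fr.isOpen.mem_nhds fr.mem,
    hh.continuous.continuousAt.eventually (fr'.isOpen.mem_nhds fr'.mem)] with x key hmx hx hx'
  change h x ∈ fr'.U at hx'
  intro b hb
  obtain ⟨c, rfl⟩ := (fr.bijective x hx).2 b
  have hcρ : ‖c‖ ≤ ρ := le_of_mul_le_mul_left ((hmx c).trans hb) hm
  have hcr : ‖c‖ ≤ r := hcρ.trans ((le_mul_of_one_le_left hρ0.le hK1).trans hρr.le)
  choose β hβ using fun t : ℝ => htrap x (fr.j x (t • c))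
  let J : (Fin fr'.rank → ℝ) ≃ₗ[ℝ] E (h x) := LinearEquiv.ofBijective _ (fr'.bijective _ hx')
  have hβc : Continuous fun t => J.symm (β t) := by
    refine (LinearMap.continuous_of_finiteDimensional (J.symm : E (h x) ≃ₗ[ℝ] _).toLinearMap).comp ?_
    refine (hW.isEmbedding (h x)).continuous_iff.2 ?_
    have : (W (h x)) ∘ β = fun t => h (W x (fr.j x (t • c))) := funext hβ
    rw [this]
    refine hh.continuous.comp ((hW.contMDiff x).continuous.comp ?_)
    exact (LinearMap.continuous_of_finiteDimensional (fr.j x)).comp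
      (continuous_id.smul continuous_const)
  have hJ : ∀ t, fr'.j (h x) (J.symm (β t)) = β t := fun t => J.apply_symm_apply (β t)
  have hW' : ∀ t, W (h x) (fr'.j (h x) (J.symm (β t))) = h (W x (fr.j x (t • c))) := fun t => by
    rw [hJ, hβ]
  -- the image of the segment from `0` to `c` lifts to a curve that starts at `0`; where the lift has
  -- norm at most `r` its norm is less than `r`, so it never reaches the sphere of radius `r`
  have hsm : ‖J.symm (β 1)‖ ≤ r := by
    by_contra! hlt
    have hβ0 : β 0 = 0 := (hW.isEmbedding (h x)).injective (by
      rw [hβ, zero_smul, _root_.map_zero, hW.map_zero, hW.map_zero])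
    have h0 : ‖J.symm (β 0)‖ ≤ r := by rw [hβ0, _root_.map_zero, norm_zero]; exact hr0.le
    obtain ⟨t, ht, htr⟩ := intermediate_value_Icc zero_le_one hβc.norm.continuousOn ⟨h0, hlt.le⟩
    have htc : ‖t • c‖ ≤ ‖c‖ := by
      rw [norm_smul, Real.norm_of_nonneg ht.1]
      exact mul_le_of_le_one_left (norm_nonneg _) ht.2
    have := (key (t • c) _ (htc.trans hcr) htr.le (hW' t)).1
    simp only at htr
    rw [htr] at this
    have h3 : K * ‖t • c‖ ≤ K * ρ := by gcongr; exact htc.trans hcρ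
    linarith
  have hW1 := hW' 1
  rw [one_smul] at hW1
  exact ⟨fr'.j (h x) (J.symm (β 1)), hW1, (key c _ hcr hsm hW1).2⟩

end

/-! ### Velocities of curves in plaques and uniform contraction of plaques -/

section

section Velocity

/-- If a curve stays in the image of an immersion, and lifts continuously, then its velocity is
tangent to that image. -/
theorem mem_range_of_hasDerivAt_comp {V H : Type*} [NormedAddCommGroup V] [NormedSpace ℝ V]
    [FiniteDimensional ℝ V] [NormedAddCommGroup H] [NormedSpace ℝ H] {g : V → H} {A : V →L[ℝ] H}
    {β : ℝ → V} {t₀ : ℝ} {v : H} (hg : HasFDerivAt g A (β t₀)) (hA : Injective A)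
    (hβ : ContinuousAt β t₀) (hv : HasDerivAt (fun t => g (β t)) v t₀) : v ∈ range A := by
  obtain ⟨K, -, hK⟩ := (A : V →ₗ[ℝ] H).injective_iff_antilipschitz.1 hA
  have h0 : (fun t => β t - β t₀) =O[𝓝 t₀] fun t => A (β t - β t₀) := by
    refine Asymptotics.IsBigO.of_bound K (Eventually.of_forall fun t => ?_)
    have := hK.le_mul_dist (β t) (β t₀)
    rw [dist_eq_norm, dist_eq_norm] at this
    simpa using this
  have h1 : (fun t => g (β t) - g (β t₀) - A (β t - β t₀)) =o[𝓝 t₀] fun t => β t - β t₀ :=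
    hg.isLittleO.comp_tendsto hβ
  have h2 : (fun t => A (β t - β t₀)) =O[𝓝 t₀] fun t => g (β t) - g (β t₀) := by
    have := (h1.trans_isBigO h0).right_isBigO_add
    simpa using this
  have h3 : (fun t => g (β t) - g (β t₀)) =O[𝓝 t₀] fun t => t - t₀ := hv.hasFDerivAt.isBigO_sub
  have h4 := h1.trans_isBigO ((h0.trans h2).trans h3)
  have h5 : HasDerivAt (fun t => A (β t - β t₀)) v t₀ := by
    rw [hasDerivAt_iff_isLittleO] at hv ⊢
    refine (hv.sub h4).congr_left fun t => ?_
    simp only [sub_self, map_zero, sub_zero]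
    abel
  rw [hasDerivAt_iff_tendsto_slope] at h5
  have hcl : IsClosed (range A) := by
    exact Submodule.closed_of_finiteDimensional (LinearMap.range (A : V →ₗ[ℝ] H))
  refine hcl.mem_of_tendsto h5 (Eventually.of_forall fun t => ?_)
  refine ⟨(t - t₀)⁻¹ • (β t - β t₀), ?_⟩
  simp [slope]

end Velocity

/-- On a compact space, constants valid near each point can be replaced by one constant. -/
theorem exists_pos_forall_of_eventually {X : Type*} [TopologicalSpace X] [CompactSpace X]
    {P : ℝ → X → Prop} (hP : ∀ δ δ' x, δ' ≤ δ → P δ x → P δ' x)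
    (h : ∀ z, ∃ δ > 0, ∀ᶠ x in 𝓝 z, P δ x) : ∃ δ > 0, ∀ x, P δ x := by
  have : ∃ δ > 0, ∀ x ∈ (univ : Set X), P δ x := by
    refine isCompact_univ.induction_on (p := fun s => ∃ δ > 0, ∀ x ∈ s, P δ x)
      ⟨1, one_pos, fun x hx => hx.elim⟩ ?_ ?_ ?_
    · rintro s t hst ⟨δ, hδ, hx⟩
      exact ⟨δ, hδ, fun x hs => hx x (hst hs)⟩
    · rintro s t ⟨δ, hδ, hx⟩ ⟨δ', hδ', hx'⟩
      refine ⟨min δ δ', lt_min hδ hδ', ?_⟩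
      rintro x (hs | hs)
      · exact hP _ _ _ (min_le_left _ _) (hx x hs)
      · exact hP _ _ _ (min_le_right _ _) (hx' x hs)
    · intro x _
      obtain ⟨δ, hδ, hx⟩ := h x
      exact ⟨_, mem_nhdsWithin_of_mem_nhds hx, δ, hδ, fun y hy => hy⟩
  obtain ⟨δ, hδ, hx⟩ := this
  exact ⟨δ, hδ, fun x => hx x (mem_univ x)⟩

variable {d : ℕ} {M : Type*} [EMetricSpace M] [ChartedSpace (EuclideanSpace ℝ (Fin d)) M]
  [IsManifold (𝓡 d) ∞ M] [RiemannianBundle (fun x : M => TangentSpace (𝓡 d) x)]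
  {E F : (x : M) → Submodule ℝ (Tan d x)} {W : (x : M) → E x → M} {z : M}

/-- The velocity of a differentiable curve contained in a plaque is tangent to the plaque. -/
theorem IsPlaqueFamily.exists_plaqueD_eq_velocity (hW : IsPlaqueFamily E W) {x : M} {β : ℝ → E x}
    {γ : ℝ → M} {t₀ : ℝ} (hγ : ContMDiff 𝓘(ℝ, ℝ) (𝓡 d) 1 γ) (hβ : ∀ t, W x (β t) = γ t) :
    ∃ w, plaqueD W x (β t₀) w = ⟨γ t₀, mfderiv 𝓘(ℝ, ℝ) (𝓡 d) γ t₀ (1 : ℝ)⟩ := by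
  have hβc : Continuous β := by
    refine (hW.isEmbedding x).continuous_iff.2 ?_
    rw [show W x ∘ β = γ from funext hβ]
    exact hγ.continuous
  obtain rfl : (fun t => W x (β t)) = γ := funext hβ
  have hz : W x (β t₀) ∈ (extChartAt (𝓡 d) (W x (β t₀))).source := mem_extChartAt_source _
  have h1 : MDifferentiableAt 𝓘(ℝ, E x) (𝓡 d) (W x) (β t₀) :=
    ((hW.contMDiff x).mdifferentiable one_ne_zero) _
  have h2 := hasFDerivAt_extChartAt_comp h1 hz
  have h3 := hasFDerivAt_extChartAt_comp (hγ.mdifferentiable one_ne_zero t₀) hz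
  obtain ⟨w, hw⟩ := mem_range_of_hasDerivAt_comp h2
    ((chartD_injective hz).comp (hW.injective_mfderiv x _)) hβc.continuousAt h3.hasDerivAt
  exact ⟨w, congrArg (TotalSpace.mk (W x (β t₀))) (chartD_injective hz hw)⟩

variable [IsContinuousRiemannianBundle (EuclideanSpace ℝ (Fin d))
    (fun x : M => TangentSpace (𝓡 d) x)]

/-- By compactness of `M`, one size `δ` serves all plaques in `IsPlaqueFamily.exists_local_contraction`. -/
theorem IsPlaqueFamily.exists_contraction [CompactSpace M] (hE : IsSubbundle E)
    (hW : IsPlaqueFamily E W) {h : M → M} (hh : ContMDiff (𝓡 d) (𝓡 d) 1 h)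
    (hinv : ∀ u ∈ bundleSet E, tangentMap (𝓡 d) (𝓡 d) h u ∈ bundleSet E) {κ₀ κ : ℝ}
    (hκ₀ : 0 ≤ κ₀) (hκ : κ₀ < κ)
    (hcontr : ∀ u ∈ bundleSet E, nrm (tangentMap (𝓡 d) (𝓡 d) h u) ≤ κ₀ * nrm u)
    (htrap : ∀ x b, h (W x b) ∈ range (W (h x))) :
    ∃ δ > 0, ∀ x, ∀ b : E x, plaqueSize W x b ≤ δ →
      ∃ b', W (h x) b' = h (W x b) ∧ plaqueSize W (h x) b' ≤ κ * plaqueSize W x b :=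
  exists_pos_forall_of_eventually (fun _ _ _ hδ h b hb => h b (hb.trans hδ))
    (hW.exists_local_contraction hE hh hinv hκ₀ hκ hcontr htrap)

theorem IsTrapped.iterate_mem {f : Diff1 d M} (hW : IsTrapped f W) (n : ℕ) (x : M) (b : E x) :
    f^[n] (W x b) ∈ range (W (f^[n] x)) := by
  induction n with
  | zero => exact ⟨b, rfl⟩
  | succ n ih =>
    rw [Function.iterate_succ_apply', Function.iterate_succ_apply']
    exact hW _ ⟨_, subset_closure ih, rfl⟩

/-- One iterate already brings the closure of a plaque into a plaque. -/
theorem IsTrapped.iterate_closure_mem {f : Diff1 d M} (hW : IsTrapped f W) {n : ℕ} (hn : 0 < n)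
    {x y : M} (hy : y ∈ closure (range (W x))) : f^[n] y ∈ range (W (f^[n] x)) := by
  obtain ⟨n, rfl⟩ := Nat.exists_eq_succ_of_ne_zero hn.ne'
  obtain ⟨b, hb⟩ := hW x ⟨y, hy, rfl⟩
  rw [Function.iterate_succ_apply, Function.iterate_succ_apply, ← hb]
  exact hW.iterate_mem n _ b

/-- The negative iterates contract an invariant expanded bundle. -/
theorem IsExpandedOn.nrm_symm_le {f : Diff1 d M} (hinv : IsInvariantBundle f F)
    {C lam : ℝ} (hC : 0 < C) (hl : 1 < lam)
    (h : ∀ x ∈ (univ : Set M), ∀ v ∈ F x, ∀ n : ℕ, C * lam ^ n * ‖v‖ ≤ ‖dIter f n x v‖) (n : ℕ)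
    {u : TangentBundle (𝓡 d) M} (hu : u ∈ bundleSet F) :
    nrm (tmap f.symm n u) ≤ (C * lam ^ n)⁻¹ * nrm u := by
  have h1 := h _ (mem_univ _) _ (tmap_symm_mem_bundleSet hinv n hu) n
  have h2 : nrm (tmap f n (tmap f.symm n u)) = nrm u := by rw [tmap_tmap_symm]
  have h3 : 0 < C * lam ^ n := by positivity
  rw [← div_eq_inv_mul, le_div_iff₀ h3, mul_comm, ← h2]
  exact h1

/-- Small plaques tangent to an expanded bundle, trapped for the inverse, are uniformly contracted
by the negative iterates. -/
theorem IsPlaqueFamily.exists_backward_contraction [CompactSpace M] {f : Diff1 d M}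
    (hE : IsSubbundle E) (hinv : IsInvariantBundle f E) (hexp : IsExpandedOn f univ E)
    (hW : IsPlaqueFamily E W) (htrap : IsTrapped f.symm W) {ε : ℝ} (hε : 0 < ε) :
    ∃ δ > 0, ∃ ρ : ℕ → ℝ, Tendsto ρ atTop (𝓝 0) ∧ (∀ n, ρ n ≤ ε) ∧
      ∀ x, ∀ b : E x, plaqueSize W x b ≤ δ → ∀ n, ∃ b',
        W (f.symm^[n] x) b' = f.symm^[n] (W x b) ∧ plaqueSize W (f.symm^[n] x) b' ≤ ρ n := by
  obtain ⟨C, lam, hC, hl, h⟩ := hexp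
  have hnrm := fun n u hu => IsExpandedOn.nrm_symm_le (u := u) hinv hC hl h n hu
  set L : ℝ := C⁻¹ + 1 with hL
  have hL0 : 1 ≤ L := by rw [hL]; have := inv_pos.2 hC; linarith
  -- a single negative iterate increases sizes at most by the factor `L`, but `δ` depends on `n`
  have hstep : ∀ n, ∃ δ > 0, ∀ x, ∀ b : E x, plaqueSize W x b ≤ δ → ∃ b',
      W (f.symm^[n] x) b' = f.symm^[n] (W x b) ∧
      plaqueSize W (f.symm^[n] x) b' ≤ L * plaqueSize W x b := by
    intro n
    refine hW.exists_contraction hE (contMDiff_iterate f.symm n)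
      (fun u hu => tmap_symm_mem_bundleSet hinv n hu) (κ₀ := C⁻¹) (inv_pos.2 hC).le
      (by rw [hL]; linarith) (fun u hu => (hnrm n u hu).trans ?_)
      (fun x b => htrap.iterate_mem n x b)
    refine mul_le_mul_of_nonneg_right ?_ (norm_nonneg u.2)
    exact inv_anti₀ hC (le_mul_of_one_le_right hC.le (one_le_pow₀ hl.le))
  -- `f⁻ᵐ` contracts `E` by the factor `1 / 4`, hence the small plaques by the factor `1 / 2`
  obtain ⟨m, hm0, hm⟩ : ∃ m : ℕ, 0 < m ∧ 4 / C < lam ^ m := by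
    obtain ⟨m, hm⟩ := pow_unbounded_of_one_lt (4 / C) hl
    exact ⟨m + 1, m.succ_pos, hm.trans_le (pow_le_pow_right₀ hl.le m.le_succ)⟩
  obtain ⟨δm, hδm, hcm⟩ := hW.exists_contraction hE (contMDiff_iterate f.symm m)
      (fun u hu => tmap_symm_mem_bundleSet hinv m hu) (κ₀ := 1 / 4) (κ := 1 / 2)
      (by norm_num) (by norm_num) (fun u hu => (hnrm m u hu).trans (by
        refine mul_le_mul_of_nonneg_right ?_ (norm_nonneg u.2)
        rw [div_lt_iff₀ hC] at hm
        rw [one_div]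
        exact inv_anti₀ (by norm_num) (by linarith)))
      (fun x b => htrap.iterate_mem m x b)
  -- one `δ` for finitely many iterates, to be applied to the remainders modulo `m`
  have hall : ∀ k, ∃ δ > 0, ∀ n < k, ∀ x, ∀ b : E x, plaqueSize W x b ≤ δ → ∃ b',
      W (f.symm^[n] x) b' = f.symm^[n] (W x b) ∧
      plaqueSize W (f.symm^[n] x) b' ≤ L * plaqueSize W x b := by
    intro k
    induction k with
    | zero => exact ⟨1, one_pos, fun n hn => absurd hn (Nat.not_lt_zero n)⟩
    | succ k ih =>
      obtain ⟨δ, hδ, h1⟩ := ih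
      obtain ⟨δ', hδ', h2⟩ := hstep k
      refine ⟨min δ δ', lt_min hδ hδ', fun n hn x b hb => ?_⟩
      rcases Nat.lt_succ_iff_lt_or_eq.1 hn with hn | rfl
      · exact h1 n hn x b (hb.trans (min_le_left _ _))
      · exact h2 x b (hb.trans (min_le_right _ _))
  obtain ⟨δr, hδr, hcr⟩ := hall (m + 1)
  set δ₀ := min δm ε with hδ₀
  have hδ₀0 : 0 < δ₀ := lt_min hδm hε
  have hiter : ∀ q : ℕ, ∀ x, ∀ b : E x, plaqueSize W x b ≤ δ₀ → ∃ b',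
      W (f.symm^[m * q] x) b' = f.symm^[m * q] (W x b) ∧
      plaqueSize W (f.symm^[m * q] x) b' ≤ (1 / 2) ^ q * δ₀ := by
    intro q
    induction q with
    | zero => intro x b hb; exact ⟨b, rfl, by simpa using hb⟩
    | succ q ih =>
      intro x b hb
      obtain ⟨b', h1, h2⟩ := ih x b hb
      have h3 : (1 / 2 : ℝ) ^ q * δ₀ ≤ δ₀ :=
        mul_le_of_le_one_left hδ₀0.le (pow_le_one₀ (by norm_num) (by norm_num))
      obtain ⟨b'', h4, h5⟩ := hcm _ b' ((h2.trans h3).trans (min_le_left _ _))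
      have e : ∀ y, f.symm^[m * (q + 1)] y = f.symm^[m] (f.symm^[m * q] y) := fun y => by
        rw [← Function.iterate_add_apply]; congr 1; ring
      rw [e x, e (W x b), ← h1]
      refine ⟨b'', h4, h5.trans ?_⟩
      rw [pow_succ]; linarith
  refine ⟨min δr (δ₀ / L), lt_min hδr (by positivity), fun n => (1 / 2) ^ (n / m) * δ₀, ?_, ?_, ?_⟩
  · have h1 : Tendsto (fun n : ℕ => (1 / 2 : ℝ) ^ (n / m)) atTop (𝓝 0) :=
      (tendsto_pow_atTop_nhds_zero_of_lt_one (by norm_num) (by norm_num)).comp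
        (Nat.tendsto_div_const_atTop hm0.ne')
    simpa using h1.mul_const δ₀
  · intro n
    exact (mul_le_of_le_one_left hδ₀0.le (pow_le_one₀ (by norm_num) (by norm_num))).trans
      (min_le_right _ _)
  · intro x b hb n
    obtain ⟨b', h1, h2⟩ := hcr (n % m) ((Nat.mod_lt n hm0).trans (Nat.lt_succ_self m)) x b
      (hb.trans (min_le_left _ _))
    have h3 : L * plaqueSize W x b ≤ δ₀ := by
      have := hb.trans (min_le_right _ _)
      rw [le_div_iff₀ (by linarith)] at this
      linarith
    obtain ⟨b'', h4, h5⟩ := hiter (n / m) _ b' (h2.trans h3)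
    have e : ∀ y, f.symm^[n] y = f.symm^[m * (n / m)] (f.symm^[n % m] y) := fun y => by
      rw [← Function.iterate_add_apply, Nat.div_add_mod]
    rw [e x, e (W x b), ← h1]
    exact ⟨b'', h4, h5⟩

end

/-! ### Transversality of frames and cones around a subbundle -/

section

variable {d : ℕ} {M : Type*} [EMetricSpace M] [ChartedSpace (EuclideanSpace ℝ (Fin d)) M]
  [IsManifold (𝓡 d) ∞ M]
  {E F : (x : M) → Submodule ℝ (Tan d x)} {z : M}

/-- The coordinate expression of the sum of two frames. -/
def frameSum (fE : LocalFrame E z) (fF : LocalFrame F z) (x : M) :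
    ((Fin fE.rank → ℝ) × (Fin fF.rank → ℝ)) →L[ℝ] EuclideanSpace ℝ (Fin d) :=
  (fE.A x).coprod (fF.A x)

theorem frameSum_apply (fE : LocalFrame E z) (fF : LocalFrame F z) (x : M)
    (p : (Fin fE.rank → ℝ) × (Fin fF.rank → ℝ)) :
    frameSum fE fF x p = chartD d z x ((fE.j x p.1 : Tan d x) + (fF.j x p.2 : Tan d x)) := by
  rw [map_add]; rfl

theorem frameSum_bijective (hEF : ∀ x, IsCompl (E x) (F x)) (fE : LocalFrame E z)
    (fF : LocalFrame F z) {x : M} (hE : x ∈ fE.U) (hF : x ∈ fF.U) :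
    Bijective (frameSum fE fF x) := by
  constructor
  · rw [injective_iff_map_eq_zero]
    rintro ⟨a, b⟩ h
    rw [frameSum_apply] at h
    have h1 : (fE.j x a : Tan d x) + (fF.j x b : Tan d x) = 0 :=
      chartD_injective (fE.subset hE) (h.trans (map_zero _).symm)
    have h2 : (fE.j x a : Tan d x) ∈ F x := by
      rw [eq_neg_of_add_eq_zero_left h1]; exact (F x).neg_mem (fF.j x b).2
    have h3 : (fE.j x a : Tan d x) = 0 :=
      (Submodule.disjoint_def.1 (hEF x).disjoint) _ (fE.j x a).2 h2
    rw [h3, zero_add] at h1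
    have h4 : a = 0 := (fE.bijective x hE).1 ((Subtype.ext h3).trans (map_zero _).symm)
    have h5 : b = 0 := (fF.bijective x hF).1 ((Subtype.ext h1).trans (map_zero _).symm)
    rw [h4, h5]; rfl
  · intro v
    obtain ⟨w, rfl⟩ := chartD_surjective (fE.subset hE) v
    have hw : w ∈ E x ⊔ F x := by rw [(hEF x).sup_eq_top]; trivial
    obtain ⟨e, he, φ, hφ, rfl⟩ := Submodule.mem_sup.1 hw
    obtain ⟨a, ha⟩ := (fE.bijective x hE).2 ⟨e, he⟩
    obtain ⟨b, hb⟩ := (fF.bijective x hF).2 ⟨φ, hφ⟩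
    exact ⟨(a, b), by rw [frameSum_apply, ha, hb]⟩

/-- The sum of two complementary frames, as an isomorphism. -/
def frameSumEquiv (hEF : ∀ x, IsCompl (E x) (F x)) (fE : LocalFrame E z)
    (fF : LocalFrame F z) {x : M} (hE : x ∈ fE.U) (hF : x ∈ fF.U) :
    ((Fin fE.rank → ℝ) × (Fin fF.rank → ℝ)) ≃L[ℝ] EuclideanSpace ℝ (Fin d) :=
  (LinearEquiv.ofBijective (frameSum fE fF x : _ →ₗ[ℝ] EuclideanSpace ℝ (Fin d))
    (frameSum_bijective hEF fE fF hE hF)).toContinuousLinearEquiv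

theorem coe_frameSumEquiv (hEF : ∀ x, IsCompl (E x) (F x)) (fE : LocalFrame E z)
    (fF : LocalFrame F z) {x : M} (hE : x ∈ fE.U) (hF : x ∈ fF.U) :
    (frameSumEquiv hEF fE fF hE hF : _ →L[ℝ] EuclideanSpace ℝ (Fin d)) = frameSum fE fF x := by
  exact ContinuousLinearMap.ext fun p => rfl

theorem continuousAt_frameSum (fE : LocalFrame E z) (fF : LocalFrame F z) :
    ContinuousAt (frameSum fE fF) z := by
  have h1 := fE.continuousOn_A.continuousAt (fE.isOpen.mem_nhds fE.mem)
  have h2 := fF.continuousOn_A.continuousAt (fF.isOpen.mem_nhds fF.mem)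
  refine continuousAt_clm_apply.2 fun p => ?_
  exact ((continuousAt_clm_apply.1 h1) p.1).add ((continuousAt_clm_apply.1 h2) p.2)

theorem continuousAt_inverse_frameSum (hEF : ∀ x, IsCompl (E x) (F x)) (fE : LocalFrame E z)
    (fF : LocalFrame F z) : ContinuousAt (fun x => (frameSum fE fF x).inverse) z := by
  have h := (contDiffAt_map_inverse (𝕜 := ℝ) (n := 0)
    (frameSumEquiv hEF fE fF fE.mem fF.mem)).continuousAt
  rw [coe_frameSumEquiv] at h
  exact ContinuousAt.comp (g := ContinuousLinearMap.inverse) h (continuousAt_frameSum fE fF)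

theorem frameSum_inverse (hEF : ∀ x, IsCompl (E x) (F x)) (fE : LocalFrame E z)
    (fF : LocalFrame F z) {x : M} (hE : x ∈ fE.U) (hF : x ∈ fF.U)
    (v : EuclideanSpace ℝ (Fin d)) : frameSum fE fF x ((frameSum fE fF x).inverse v) = v := by
  rw [← coe_frameSumEquiv hEF fE fF hE hF, ContinuousLinearMap.inverse_equiv]
  exact (frameSumEquiv hEF fE fF hE hF).apply_symm_apply v

variable [RiemannianBundle (fun x : M => TangentSpace (𝓡 d) x)]
  [IsContinuousRiemannianBundle (EuclideanSpace ℝ (Fin d))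
    (fun x : M => TangentSpace (𝓡 d) x)] {W : (x : M) → F x → M}

/-- The Riemannian norm of a vector of `E`, in terms of its coordinates in a frame. -/
def frameNorm (fE : LocalFrame E z) (y : M) (a : Fin fE.rank → ℝ) : ℝ :=
  nrm (⟨y, (fE.j y a : Tan d y)⟩ : TangentBundle (𝓡 d) M)

theorem frameNorm_smul (fE : LocalFrame E z) (y : M) (a : Fin fE.rank → ℝ) {t : ℝ} (ht : 0 < t) :
    frameNorm fE y (t • a) = t * frameNorm fE y a := by
  have h := nrm_smul (⟨y, (fE.j y a : Tan d y)⟩ : TangentBundle (𝓡 d) M) t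
  rw [abs_of_pos ht] at h
  rw [frameNorm, map_smul]
  exact h

theorem tendsto_frameNorm (fE : LocalFrame E z) {ι : Type*} {l : Filter ι} {y : ι → M}
    {a : ι → Fin fE.rank → ℝ} {a₀ : Fin fE.rank → ℝ} (hy : Tendsto y l (𝓝 z))
    (ha : Tendsto a l (𝓝 a₀)) :
    Tendsto (fun i => frameNorm fE (y i) (a i)) l (𝓝 (frameNorm fE z a₀)) := by
  have h1 := fE.continuousOn.continuousAt (fE.isOpen_prod.mem_nhds
      (show (z, a₀) ∈ _ from ⟨fE.mem, mem_univ _⟩))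
  exact (continuous_nrm.tendsto _).comp (h1.tendsto.comp (hy.prodMk_nhds ha))

/-- The coordinates, in the frames of `E` and `F`, of a vector tangent to a plaque of `F`. -/
def coneCoord (W : (x : M) → F x → M) (fE : LocalFrame E z) (fF : LocalFrame F z)
    (q : M × (Fin fF.rank → ℝ)) (w : Fin fF.rank → ℝ) :
    (Fin fE.rank → ℝ) × (Fin fF.rank → ℝ) :=
  (frameSum fE fF (W q.1 (fF.j q.1 q.2))).inverse (plaqueMapD W fF q.1 q.2 w)

theorem IsPlaqueFamily.continuousAt_coneCoord (hEF : ∀ x, IsCompl (E x) (F x))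
    (hW : IsPlaqueFamily F W) (fE : LocalFrame E z) (fF : LocalFrame F z) (w : Fin fF.rank → ℝ) :
    ContinuousAt (uncurry (coneCoord W fE fF)) ((z, 0), w) := by
  have h1 : ContinuousAt (fun q : M × (Fin fF.rank → ℝ) =>
      (frameSum fE fF (W q.1 (fF.j q.1 q.2))).inverse) (z, 0) :=
    ContinuousAt.comp_of_eq (g := fun x => (frameSum fE fF x).inverse)
      (continuousAt_inverse_frameSum hEF fE fF) (hW.continuousAt_plaque fF fF.mem 0)
      (hW.map_j_zero fF z)
  have h2 := hW.continuousAt_plaqueMapD fF fF.mem 0 (hW.mem_source_zero fF fF.mem)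
  have hfst : ContinuousAt (fun p : (M × (Fin fF.rank → ℝ)) × (Fin fF.rank → ℝ) => p.1)
    ((z, 0), w) := continuousAt_fst
  have h1' := ContinuousAt.comp (x := ((z, (0 : Fin fF.rank → ℝ)), w)) h1 hfst
  have h2' := ContinuousAt.comp (x := ((z, (0 : Fin fF.rank → ℝ)), w)) h2 hfst
  exact h1'.clm_apply (h2'.clm_apply continuousAt_snd)

/-- At the centre of the plaque at `z` the tangent vectors belong to `F`, so their component in `E`
vanishes. -/
theorem IsPlaqueFamily.exists_coneCoord_eq (hEF : ∀ x, IsCompl (E x) (F x))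
    (hW : IsPlaqueFamily F W) (fE : LocalFrame E z) (fF : LocalFrame F z) {w : Fin fF.rank → ℝ}
    (hw : w ≠ 0) : ∃ b, coneCoord W fE fF (z, 0) w = (0, b) ∧ 0 < frameNorm fF z b := by
  have hz : W z (fF.j z 0) = z := hW.map_j_zero fF z
  obtain ⟨v, hv, hvw⟩ := hW.exists_chartD_eq fF (x := z) w
  obtain ⟨b, hb⟩ := (fF.bijective z fF.mem).2 ⟨v, hv⟩
  refine ⟨b, ?_, ?_⟩
  · have h1 : frameSum fE fF z (0, b) = plaqueMapD W fF z 0 w := by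
      rw [frameSum_apply, hb, _root_.map_zero]
      simpa using hvw
    rw [coneCoord, hz, ← h1]
    exact (frameSum_bijective hEF fE fF fE.mem fF.mem).1
      (frameSum_inverse hEF fE fF fE.mem fF.mem _)
  · have hv0 : v ≠ 0 := by
      rintro rfl
      refine hw (hW.plaqueMapD_injective fF fF.mem 0 (hW.mem_source_zero fF fF.mem) ?_)
      rw [← hvw, _root_.map_zero, _root_.map_zero]
    rw [frameNorm, hb]
    exact norm_pos_iff.2 hv0

/-- The vectors tangent to a plaque of `F` near its centre lie in a cone around `F`. -/
theorem IsPlaqueFamily.eventually_cone (hEF : ∀ x, IsCompl (E x) (F x)) (hW : IsPlaqueFamily F W)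
    (fE : LocalFrame E z) (fF : LocalFrame F z) :
    ∀ᶠ q : M × (Fin fF.rank → ℝ) in 𝓝 (z, 0), ∀ w : Fin fF.rank → ℝ,
      ∃ e ∈ E (W q.1 (fF.j q.1 q.2)), ∃ φ ∈ F (W q.1 (fF.j q.1 q.2)),
        (plaqueD W q.1 (fF.j q.1 q.2) (fF.j q.1 w)).2 = e + φ ∧ ‖e‖ ≤ ‖φ‖ := by
  have hz : W z (fF.j z 0) = z := hW.map_j_zero fF z
  have hyc : Tendsto (fun q : M × (Fin fF.rank → ℝ) => W q.1 (fF.j q.1 q.2)) (𝓝 (z, 0)) (𝓝 z) := by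
    have := (hW.continuousAt_plaque fF fF.mem 0).tendsto; rwa [hz] at this
  have hmain := eventually_neg_of_homogeneous (x₀ := (z, (0 : Fin fF.rank → ℝ)))
    (N := fun q w => frameNorm fE (W q.1 (fF.j q.1 q.2)) (coneCoord W fE fF q w).1 -
      frameNorm fF (W q.1 (fF.j q.1 q.2)) (coneCoord W fE fF q w).2)
    (fun w => by
      have hP := (hW.continuousAt_coneCoord hEF fE fF w).tendsto
      have hy := hyc.comp (continuous_fst.tendsto ((z, (0 : Fin fF.rank → ℝ)), w))
      have h := (tendsto_frameNorm fE hy ((continuous_fst.tendsto _).comp hP)).sub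
        (tendsto_frameNorm fF hy ((continuous_snd.tendsto _).comp hP))
      rw [ContinuousAt, uncurry_apply_pair, hz]
      exact h)
    (fun q w t ht => by
      have : coneCoord W fE fF q (t • w) = t • coneCoord W fE fF q w := by
        simp only [coneCoord, map_smul]
      rw [this, Prod.smul_fst, Prod.smul_snd, frameNorm_smul _ _ _ ht, frameNorm_smul _ _ _ ht,
        mul_sub])
    (fun w hw => by
      obtain ⟨b, hb, hpos⟩ := hW.exists_coneCoord_eq hEF fE fF hw
      have h0 : frameNorm fE z 0 = 0 := by
        rw [frameNorm, _root_.map_zero]; exact norm_zero (E := Tan d z)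
      rw [hz, hb, h0]
      linarith)
  filter_upwards [hmain, hyc.eventually (fE.isOpen.mem_nhds fE.mem),
    hyc.eventually (fF.isOpen.mem_nhds fF.mem)] with q hq hqE hqF w
  refine ⟨fE.j (W q.1 (fF.j q.1 q.2)) (coneCoord W fE fF q w).1, (fE.j _ _).2,
    fF.j (W q.1 (fF.j q.1 q.2)) (coneCoord W fE fF q w).2, (fF.j _ _).2, ?_, ?_⟩
  · refine chartD_injective (fE.subset hqE) ?_
    rw [← frameSum_apply, coneCoord, frameSum_inverse hEF fE fF hqE hqF]
    rfl
  · rcases eq_or_ne w 0 with rfl | hw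
    · have : coneCoord W fE fF q 0 = 0 := by simp only [coneCoord, _root_.map_zero]
      rw [this, Prod.fst_zero, Prod.snd_zero, _root_.map_zero, _root_.map_zero]
      exact le_rfl
    · exact (sub_neg.1 (hq w hw)).le

/-- By compactness of `M`, the vectors tangent to the plaques of `F` at all points of size at most `δ`
lie in a cone around `F`. -/
theorem IsPlaqueFamily.exists_cone [CompactSpace M] (hE : IsSubbundle E) (hF : IsSubbundle F)
    (hEF : ∀ x, IsCompl (E x) (F x)) (hW : IsPlaqueFamily F W) :
    ∃ δ > 0, ∀ x, ∀ b : F x, plaqueSize W x b ≤ δ → ∀ w, ∃ e ∈ E (W x b), ∃ φ ∈ F (W x b),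
        (plaqueD W x b w).2 = e + φ ∧ ‖e‖ ≤ ‖φ‖ := by
  refine exists_pos_forall_of_eventually (fun _ _ _ hδ h b hb => h b (hb.trans hδ)) fun z => ?_
  obtain ⟨fE⟩ := hE.nonempty_localFrame z
  obtain ⟨fF⟩ := hF.nonempty_localFrame z
  have h := hW.eventually_cone hEF fE fF
  rw [nhds_prod_eq, eventually_prod_iff] at h
  obtain ⟨P, hP, Q, hQ, hPQ⟩ := h
  obtain ⟨r, hr, hrQ⟩ := Metric.nhds_basis_closedBall.eventually_iff.1 hQ
  obtain ⟨m, hm, hmx⟩ := hW.exists_pos_le_frameSize fF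
  refine ⟨m * r, by positivity, ?_⟩
  filter_upwards [hP, hmx, fF.isOpen.mem_nhds fF.mem] with x hx hmx hxU b hb w
  obtain ⟨c, rfl⟩ := (fF.bijective x hxU).2 b
  obtain ⟨w, rfl⟩ := (fF.bijective x hxU).2 w
  exact hPQ hx (hrQ (by simpa using le_of_mul_le_mul_left ((hmx c).trans hb) hm)) w

end

/-! ### Leaves and domination -/

section

section Leaves

variable {d : ℕ} {M : Type*} [TopologicalSpace M] [ChartedSpace (EuclideanSpace ℝ (Fin d)) M]
  {F : (x : M) → Submodule ℝ (Tan d x)}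

theorem mfderiv_comp_real {γ : ℝ → M} (hγ : ContMDiff 𝓘(ℝ, ℝ) (𝓡 d) 1 γ) {h : ℝ → ℝ}
    (hh : Differentiable ℝ h) (t : ℝ) :
    mfderiv 𝓘(ℝ, ℝ) (𝓡 d) (γ ∘ h) t (1 : ℝ)
      = deriv h t • (mfderiv 𝓘(ℝ, ℝ) (𝓡 d) γ (h t) (1 : ℝ) : Tan d (γ (h t))) := by
  have h1 : mfderiv 𝓘(ℝ, ℝ) 𝓘(ℝ, ℝ) h t = fderiv ℝ h t := mfderiv_eq_fderiv
  rw [mfderiv_comp t (hγ.mdifferentiable one_ne_zero _) (hh t).mdifferentiableAt]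
  change mfderiv 𝓘(ℝ, ℝ) (𝓡 d) γ (h t) (mfderiv 𝓘(ℝ, ℝ) 𝓘(ℝ, ℝ) h t (1 : ℝ)) = _
  have h2 : (mfderiv 𝓘(ℝ, ℝ) 𝓘(ℝ, ℝ) h t (1 : ℝ) : ℝ) = deriv h t • (1 : ℝ) := by
    rw [h1, smul_eq_mul, mul_one]; exact fderiv_apply_one_eq_deriv
  exact (congrArg (mfderiv 𝓘(ℝ, ℝ) (𝓡 d) γ (h t)) h2).trans
    ((mfderiv 𝓘(ℝ, ℝ) (𝓡 d) γ (h t)).map_smul (deriv h t) (1 : ℝ))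

/-- Two `C^1` curves tangent to `F` can be concatenated, after a reparametrization that makes both
of them constant near the junction. -/
theorem leaf_trans {x y w : M} (hy : y ∈ leaf F x) (hw : w ∈ leaf F y) : w ∈ leaf F x := by
  obtain ⟨γ₁, h1, hF1, h10, h11⟩ := hy
  obtain ⟨γ₂, h2, hF2, h20, h21⟩ := hw
  let s₁ : ℝ → ℝ := fun t => Real.smoothTransition (3 * t)
  let s₂ : ℝ → ℝ := fun t => Real.smoothTransition (3 * t - 2)
  have hs₁ : ContDiff ℝ 1 s₁ := Real.smoothTransition.contDiff.comp (contDiff_const.mul contDiff_id)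
  have hs₂ : ContDiff ℝ 1 s₂ :=
    Real.smoothTransition.contDiff.comp ((contDiff_const.mul contDiff_id).sub contDiff_const)
  let γ : ℝ → M := fun t => if t < 1 / 2 then γ₁ (s₁ t) else γ₂ (s₂ t)
  have e1 : ∀ t < 2 / 3, γ t = (γ₁ ∘ s₁) t := by
    intro t ht
    by_cases h : t < 1 / 2
    · exact if_pos h
    · have a : s₂ t = 0 := Real.smoothTransition.zero_of_nonpos (by linarith)
      have b : s₁ t = 1 := Real.smoothTransition.one_of_one_le (by linarith)
      simp [γ, a, b, h20, h11]
  have e2 : ∀ t > 1 / 3, γ t = (γ₂ ∘ s₂) t := by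
    intro t ht
    by_cases h : t < 1 / 2
    · have a : s₂ t = 0 := Real.smoothTransition.zero_of_nonpos (by linarith)
      have b : s₁ t = 1 := Real.smoothTransition.one_of_one_le (by linarith)
      simp [γ, a, b, h20, h11]
    · exact if_neg h
  have g1 : ContMDiff 𝓘(ℝ, ℝ) (𝓡 d) 1 (γ₁ ∘ s₁) := h1.comp hs₁.contMDiff
  have g2 : ContMDiff 𝓘(ℝ, ℝ) (𝓡 d) 1 (γ₂ ∘ s₂) := h2.comp hs₂.contMDiff
  have loc : ∀ t, γ =ᶠ[𝓝 t] (γ₁ ∘ s₁) ∨ γ =ᶠ[𝓝 t] (γ₂ ∘ s₂) := by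
    intro t
    rcases lt_or_ge t (2 / 3) with h | h
    · exact Or.inl ((isOpen_Iio.eventually_mem h).mono e1)
    · exact Or.inr ((isOpen_Ioi.eventually_mem (show t ∈ Ioi (1 / 3 : ℝ) from
        lt_of_lt_of_le (by norm_num) h)).mono e2)
  refine ⟨γ, fun t => ?_, fun t => ?_, ?_, ?_⟩
  · rcases loc t with h | h
    · exact (g1 t).congr_of_eventuallyEq h
    · exact (g2 t).congr_of_eventuallyEq h
  · rcases loc t with h | h
    · rw [h.mfderiv_eq, h.eq_of_nhds, mfderiv_comp_real h1 (hs₁.differentiable one_ne_zero)]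
      exact (F _).smul_mem _ (hF1 _)
    · rw [h.mfderiv_eq, h.eq_of_nhds, mfderiv_comp_real h2 (hs₂.differentiable one_ne_zero)]
      exact (F _).smul_mem _ (hF2 _)
  · rw [e1 0 (by norm_num)]
    simp [s₁, h10, Real.smoothTransition.zero_of_nonpos]
  · rw [e2 1 (by norm_num)]
    have : s₂ 1 = 1 := Real.smoothTransition.one_of_one_le (by norm_num)
    simp [this, h21]

/-- Leaves are mapped to leaves by a map whose tangent map preserves the bundle. -/
theorem map_mem_leaf {h : M → M} (hh : ContMDiff (𝓡 d) (𝓡 d) 1 h)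
    (hinv : ∀ u ∈ bundleSet F, tangentMap (𝓡 d) (𝓡 d) h u ∈ bundleSet F) {x y : M}
    (hy : y ∈ leaf F x) : h y ∈ leaf F (h x) := by
  obtain ⟨γ, hγ, hF, rfl, rfl⟩ := hy
  refine ⟨h ∘ γ, hh.comp hγ, fun t => ?_, rfl, rfl⟩
  rw [mfderiv_comp t (hh.mdifferentiable one_ne_zero _) (hγ.mdifferentiable one_ne_zero _)]
  exact hinv ⟨γ t, mfderiv 𝓘(ℝ, ℝ) (𝓡 d) γ t (1 : ℝ)⟩ (hF t)

end Leaves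

section Domination

variable {d : ℕ} {M : Type*} [EMetricSpace M] [ChartedSpace (EuclideanSpace ℝ (Fin d)) M]
  [IsManifold (𝓡 d) ∞ M] [RiemannianBundle (fun x : M => TangentSpace (𝓡 d) x)]
  {f : Diff1 d M} {E F : (x : M) → Submodule ℝ (Tan d x)}

/-- Domination for vectors that need not be unit vectors. -/
theorem dominated_mul {N : ℕ} {x : M} {e φ : Tan d x} (he : e ∈ E x) (hφ : φ ∈ F x)
    (h : ∀ x : M, ∀ v ∈ E x, ∀ u ∈ F x, ‖v‖ = 1 → ‖u‖ = 1 →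
      ‖dIter f N x v‖ < 1 / 2 * ‖dIter f N x u‖) :
    ‖dIter f N x e‖ * ‖φ‖ ≤ 1 / 2 * ‖e‖ * ‖dIter f N x φ‖ := by
  rcases eq_or_ne e 0 with rfl | he0
  · rw [map_zero, norm_zero, norm_zero]; simp
  rcases eq_or_ne φ 0 with rfl | hφ0
  · rw [map_zero, norm_zero, norm_zero]; simp
  have hne : 0 < ‖e‖ := norm_pos_iff.2 he0
  have hnφ : 0 < ‖φ‖ := norm_pos_iff.2 hφ0
  have h1 := h x (‖e‖⁻¹ • e) ((E x).smul_mem _ he) (‖φ‖⁻¹ • φ) ((F x).smul_mem _ hφ)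
    (by rw [norm_smul, norm_inv, norm_norm, inv_mul_cancel₀ hne.ne'])
    (by rw [norm_smul, norm_inv, norm_norm, inv_mul_cancel₀ hnφ.ne'])
  rw [map_smul, map_smul, norm_smul, norm_smul, norm_inv, norm_inv, norm_norm, norm_norm,
    inv_mul_eq_div, inv_mul_eq_div, div_lt_iff₀ hne] at h1
  have h2 := mul_lt_mul_of_pos_right h1 hnφ
  have h3 : 1 / 2 * (‖dIter f N x φ‖ / ‖φ‖) * ‖e‖ * ‖φ‖ = 1 / 2 * ‖e‖ * ‖dIter f N x φ‖ := by
    field_simp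
  linarith

theorem norm_dIter_add (m n : ℕ) (x : M) (v : Tan d x) :
    ‖dIter f (m + n) x v‖ = ‖dIter f m (f^[n] x) (dIter f n x v)‖ :=
  congrArg nrm (tmap_add f m n ⟨x, v⟩)

theorem dIter_mem (hE : IsInvariantBundle f E) (n : ℕ) {x : M} {v : Tan d x} (hv : v ∈ E x) :
    dIter f n x v ∈ E (f^[n] x) := tmap_mem_bundleSet hE n (u := ⟨x, v⟩) hv

/-- Domination over multiples of `N`, by the product of the inequalities along the orbit. -/
theorem dominated_iterate {N : ℕ} {x : M} {e φ : Tan d x} (hEi : IsInvariantBundle f E)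
    (hFi : IsInvariantBundle f F) (he : e ∈ E x) (hφ : φ ∈ F x)
    (h : ∀ x : M, ∀ v ∈ E x, ∀ u ∈ F x, ‖v‖ = 1 → ‖u‖ = 1 →
      ‖dIter f N x v‖ < 1 / 2 * ‖dIter f N x u‖) (j : ℕ) :
    ‖dIter f (N * j) x e‖ * ‖φ‖ ≤ (1 / 2) ^ j * ‖e‖ * ‖dIter f (N * j) x φ‖ := by
  rcases eq_or_ne φ 0 with rfl | hφ0
  · rw [map_zero, norm_zero, norm_zero]; simp
  induction j with
  | zero =>
    have h0 : ∀ v : Tan d x, ‖dIter f (N * 0) x v‖ = ‖v‖ := fun v =>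
      congrArg nrm (tmap_zero f ⟨x, v⟩)
    rw [h0, h0]; simp
  | succ j ih =>
    have h1 := dominated_mul (dIter_mem hEi (N * j) he) (dIter_mem hFi (N * j) hφ) h
    rw [Nat.mul_succ, Nat.add_comm, norm_dIter_add, norm_dIter_add]
    have hB : 0 < ‖dIter f (N * j) x φ‖ := by
      refine norm_pos_iff.2 fun h0 => hφ0 (dIter_injective f (N * j) x ?_)
      rw [h0, map_zero]
    set A := ‖dIter f N (f^[N * j] x) (dIter f (N * j) x e)‖
    set B := ‖dIter f (N * j) x φ‖
    set C := ‖dIter f (N * j) x e‖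
    set D := ‖dIter f N (f^[N * j] x) (dIter f (N * j) x φ)‖
    have hD : 0 ≤ D := norm_nonneg _
    have h2 : A * ‖φ‖ * B ≤ (1 / 2) ^ (j + 1) * ‖e‖ * D * B := by
      calc A * ‖φ‖ * B = A * B * ‖φ‖ := by ring
        _ ≤ 1 / 2 * C * D * ‖φ‖ := mul_le_mul_of_nonneg_right h1 (norm_nonneg _)
        _ = 1 / 2 * D * (C * ‖φ‖) := by ring
        _ ≤ 1 / 2 * D * ((1 / 2) ^ j * ‖e‖ * B) := by gcongr
        _ = _ := by rw [pow_succ]; ring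
    exact le_of_mul_le_mul_right h2 hB

/-- A vector all of whose negative iterates lie in a cone around `F` belongs to `F`. -/
theorem IsDominatedSplitting.mem_right_of_cone (hd : IsDominatedSplitting f E F)
    {u : TangentBundle (𝓡 d) M} (hu : ∀ n, ∃ e ∈ E (f.symm^[n] u.1), ∃ φ ∈ F (f.symm^[n] u.1),
      dIter f.symm n u.1 u.2 = e + φ ∧ ‖e‖ ≤ ‖φ‖) : u ∈ bundleSet F := by
  obtain ⟨N, -, hN⟩ := hd.dominated
  -- pushing the decomposition at time `-N * j` forward narrows the cone by the factor `(1 / 2) ^ j`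
  have h1 : ∀ j : ℕ, ∃ e ∈ E u.1, ∃ φ ∈ F u.1, u.2 = e + φ ∧ ‖e‖ ≤ (1 / 2) ^ j * ‖φ‖ := by
    intro j
    obtain ⟨e, he, φ, hφ, heq, hle⟩ := hu (N * j)
    have h2 : tmap f (N * j) ⟨f.symm^[N * j] u.1, e + φ⟩ = u := by
      rw [← heq]; exact tmap_tmap_symm f (N * j) u
    clear heq
    generalize f.symm^[N * j] u.1 = y at e φ he hφ hle h2
    subst h2
    refine ⟨dIter f (N * j) y e, dIter_mem hd.invariant_left _ he, dIter f (N * j) y φ,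
      dIter_mem hd.invariant_right _ hφ, map_add _ _ _, ?_⟩
    change ‖dIter f (N * j) y e‖ ≤ (1 / 2) ^ j * ‖dIter f (N * j) y φ‖
    have h3 := dominated_iterate hd.invariant_left hd.invariant_right he hφ hN j
    rcases eq_or_ne φ 0 with rfl | hφ0
    · have : e = 0 := norm_le_zero_iff.1 (by rwa [norm_zero] at hle)
      rw [this, map_zero, norm_zero]; simp
    · have hp : 0 < ‖φ‖ := norm_pos_iff.2 hφ0
      have h4 : (1 / 2) ^ j * ‖e‖ * ‖dIter f (N * j) y φ‖
          ≤ (1 / 2) ^ j * ‖φ‖ * ‖dIter f (N * j) y φ‖ := by gcongr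
      have h5 : ‖dIter f (N * j) y e‖ * ‖φ‖ ≤ (1 / 2) ^ j * ‖dIter f (N * j) y φ‖ * ‖φ‖ := by
        linarith
      exact le_of_mul_le_mul_right h5 hp
  obtain ⟨e₀, he₀, φ₀, hφ₀, h0, -⟩ := h1 0
  -- the decomposition of `u` is unique, so it is the same for all `j`
  have h2 : ∀ j : ℕ, ‖e₀‖ ≤ (1 / 2) ^ j * ‖φ₀‖ := by
    intro j
    obtain ⟨e, he, φ, hφ, heq, hle⟩ := h1 j
    have h3 : e - e₀ = φ₀ - φ := by
      rw [sub_eq_sub_iff_add_eq_add, ← heq, h0, add_comm]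
    have h4 : e - e₀ = 0 := Submodule.disjoint_def.1 (hd.isCompl u.1).disjoint _
      ((E _).sub_mem he he₀) (by rw [h3]; exact (F _).sub_mem hφ₀ hφ)
    rw [h4] at h3
    rwa [sub_eq_zero.1 h4, ← sub_eq_zero.1 h3.symm] at hle
  have h3 : Tendsto (fun j : ℕ => (1 / 2 : ℝ) ^ j * ‖φ₀‖) atTop (𝓝 0) := by
    simpa using (tendsto_pow_atTop_nhds_zero_of_lt_one (r := (1 / 2 : ℝ)) (by norm_num)
      (by norm_num)).mul_const ‖φ₀‖
  have h4 : e₀ = 0 := norm_le_zero_iff.1 (ge_of_tendsto' h3 h2)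
  change u.2 ∈ F u.1
  rwa [h0, h4, zero_add]

/-- A vector with bounded positive iterates belongs to `E`, if `F` is expanded. -/
theorem IsWeaklyPartiallyHyperbolic.mem_left_of_bounded (hw : IsWeaklyPartiallyHyperbolic f E F)
    {x : M} {v : Tan d x} {K : ℕ} (hK : 0 < K) {B : ℝ}
    (hv : ∀ᶠ i : ℕ in atTop, ‖dIter f (K * i) x v‖ ≤ B) : v ∈ E x := by
  have hd := hw.dominated
  obtain ⟨N, hN0, hN⟩ := hd.dominated
  obtain ⟨C, lam, hC, hl, hexp⟩ := hw.expanded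
  have hmem : v ∈ E x ⊔ F x := by rw [(hd.isCompl x).sup_eq_top]; trivial
  obtain ⟨e, he, φ, hφ, rfl⟩ := Submodule.mem_sup.1 hmem
  suffices φ = 0 by rw [this, add_zero]; exact he
  by_contra hφ0
  have hp : 0 < ‖φ‖ := norm_pos_iff.2 hφ0
  -- along the common multiples of `N` and `K` the component in `F` dominates and is unbounded
  have h1 : ∀ᶠ j : ℕ in atTop, (1 / 2 : ℝ) ^ (K * j) * ‖e‖ ≤ 1 / 2 * ‖φ‖ := by
    have : Tendsto (fun j : ℕ => (1 / 2 : ℝ) ^ (K * j) * ‖e‖) atTop (𝓝 0) := by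
      simpa using ((tendsto_pow_atTop_nhds_zero_of_lt_one (r := (1 / 2 : ℝ)) (by norm_num)
        (by norm_num)).comp (tendsto_id.const_mul_atTop' hK)).mul_const ‖e‖
    exact this.eventually_le_const (by positivity)
  have h2 : ∀ᶠ j : ℕ in atTop, ‖dIter f (K * (N * j)) x (e + φ)‖ ≤ B :=
    (tendsto_id.const_mul_atTop' hN0).eventually hv
  have h3 : Tendsto (fun j : ℕ => C * lam ^ (N * (K * j)) * ‖φ‖) atTop atTop := by
    refine Tendsto.atTop_mul_const hp (Tendsto.const_mul_atTop hC ?_)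
    exact (tendsto_pow_atTop_atTop_of_one_lt hl).comp
      ((tendsto_id.const_mul_atTop' hK).const_mul_atTop' hN0)
  obtain ⟨j, h1, h2, h3⟩ := (h1.and (h2.and (h3.eventually_gt_atTop (2 * B)))).exists
  rw [show K * (N * j) = N * (K * j) by ring, map_add] at h2
  have h4 := hexp x (mem_univ _) φ hφ (N * (K * j))
  have h5 := dominated_iterate hd.invariant_left hd.invariant_right he hφ hN (K * j)
  have h6 : ‖dIter f (N * (K * j)) x e‖ ≤ 1 / 2 * ‖dIter f (N * (K * j)) x φ‖ := by
    refine le_of_mul_le_mul_right (h5.trans ?_) hp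
    have := mul_le_mul_of_nonneg_right h1 (norm_nonneg (dIter f (N * (K * j)) x φ))
    linarith
  have h7 := norm_sub_le_norm_add (dIter f (N * (K * j)) x φ) (dIter f (N * (K * j)) x e)
  rw [add_comm] at h7
  linarith

end Domination

end

/-! ### Small plaques as local leaves, and the local product structure -/

section

variable {d : ℕ} {M : Type*} [EMetricSpace M] [ChartedSpace (EuclideanSpace ℝ (Fin d)) M]
  [IsManifold (𝓡 d) ∞ M] [RiemannianBundle (fun x : M => TangentSpace (𝓡 d) x)]
  [IsContinuousRiemannianBundle (EuclideanSpace ℝ (Fin d)) (fun x : M => TangentSpace (𝓡 d) x)]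
  {f : Diff1 d M} {E F : (x : M) → Submodule ℝ (Tan d x)}
  {WE : (x : M) → E x → M} {W : (x : M) → F x → M} {z : M}

/-- The plaques tangent to `F`, trapped for the inverse, are tangent to `F` at all points near their
centres: they are local leaves. -/
theorem IsWeaklyPartiallyHyperbolic.exists_plaqueD_mem [CompactSpace M]
    (hw : IsWeaklyPartiallyHyperbolic f E F) (hW : IsPlaqueFamily F W)
    (htrap : IsTrapped f.symm W) :
    ∃ δ > 0, ∀ x, ∀ b : F x, plaqueSize W x b ≤ δ → ∀ w, plaqueD W x b w ∈ bundleSet F := by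
  have hd := hw.dominated
  obtain ⟨δc, hδc, hcone⟩ := hW.exists_cone hd.subbundle_left hd.subbundle_right hd.isCompl
  obtain ⟨δ, hδ, ρ, -, hρ, hback⟩ := hW.exists_backward_contraction hd.subbundle_right
    hd.invariant_right hw.expanded htrap hδc
  refine ⟨δ, hδ, fun x b hb w => hd.mem_right_of_cone fun n => ?_⟩
  obtain ⟨b', hb', hs⟩ := hback x b hb n
  -- the image under `f⁻ⁿ` of a segment of the plaque is a curve in another plaque
  have hline : ContMDiff 𝓘(ℝ, ℝ) 𝓘(ℝ, F x) 1 (fun t : ℝ => b + t • w) :=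
    (contDiff_const.add (contDiff_id.smul contDiff_const)).contMDiff
  have hγ : ContMDiff 𝓘(ℝ, ℝ) (𝓡 d) 1 (fun t : ℝ => f.symm^[n] (W x (b + t • w))) :=
    (contMDiff_iterate f.symm n).comp ((hW.contMDiff x).comp hline)
  choose β hβ using fun t : ℝ => htrap.iterate_mem n x (b + t • w)
  obtain ⟨w', hw'⟩ := hW.exists_plaqueD_eq_velocity (t₀ := 0) hγ hβ
  have hβ0 : β 0 = b' := (hW.isEmbedding _).injective (by rw [hβ, hb', zero_smul, add_zero])
  have hvel : (⟨f.symm^[n] (W x (b + (0 : ℝ) • w)),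
      mfderiv 𝓘(ℝ, ℝ) (𝓡 d) (fun t : ℝ => f.symm^[n] (W x (b + t • w))) 0 (1 : ℝ)⟩ :
      TangentBundle (𝓡 d) M) = tmap f.symm n (plaqueD W x b w) := by
    have h1 := tangentMap_comp_at (I := 𝓘(ℝ, ℝ)) (I' := 𝓘(ℝ, F x)) (I'' := 𝓡 d)
      (g := W x) (f := fun t : ℝ => b + t • w)
      ⟨(0 : ℝ), (1 : ℝ)⟩ ((hW.contMDiff x).mdifferentiable one_ne_zero _)
      (hline.mdifferentiable one_ne_zero _)
    have h2 := tangentMap_comp_at (I := 𝓘(ℝ, ℝ)) (I' := 𝓡 d) (I'' := 𝓡 d)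
      (g := f.symm^[n]) (f := W x ∘ fun t : ℝ => b + t • w)
      ⟨(0 : ℝ), (1 : ℝ)⟩ ((mdifferentiable_iterate f.symm n) _)
      (((hW.contMDiff x).comp hline).mdifferentiable one_ne_zero _)
    rw [h1] at h2
    refine h2.trans ?_
    rw [← tmap_eq_tangentMap]
    congr 1
    have h3 : HasDerivAt (fun t : ℝ => b + t • w) w 0 := by
      simpa using ((hasDerivAt_id (0 : ℝ)).smul_const w).const_add b
    have h4 : (mfderiv 𝓘(ℝ, ℝ) 𝓘(ℝ, F x) (fun t : ℝ => b + t • w) 0 (1 : ℝ) : F x) = w := by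
      have h1 : mfderiv 𝓘(ℝ, ℝ) 𝓘(ℝ, F x) (fun t : ℝ => b + t • w) 0
          = fderiv ℝ (fun t : ℝ => b + t • w) 0 := mfderiv_eq_fderiv
      have h2 : (fderiv ℝ (fun t : ℝ => b + t • w) 0 (1 : ℝ) : F x) = w :=
        fderiv_apply_one_eq_deriv.trans h3.deriv
      exact (congrArg (fun A : ℝ →L[ℝ] F x => A 1) h1).trans h2
    have h5 : b + (0 : ℝ) • w = b := by rw [zero_smul, add_zero]
    have h6 : tangentMap 𝓘(ℝ, F x) (𝓡 d) (W x) (tangentMap 𝓘(ℝ, ℝ) 𝓘(ℝ, F x)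
        (fun t : ℝ => b + t • w) ⟨(0 : ℝ), (1 : ℝ)⟩)
        = plaqueD W x (b + (0 : ℝ) • w)
          (mfderiv 𝓘(ℝ, ℝ) 𝓘(ℝ, F x) (fun t : ℝ => b + t • w) 0 (1 : ℝ) : F x) := rfl
    rw [h6, h4, h5]
  rw [hvel] at hw'
  obtain ⟨e, he, φ, hφ, heq, hle⟩ := hcone _ (β 0) (by rw [hβ0]; exact hs.trans (hρ n)) w'
  change ∃ e ∈ E (tmap f.symm n (plaqueD W x b w)).1, ∃ φ ∈ F (tmap f.symm n (plaqueD W x b w)).1,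
    (tmap f.symm n (plaqueD W x b w)).2 = e + φ ∧ ‖e‖ ≤ ‖φ‖
  rw [← hw']
  exact ⟨e, he, φ, hφ, heq, hle⟩

/-- A point of a small plaque is joined to the centre by a radial curve. The smooth transition function
keeps the curve, which has to be defined on the whole line, inside the small plaque. -/
theorem IsPlaqueFamily.mem_leaf (hW : IsPlaqueFamily F W) {δ : ℝ}
    (hδ : ∀ x, ∀ b : F x, plaqueSize W x b ≤ δ → ∀ w, plaqueD W x b w ∈ bundleSet F) {x : M}
    {b : F x} (hb : plaqueSize W x b ≤ δ) : W x b ∈ leaf F x := by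
  have hs : ContDiff ℝ 1 (fun t : ℝ => Real.smoothTransition t • b) :=
    Real.smoothTransition.contDiff.smul contDiff_const
  have hs' : ContMDiff 𝓘(ℝ, ℝ) 𝓘(ℝ, F x) 1 (fun t : ℝ => Real.smoothTransition t • b) :=
    hs.contMDiff
  refine ⟨fun t => W x (Real.smoothTransition t • b), (hW.contMDiff x).comp hs', fun t => ?_, ?_, ?_⟩
  · have h1 := mfderiv_comp (I := 𝓘(ℝ, ℝ)) (I' := 𝓘(ℝ, F x)) (I'' := 𝓡 d) t
      (g := W x) (f := fun t : ℝ => Real.smoothTransition t • b)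
      ((hW.contMDiff x).mdifferentiable one_ne_zero _) (hs'.mdifferentiable one_ne_zero _)
    have h2 := hδ x (Real.smoothTransition t • b) (by
      rw [plaqueSize_smul, abs_of_nonneg (Real.smoothTransition.nonneg t)]
      exact (mul_le_of_le_one_left (plaqueSize_nonneg x b)
        (Real.smoothTransition.le_one t)).trans hb)
      (mfderiv 𝓘(ℝ, ℝ) 𝓘(ℝ, F x) (fun t : ℝ => Real.smoothTransition t • b) t (1 : ℝ))
    change mfderiv 𝓘(ℝ, ℝ) (𝓡 d) (W x ∘ fun t : ℝ => Real.smoothTransition t • b) t (1 : ℝ) ∈ _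
    rw [h1]
    exact h2
  · simp only [Real.smoothTransition.zero, zero_smul, hW.map_zero]
  · simp only [Real.smoothTransition.one, one_smul]

/-- Local product structure: a small plaque of `F` meets the plaques of `E` through the nearby
points. -/
theorem exists_local_product (hE : IsSubbundle E) (hF : IsSubbundle F)
    (hEF : ∀ x, IsCompl (E x) (F x)) (hWE : IsPlaqueFamily E WE) (hW : IsPlaqueFamily F W) (z : M)
    {ε : ℝ} (hε : 0 < ε) :
    ∃ U ∈ 𝓝 z, ∀ y ∈ U, ∀ w ∈ U, ∃ b : F y, plaqueSize W y b ≤ ε ∧ W y b ∈ range (WE w) := by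
  obtain ⟨fE⟩ := hE.nonempty_localFrame z
  obtain ⟨fF⟩ := hF.nonempty_localFrame z
  -- the linear part at `z` of the difference of a point of a plaque of `F` and one of a plaque of `E`
  let A : ((Fin fF.rank → ℝ) × (Fin fE.rank → ℝ)) →L[ℝ] EuclideanSpace ℝ (Fin d) :=
    (plaqueMapD W fF z 0).coprod (-plaqueMapD WE fE z 0)
  have hA : A.range = ⊤ := by
    rw [LinearMap.range_eq_top]
    intro v
    obtain ⟨u, rfl⟩ := chartD_surjective (fE.subset fE.mem) v
    have hu : u ∈ E z ⊔ F z := by rw [(hEF z).sup_eq_top]; trivial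
    obtain ⟨e, he, φ, hφ, rfl⟩ := Submodule.mem_sup.1 hu
    obtain ⟨c, hc⟩ := hW.exists_plaqueMapD_zero_eq fF fF.mem hφ
    obtain ⟨c', hc'⟩ := hWE.exists_plaqueMapD_zero_eq fE fE.mem he
    refine ⟨(c, -c'), ?_⟩
    change plaqueMapD W fF z 0 c + (-plaqueMapD WE fE z 0) (-c') = _
    rw [neg_apply, map_neg, neg_neg, hc, hc', map_add, add_comm]
  let R := A.nonlinearRightInverseOfSurjective hA
  have hR : 0 < R.nnnorm := A.nonlinearRightInverseOfSurjective_nnnorm_pos hA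
  -- half of the room left by the right inverse
  set η : ℝ := (R.nnnorm : ℝ)⁻¹ / 4 with hη
  have hη0 : 0 < η := by positivity
  obtain ⟨r₁, hr₁, h1⟩ := hW.exists_approx fF hη0
  obtain ⟨r₂, hr₂, h2⟩ := hWE.exists_approx fE hη0
  obtain ⟨C, hC, hCz⟩ := hW.exists_frameSize_le fF
  have hCy := hW.eventually_abs_frameSize_sub_le fF one_pos
  -- a radius on which everything is defined
  have hsrcF := hW.eventually_mem_source fF
  have hsrcE := hWE.eventually_mem_source fE
  rw [nhds_prod_eq, eventually_prod_iff] at hsrcF hsrcE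
  obtain ⟨PF, hPF, QF, hQF, hsF⟩ := hsrcF
  obtain ⟨PE, hPE, QE, hQE, hsE⟩ := hsrcE
  obtain ⟨r₃, hr₃, h3⟩ := Metric.nhds_basis_closedBall.eventually_iff.1 hQF
  obtain ⟨r₄, hr₄, h4⟩ := Metric.nhds_basis_closedBall.eventually_iff.1 hQE
  obtain ⟨r, hr, hrr₁, hrr₂, hrr₃, hrr₄, hrε⟩ : ∃ r > 0, r ≤ r₁ ∧ r ≤ r₂ ∧ r ≤ r₃ ∧ r ≤ r₄ ∧
      (C + 1) * r ≤ ε := by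
    refine ⟨min r₁ (min r₂ (min r₃ (min r₄ (ε / (C + 1))))), by positivity, min_le_left _ _,
      (min_le_right _ _).trans (min_le_left _ _),
      (min_le_right _ _).trans ((min_le_right _ _).trans (min_le_left _ _)),
      (min_le_right _ _).trans ((min_le_right _ _).trans ((min_le_right _ _).trans
        (min_le_left _ _))), ?_⟩
    rw [mul_comm, ← le_div_iff₀ (by positivity)]
    exact (min_le_right _ _).trans ((min_le_right _ _).trans ((min_le_right _ _).trans
        (min_le_right _ _)))
  have hcont : ContinuousAt (extChartAt (𝓡 d) z) z := continuousAt_extChartAt z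
  have h5 : ∀ᶠ y in 𝓝 z, ‖extChartAt (𝓡 d) z y - extChartAt (𝓡 d) z z‖
      < (R.nnnorm : ℝ)⁻¹ / 4 * r := by
    have := (hcont.tendsto.sub_const (extChartAt (𝓡 d) z z)).norm
    simp only [sub_self, norm_zero] at this
    exact this.eventually_lt_const (by positivity)
  refine ⟨_, h1.and (h2.and (hCy.and (hPF.and (hPE.and h5)))), ?_⟩
  rintro y ⟨h1y, -, hCy, hPFy, -, h5y⟩ w ⟨-, h2w, -, -, hPEw, h5w⟩
  let Φ : ((Fin fF.rank → ℝ) × (Fin fE.rank → ℝ)) → EuclideanSpace ℝ (Fin d) := fun p =>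
    plaqueMap W fF y p.1 - plaqueMap WE fE w p.2
  have happ : ApproximatesLinearOn Φ A (Metric.closedBall 0 r) (R.nnnorm⁻¹ / 2) := by
    rintro ⟨c, e⟩ hp ⟨c', e'⟩ hp'
    rw [mem_closedBall_zero_iff, Prod.norm_def, max_le_iff] at hp hp'
    have g1 := h1y c (by simpa using hp.1.trans hrr₁) c' (by simpa using hp'.1.trans hrr₁)
    have g2 := h2w e (by simpa using hp.2.trans hrr₂) e' (by simpa using hp'.2.trans hrr₂)
    have g3 : Φ (c, e) - Φ (c', e') - A ((c, e) - (c', e'))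
        = (plaqueMap W fF y c - plaqueMap W fF y c' - plaqueMapD W fF z 0 (c - c'))
        - (plaqueMap WE fE w e - plaqueMap WE fE w e' - plaqueMapD WE fE z 0 (e - e')) := by
      change _ - _ - (plaqueMapD W fF z 0 (c - c') + (-plaqueMapD WE fE z 0) (e - e')) = _
      rw [neg_apply]
      simp only [Φ]
      abel
    rw [g3]
    refine (norm_sub_le _ _).trans ((add_le_add g1 g2).trans ?_)
    have g4 : ‖c - c'‖ ≤ ‖(c, e) - (c', e')‖ := norm_fst_le ((c, e) - (c', e'))
    have g5 : ‖e - e'‖ ≤ ‖(c, e) - (c', e')‖ := norm_snd_le ((c, e) - (c', e'))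
    have g6 := mul_le_mul_of_nonneg_left g4 hη0.le
    have g7 := mul_le_mul_of_nonneg_left g5 hη0.le
    have g8 : ((R.nnnorm⁻¹ / 2 : NNReal) : ℝ) = η + η := by
      rw [hη]; push_cast; ring
    rw [g8]; linarith
  have hsurj := happ.surjOn_closedBall_of_nonlinearRightInverse R hr.le (b := 0) Subset.rfl
  have hΦ0 : Φ 0 = extChartAt (𝓡 d) z y - extChartAt (𝓡 d) z w := by
    simp only [Φ, plaqueMap, Prod.fst_zero, Prod.snd_zero, _root_.map_zero, hW.map_zero,
      hWE.map_zero]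
  have hmem : (0 : EuclideanSpace ℝ (Fin d)) ∈ Metric.closedBall (Φ 0)
      (((R.nnnorm : ℝ)⁻¹ - ((R.nnnorm⁻¹ / 2 : NNReal) : ℝ)) * r) := by
    rw [Metric.mem_closedBall, dist_comm, dist_zero_right, hΦ0]
    have e1 : extChartAt (𝓡 d) z y - extChartAt (𝓡 d) z w = (extChartAt (𝓡 d) z y
      - extChartAt (𝓡 d) z z) - (extChartAt (𝓡 d) z w - extChartAt (𝓡 d) z z) := by abel
    rw [e1]
    refine (norm_sub_le _ _).trans ((add_le_add h5y.le h5w.le).trans (le_of_eq ?_))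
    push_cast; ring
  obtain ⟨⟨c, e⟩, hp, hΦ⟩ := hsurj hmem
  rw [mem_closedBall_zero_iff, Prod.norm_def, max_le_iff] at hp
  refine ⟨fF.j y c, ?_, fE.j w e, ?_⟩
  · have g1 := (abs_le.1 (hCy c)).2
    have g2 := hCz c
    have g3 : (C + 1) * ‖c‖ ≤ (C + 1) * r := by gcongr; exact hp.1
    change frameSize W fF y c ≤ ε
    linarith
  · have m1 := (hsF hPFy (h3 (by simpa using hp.1.trans hrr₃))).2
    have m2 := (hsE hPEw (h4 (by simpa using hp.2.trans hrr₄))).2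
    exact ((extChartAt (𝓡 d) z).injOn m1 m2 (sub_eq_zero.1 hΦ)).symm

end

/-! ### Limit sets and saturated sets -/

section

section Limit

variable {d : ℕ} {M : Type*} [TopologicalSpace M] [ChartedSpace (EuclideanSpace ℝ (Fin d)) M]
  {f : Diff1 d M}

/-- The set of limit points of the forward orbit of `y`. -/
def limitSet (f : Diff1 d M) (y : M) : Set M := {c | MapClusterPt c atTop fun n : ℕ => f^[n] y}

theorem isClosed_limitSet (y : M) : IsClosed (limitSet f y) := isClosed_setOfPred_clusterPt

theorem limitSet_iterate (k : ℕ) (y : M) : limitSet f (f^[k] y) = limitSet f y := by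
  ext c
  have h : (fun n : ℕ => f^[n] (f^[k] y)) = (fun n : ℕ => f^[n] y) ∘ (· + k) :=
    funext fun n => (Function.iterate_add_apply f n k y).symm
  simp only [limitSet, mem_ofPred_eq, MapClusterPt, h]
  rw [← Filter.map_map, map_add_atTop_eq_nat]

theorem iterate_mem_limitSet (k : ℕ) {y c : M} (hc : c ∈ limitSet f y) :
    f^[k] c ∈ limitSet f y := by
  rw [← limitSet_iterate k]
  have h : (fun n : ℕ => f^[n] (f^[k] y)) = f^[k] ∘ fun n : ℕ => f^[n] y :=
    funext fun n => (Function.Commute.iterate_iterate_self f n k) y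
  change MapClusterPt _ _ _
  rw [h]
  exact MapClusterPt.continuousAt_comp (continuous_iterate f k).continuousAt hc

theorem isPeriodicPt_symm {m : ℕ} {q : M} (hq : IsPeriodicPt f m q) :
    IsPeriodicPt f.symm m q := by
  have h := symm_iterate_iterate f m q
  rwa [hq] at h

theorem isPeriodicPt_of_mem_orbit {m : ℕ} {q q' : M} (hq : IsPeriodicPt f m q)
    (h : ∃ k, f^[k] q = q') : IsPeriodicPt f m q' := by
  obtain ⟨k, rfl⟩ := h
  exact hq.apply_iterate k

theorem iterate_mem_of_mapsTo {Λ : Set M} (h : ∀ y ∈ Λ, f y ∈ Λ) (n : ℕ) {y : M} (hy : y ∈ Λ) :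
    f^[n] y ∈ Λ := (show MapsTo f Λ Λ from h).iterate n hy

end Limit

section Stable

variable {d : ℕ} {M : Type*} [EMetricSpace M] [ChartedSpace (EuclideanSpace ℝ (Fin d)) M]
  {f : Diff1 d M}

theorem tendsto_of_mem_stableManifold {m : ℕ} (hm : 0 < m) {q y : M} (hq : IsPeriodicPt f m q)
    (hy : y ∈ stableManifold f q) : Tendsto (fun n : ℕ => f^[m * n] y) atTop (𝓝 q) := by
  rw [tendsto_iff_edist_tendsto_0]
  have h := (show Tendsto _ _ _ from hy).comp (tendsto_id.const_mul_atTop' hm)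
  refine h.congr fun n => ?_
  change edist (f^[m * n] y) (f^[m * n] q) = _
  rw [(hq.mul_const n).eq]

theorem mem_limitSet_of_mem_stableManifold {m : ℕ} (hm : 0 < m) {q y : M}
    (hq : IsPeriodicPt f m q) (hy : y ∈ stableManifold f q) : q ∈ limitSet f y :=
  (tendsto_of_mem_stableManifold hm hq hy).mapClusterPt.of_comp (tendsto_id.const_mul_atTop' hm)

end Stable

variable {d : ℕ} {M : Type*} [EMetricSpace M] [ChartedSpace (EuclideanSpace ℝ (Fin d)) M]
  [IsManifold (𝓡 d) ∞ M] [RiemannianBundle (fun x : M => TangentSpace (𝓡 d) x)]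
  [IsContinuousRiemannianBundle (EuclideanSpace ℝ (Fin d)) (fun x : M => TangentSpace (𝓡 d) x)]
  {f : Diff1 d M} {E F : (x : M) → Submodule ℝ (Tan d x)}
  {WE : (x : M) → E x → M} {W : (x : M) → F x → M} {p q qs z : M}

/-- If the forward orbit of `t` accumulates on `qs`, then so do the forward orbits of all points of
the plaque at `t`: by trapping they accumulate on the plaque at `qs`, which lies in the stable
manifold of `qs`. -/
theorem IsPlaqueFamily.mem_limitSet [CompactSpace M] (hW : IsPlaqueFamily E WE)
    (htrap : IsTrapped f WE) {m : ℕ} (hm : 0 < m) (hq : IsPeriodicPt f m qs)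
    (hs : range (WE qs) ⊆ stableManifold f qs) {t : M} (ht : qs ∈ limitSet f t) (b : E t) :
    qs ∈ limitSet f (WE t b) := by
  obtain ⟨U, hU, htU⟩ := mapClusterPt_iff_ultrafilter.1 ht
  obtain ⟨c, -, hc⟩ := isCompact_univ.ultrafilter_le_nhds (U.map fun n : ℕ => f^[n] (WE t b))
    (by simp)
  have hc' : Tendsto (fun n : ℕ => f^[n] (WE t b)) U (𝓝 c) := hc
  have h1 : Tendsto (fun n : ℕ => Metric.infEDist (f^[n] (WE t b)) (range (WE qs))) U (𝓝 0) := by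
    refine tendsto_of_tendsto_of_tendsto_of_le_of_le tendsto_const_nhds
      ((hW.continuous_plaque qs).comp htU) (fun n => zero_le) fun n => ?_
    exact Metric.infEDist_le_hausdorffEDist_of_mem (htrap.iterate_mem n t b)
  have h2 : c ∈ closure (range (WE qs)) := by
    rw [Metric.mem_closure_iff_infEDist_zero]
    exact tendsto_nhds_unique ((Metric.continuous_infEDist.tendsto c).comp hc') h1
  have h3 : f^[m] c ∈ stableManifold f qs := by
    have := htrap.iterate_closure_mem hm h2
    rw [hq.eq] at this
    exact hs this
  have h4 : c ∈ limitSet f (WE t b) := mapClusterPt_iff_ultrafilter.2 ⟨U, hU, hc'⟩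
  refine (isClosed_limitSet _).mem_of_tendsto (tendsto_of_mem_stableManifold hm hq h3)
    (Eventually.of_forall fun n => ?_)
  exact iterate_mem_limitSet _ (iterate_mem_limitSet _ h4)

/-- The size at a fixed point bounds a multiple of the norm, since the derivative of the plaque is
injective. -/
theorem IsPlaqueFamily.tendsto_of_plaqueSize (hW : IsPlaqueFamily F W) (y : M) {ι : Type*}
    {l : Filter ι} {b : ι → F y} (hb : Tendsto (fun i => plaqueSize W y (b i)) l (𝓝 0)) :
    Tendsto (fun i => W y (b i)) l (𝓝 y) := by
  obtain ⟨a, ha, h⟩ := exists_pos_mul_norm_le (V := F y) (H := Tan d (W y 0))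
    (A := mfderiv 𝓘(ℝ, F y) (𝓡 d) (W y) 0) (hW.injective_mfderiv y 0)
  have h1 : Tendsto b l (𝓝 0) := by
    rw [tendsto_zero_iff_norm_tendsto_zero]
    refine squeeze_zero (fun _ => norm_nonneg _) (fun i => ?_)
      (by simpa using hb.const_mul a⁻¹)
    rw [← div_eq_inv_mul, le_div_iff₀ ha, mul_comm]
    exact h (b i)
  have h2 := ((hW.contMDiff y).continuous.tendsto 0).comp h1
  rwa [hW.map_zero] at h2

/-- Let `G` be a set that contains all preimages of its points, and with each point its plaque of `E`.
If the forward orbit of `y` accumulates on the closure of `G`, then `y` belongs to this closure: the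
local product structure yields points of `G` on small plaques of `F` at far iterates of `y`, and the
negative iterates contract these plaques. -/
theorem mem_closure_of_mem_limitSet [CompactSpace M] (hw : IsWeaklyPartiallyHyperbolic f E F)
    (hWE : IsPlaqueFamily E WE) (hW : IsPlaqueFamily F W)
    (htrap : IsTrapped f.symm W) {G : Set M} (hG : ∀ y, ∀ n, f^[n] y ∈ G → y ∈ G)
    (hGW : ∀ t ∈ G, range (WE t) ⊆ G) {y : M} (hz : z ∈ closure G) (hzy : z ∈ limitSet f y) :
    y ∈ closure G := by
  have hd := hw.dominated
  obtain ⟨δ, hδ, ρ, hρ, -, hback⟩ := hW.exists_backward_contraction hd.subbundle_right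
    hd.invariant_right hw.expanded htrap one_pos
  obtain ⟨U, hU, hprod⟩ := exists_local_product hd.subbundle_left hd.subbundle_right hd.isCompl
    hWE hW z hδ
  obtain ⟨g, hgU, hgG⟩ := mem_closure_iff_nhds.1 hz U hU
  have hfreq : ∃ᶠ n : ℕ in atTop, f^[n] y ∈ U := mapClusterPt_iff_frequently.1 hzy U hU
  -- whenever the orbit is in `U` there is a point of `G` on the plaque at `y`, of size at most `ρ n`
  have key : ∀ n, ∃ b : F y, f^[n] y ∈ U → W y b ∈ G ∧ plaqueSize W y b ≤ ρ n := by
    intro n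
    by_cases hn : f^[n] y ∈ U
    · obtain ⟨b, hb, hbG⟩ := hprod _ hn g hgU
      have h1 := hback (f^[n] y) b hb n
      rw [symm_iterate_iterate] at h1
      obtain ⟨b', h2, h3⟩ := h1
      refine ⟨b', fun _ => ⟨hG _ n ?_, h3⟩⟩
      rw [h2, iterate_symm_iterate]
      exact hGW g hgG hbG
    · exact ⟨0, fun h => absurd h hn⟩
  choose b hb using key
  have : (atTop ⊓ 𝓟 {n : ℕ | f^[n] y ∈ U}).NeBot := frequently_mem_iff_neBot.1 hfreq
  have hev : ∀ᶠ n in atTop ⊓ 𝓟 {n : ℕ | f^[n] y ∈ U}, f^[n] y ∈ U :=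
    mem_inf_of_right (mem_principal_self _)
  refine mem_closure_of_tendsto (hW.tendsto_of_plaqueSize y (b := b) ?_)
    (hev.mono fun n hn => (hb n hn).1)
  exact squeeze_zero' (Eventually.of_forall fun _ => plaqueSize_nonneg _ _)
    (hev.mono fun n hn => (hb n hn).2) (hρ.mono_left inf_le_left)

/-- A closed set invariant by `f` and `f⁻¹` and containing a point of the unstable manifold of `q`
contains `q`. -/
theorem mem_of_mem_unstableManifold {Λ : Set M} (hΛ : IsClosed Λ) (h : ∀ y ∈ Λ, f.symm y ∈ Λ)
    (hq : q ∈ periodicPts f) {q' y : M} (hq' : q' ∈ orbit f q) (hy : y ∈ Λ)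
    (hyu : y ∈ unstableManifold f q') : q ∈ Λ := by
  obtain ⟨m, hm, hmq⟩ := hq
  obtain ⟨k, rfl⟩ := hq'
  have h1 := tendsto_of_mem_stableManifold hm
    (isPeriodicPt_symm (isPeriodicPt_of_mem_orbit hmq ⟨k, rfl⟩)) hyu
  have h2 := hΛ.mem_of_tendsto h1 (Eventually.of_forall fun n => iterate_mem_of_mapsTo h _ hy)
  have h3 := iterate_mem_of_mapsTo h k h2
  rwa [symm_iterate_iterate] at h3

/-- In a chain-hyperbolic system the points whose forward orbit accumulates on `qs` are dense. -/
theorem dense_setOf_mem_limitSet [CompactSpace M] (hw : IsWeaklyPartiallyHyperbolic f E F)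
    (hWE : IsPlaqueFamily E WE) (htrapE : IsTrapped f WE) (hW : IsPlaqueFamily F W)
    (htrap : IsTrapped f.symm W) (hp : homoclinicClass f p = univ)
    (hqs : HomoclinicallyRelated f p qs) (hs : range (WE qs) ⊆ stableManifold f qs) :
    Dense {y | qs ∈ limitSet f y} := by
  obtain ⟨m, hm, hmq⟩ := hqs.2.1.1
  set G := {y | qs ∈ limitSet f y} with hGdef
  have hG : ∀ y, ∀ n, f^[n] y ∈ G ↔ y ∈ G := fun y n => by
    simp only [hGdef, mem_ofPred_eq, limitSet_iterate]
  have hGs : ∀ y ∈ G, f.symm y ∈ G := fun y hy => by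
    rw [← hG _ 1]; simpa using hy
  have hGW : ∀ t ∈ G, range (WE t) ⊆ G := by
    rintro t ht _ ⟨b, rfl⟩
    exact hWE.mem_limitSet htrapE hm hmq hs ht b
  have hcl : ∀ y ∈ closure G, f y ∈ closure G := fun y hy =>
    map_mem_closure f.continuous hy fun y hy => (hG y 1).2 hy
  have hcls : ∀ y ∈ closure G, f.symm y ∈ closure G := fun y hy =>
    map_mem_closure f.symm.continuous hy hGs
  -- the closure of `G` contains the heteroclinic point, attracted by the orbit of `a`, and then the
  -- orbit of `b`, to which the negative iterates of that point converge
  have key : ∀ a b, a ∈ periodicPts f → b ∈ periodicPts f → StableMeetsUnstable f a b →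
      a ∈ closure G → b ∈ closure G := by
    rintro a b ⟨k, hk, hka⟩ hb ⟨a', ⟨j, rfl⟩, b', hb', y, ⟨hy1, hy2⟩, -⟩ haG
    have h1 := mem_limitSet_of_mem_stableManifold hk (hka.apply_iterate j) hy1
    have h2 := mem_closure_of_mem_limitSet hw hWE hW htrap (fun y n => (hG y n).1) hGW
      (iterate_mem_of_mapsTo hcl j haG) h1
    exact mem_of_mem_unstableManifold isClosed_closure hcls hb hb' h2 hy2
  have hqsG : qs ∈ closure G := by
    refine subset_closure (mem_limitSet_of_mem_stableManifold hm hmq (hs ⟨0, hWE.map_zero qs⟩))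
  have hpG : p ∈ closure G := key qs p hqs.2.1.1 hqs.1.1 hqs.2.2.2 hqsG
  rw [dense_iff_closure_eq, ← univ_subset_iff, ← hp]
  refine closure_minimal ?_ isClosed_closure
  intro q hq
  exact key p q hq.1.1 hq.2.1.1 hq.2.2.1 hpG

/-- `Λ` is a closed set, invariant by `f` and `f⁻¹`, which contains with each of its points the
plaque of size `δ` of the family `W` at that point. -/
structure IsSaturatedBy (f : Diff1 d M) {F : (x : M) → Submodule ℝ (Tan d x)}
    (W : (x : M) → F x → M) (δ : ℝ) (Λ : Set M) : Prop where
  isClosed : IsClosed Λ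
  map : ∀ y ∈ Λ, f y ∈ Λ
  map_symm : ∀ y ∈ Λ, f.symm y ∈ Λ
  plaque : ∀ y ∈ Λ, ∀ b : F y, plaqueSize W y b < δ → W y b ∈ Λ

/-- The closure of the union of the leaves through an orbit is saturated by small plaques. The strict
inequality in `IsSaturatedBy` lets the plaque condition pass to the limit. -/
theorem isSaturatedBy_closure_iUnion_leaf (hF : IsSubbundle F) (hinv : IsInvariantBundle f F)
    (hW : IsPlaqueFamily F W) {δ : ℝ}
    (hδ : ∀ x, ∀ b : F x, plaqueSize W x b ≤ δ → ∀ w, plaqueD W x b w ∈ bundleSet F) (x : M) :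
    IsSaturatedBy f W δ (closure (⋃ n : ℤ, leaf F ((f.toEquiv ^ n : Equiv.Perm M) x))) where
  isClosed := isClosed_closure
  map y hy := by
    refine map_mem_closure f.continuous hy fun y hy => ?_
    obtain ⟨n, hn⟩ := mem_iUnion.1 hy
    refine mem_iUnion.2 ⟨1 + n, ?_⟩
    rw [zpow_add, zpow_one]
    exact map_mem_leaf f.contMDiff (fun u hu => tmap_mem_bundleSet hinv 1 hu) hn
  map_symm y hy := by
    refine map_mem_closure f.symm.continuous hy fun y hy => ?_
    obtain ⟨n, hn⟩ := mem_iUnion.1 hy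
    refine mem_iUnion.2 ⟨-1 + n, ?_⟩
    rw [zpow_add, zpow_neg_one]
    exact map_mem_leaf f.symm.contMDiff (fun u hu => tmap_symm_mem_bundleSet hinv 1 hu) hn
  plaque y hy b hb := by
    obtain ⟨fr⟩ := hF.nonempty_localFrame y
    obtain ⟨c, rfl⟩ := (fr.bijective y fr.mem).2 b
    rw [mem_closure_iff_frequently] at hy
    have h1 : Tendsto (fun x' => W x' (fr.j x' c)) (𝓝 y) (𝓝 (W y (fr.j y c))) :=
      (hW.continuousAt_plaque fr fr.mem c).comp
        (f := fun x' => (x', c)) (continuousAt_id.prodMk continuousAt_const)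
    have h2 : ∀ᶠ x' in 𝓝 y, plaqueSize W x' (fr.j x' c) < δ :=
      ((hW.continuousAt_plaqueSize fr fr.mem c).comp
        (f := fun x' => (x', c)) (continuousAt_id.prodMk continuousAt_const)).eventually_lt_const hb
    refine mem_closure_iff_frequently.2 (h1.frequently ((hy.and_eventually h2).mono ?_))
    rintro x' ⟨hx', hs⟩
    obtain ⟨n, hn⟩ := mem_iUnion.1 hx'
    exact mem_iUnion.2 ⟨n, leaf_trans hn (hW.mem_leaf hδ hs.le)⟩

/-- Every leaf contains a point whose forward orbit accumulates on `qs`. -/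
theorem exists_mem_leaf_mem_limitSet [CompactSpace M] (hd : IsDominatedSplitting f E F)
    (hWE : IsPlaqueFamily E WE) (htrapE : IsTrapped f WE) (hW : IsPlaqueFamily F W) {δ : ℝ}
    (hδ0 : 0 < δ)
    (hδ : ∀ x, ∀ b : F x, plaqueSize W x b ≤ δ → ∀ w, plaqueD W x b w ∈ bundleSet F)
    (hqs : qs ∈ periodicPts f) (hs : range (WE qs) ⊆ stableManifold f qs)
    (hdense : Dense {y | qs ∈ limitSet f y}) (x : M) : ∃ y ∈ leaf F x, qs ∈ limitSet f y := by
  obtain ⟨m, hm, hmq⟩ := hqs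
  obtain ⟨U, hU, hprod⟩ := exists_local_product hd.subbundle_left hd.subbundle_right hd.isCompl
    hWE hW x hδ0
  obtain ⟨g, hgG, hgU⟩ := hdense.inter_nhds_nonempty hU
  obtain ⟨b, hb, e, he⟩ := hprod x (mem_of_mem_nhds hU) g hgU
  exact ⟨W x b, hW.mem_leaf hδ hb, he ▸ hWE.mem_limitSet htrapE hm hmq hs hgG e⟩

end

/-! ### Hyperbolic coordinates at a periodic point -/

section

section Cones

/-- Forward cone estimate: if the unstable part of a nearly hyperbolic sequence stays bounded, then
the stable part dominates it and does not grow. -/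
theorem cone_of_bounded {s u : ℕ → ℝ} (hs0 : ∀ n, 0 ≤ s n)
    (hs : ∀ n, s (n + 1) ≤ 1 / 4 * s n + 1 / 8 * (s n + u n))
    (hu : ∀ n, 4 * u n - 1 / 8 * (s n + u n) ≤ u (n + 1)) {B : ℝ} (hB : ∀ n, u n ≤ B) :
    ∀ n, u n ≤ s n ∧ s n ≤ s 0 := by
  have h1 : ∀ n, u n ≤ s n := by
    by_contra! h
    obtain ⟨n, hn⟩ := h
    -- once the unstable part is the larger one, it stays so and doubles at each step
    have h2 : ∀ k, s (n + k) < u (n + k) ∧ 2 ^ k * u n ≤ u (n + k) := by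
      intro k
      induction k with
      | zero => simpa using hn
      | succ k ih =>
        have a := hs (n + k)
        have b := hu (n + k)
        have c := hs0 (n + k)
        rw [← add_assoc, pow_succ]
        constructor <;> linarith
    have h3 : 0 < u n := (hs0 n).trans_lt hn
    obtain ⟨k, hk⟩ := pow_unbounded_of_one_lt (B / u n) (one_lt_two : (1 : ℝ) < 2)
    rw [div_lt_iff₀ h3] at hk
    have := (h2 k).2
    have := hB (n + k)
    linarith
  refine fun n => ⟨h1 n, ?_⟩
  induction n with
  | zero => exact le_rfl
  | succ n ih => have := hs n; have := h1 n; have := hs0 n; linarith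

/-- Backward cone estimate: if the stable part of a nearly hyperbolic sequence of preimages stays
bounded, then the unstable part dominates it. -/
theorem cone_of_bounded_backward {s u : ℕ → ℝ} (hs0 : ∀ n, 0 ≤ s n) (hu0 : ∀ n, 0 ≤ u n)
    (hs : ∀ n, s n ≤ 1 / 4 * s (n + 1) + 1 / 8 * (s (n + 1) + u (n + 1)))
    (hu : ∀ n, 4 * u (n + 1) - 1 / 8 * (s (n + 1) + u (n + 1)) ≤ u n) {B : ℝ}
    (hB : ∀ n, s n ≤ B) : s 0 ≤ u 0 := by
  by_contra! h
  have h2 : ∀ k, u k < s k ∧ 2 ^ k * s 0 ≤ s k := by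
    intro k
    induction k with
    | zero => simpa using h
    | succ k ih =>
      have a := hs k
      have b := hu k
      -- the unstable part would stay dominant on the way from time `k + 1` to time `k`
      have h3 : u (k + 1) < s (k + 1) := by
        by_contra! h4
        have := hu0 (k + 1)
        have := hs0 (k + 1)
        linarith
      refine ⟨h3, ?_⟩
      have := hs0 (k + 1)
      rw [pow_succ]
      linarith
  have h3 : 0 < s 0 := (hu0 0).trans_lt h
  obtain ⟨k, hk⟩ := pow_unbounded_of_one_lt (B / s 0) (one_lt_two : (1 : ℝ) < 2)
  rw [div_lt_iff₀ h3] at hk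
  have := (h2 k).2
  have := hB k
  linarith

end Cones

section Chart

variable {d : ℕ} {M : Type*} [TopologicalSpace M] [ChartedSpace (EuclideanSpace ℝ (Fin d)) M]
  [IsManifold (𝓡 d) ∞ M] {f : Diff1 d M} {q : M}

/-- The iterate `f^[K]` read in the chart at a point `q` fixed by it. -/
theorem exists_contDiffAt_chart {K : ℕ} (hK : f^[K] q = q) :
    ∃ G : EuclideanSpace ℝ (Fin d) → EuclideanSpace ℝ (Fin d),
      ContDiffAt ℝ 1 G (extChartAt (𝓡 d) q q) ∧
      ∀ x ∈ (extChartAt (𝓡 d) q).source,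
        G (extChartAt (𝓡 d) q x) = extChartAt (𝓡 d) q (f^[K] x) := by
  set φ := extChartAt (𝓡 d) q with hφ
  have hφq : φ.symm (φ q) = q := φ.left_inv (mem_extChartAt_source q)
  refine ⟨fun h => φ (f^[K] (φ.symm h)), ?_, fun x hx => by
    simp only [φ.left_inv hx]⟩
  rw [← contMDiffAt_iff_contDiffAt]
  have h1 : ContMDiffAt 𝓘(ℝ, EuclideanSpace ℝ (Fin d)) (𝓡 d) 1 φ.symm (φ q) :=
    ((contMDiffOn_extChartAt_symm (n := ∞) q).contMDiffAt (extChartAt_target_mem_nhds q)).of_le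
      (by norm_cast)
  have h2 : ContMDiffAt 𝓘(ℝ, EuclideanSpace ℝ (Fin d)) (𝓡 d) 1 (f^[K] ∘ φ.symm) (φ q) :=
    ((contMDiff_iterate f K) _).comp _ h1
  have h3 : ContMDiffAt (𝓡 d) 𝓘(ℝ, EuclideanSpace ℝ (Fin d)) 1 φ ((f^[K] ∘ φ.symm) (φ q)) := by
    rw [comp_apply, hφq, hK]
    exact (contMDiffAt_extChartAt (n := ∞)).of_le (by norm_cast)
  exact h3.comp _ h2

/-- The chain rule for an iterate read in a chart. -/
theorem fderiv_chart_coord {K : ℕ} {G : EuclideanSpace ℝ (Fin d) → EuclideanSpace ℝ (Fin d)}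
    (hGφ : ∀ x ∈ (extChartAt (𝓡 d) q).source,
      G (extChartAt (𝓡 d) q x) = extChartAt (𝓡 d) q (f^[K] x)) {u : TangentBundle (𝓡 d) M}
    (hu : u.1 ∈ (extChartAt (𝓡 d) q).source) (hfu : f^[K] u.1 ∈ (extChartAt (𝓡 d) q).source)
    (hd : DifferentiableAt ℝ G (extChartAt (𝓡 d) q u.1)) :
    fderiv ℝ G (extChartAt (𝓡 d) q u.1) (coord q u) = coord q (tmap f K u) := by
  set φ := extChartAt (𝓡 d) q with hφ
  have h1 : MDifferentiableAt (𝓡 d) 𝓘(ℝ, EuclideanSpace ℝ (Fin d)) φ u.1 :=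
    mdifferentiableAt_extChartAt (by rwa [hφ, extChartAt_source] at hu)
  have h2 : MDifferentiableAt (𝓡 d) 𝓘(ℝ, EuclideanSpace ℝ (Fin d)) φ (f^[K] u.1) :=
    mdifferentiableAt_extChartAt (by rwa [hφ, extChartAt_source] at hfu)
  have e1 := hd.mdifferentiableAt.hasMFDerivAt.comp u.1 h1.hasMFDerivAt
  have e2 := h2.hasMFDerivAt.comp u.1 (mdifferentiable_iterate f K u.1).hasMFDerivAt
  have e3 : (φ ∘ f^[K]) =ᶠ[𝓝 u.1] G ∘ φ := by
    filter_upwards [(isOpen_extChartAt_source q).mem_nhds hu] with x hx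
    exact (hGφ x hx).symm
  have e4 := hasMFDerivAt_unique (e1.congr_of_eventuallyEq e3) e2
  have e5 := congrArg (fun T : Tan d u.1 →L[ℝ] EuclideanSpace ℝ (Fin d) => T u.2) e4
  refine Eq.trans ?_ e5
  change _ = (mfderiv 𝓘(ℝ, EuclideanSpace ℝ (Fin d)) 𝓘(ℝ, EuclideanSpace ℝ (Fin d)) G (φ u.1))
    (coord q u)
  rw [mfderiv_eq_fderiv]
  rfl

/-- Near a point `q` fixed by it, the iterate `f^[K]` is uniformly approximated in the chart at `q`
by its derivative `A` there, both for differences of points and for tangent vectors. -/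
theorem exists_nhds_approx {K : ℕ} (hK : f^[K] q = q)
    {A : EuclideanSpace ℝ (Fin d) →L[ℝ] EuclideanSpace ℝ (Fin d)}
    (hA : ∀ v : Tan d q, A (coord q ⟨q, v⟩) = coord q (tmap f K ⟨q, v⟩)) {η : ℝ} (hη : 0 < η) :
    ∃ B ∈ 𝓝 q, B ⊆ (extChartAt (𝓡 d) q).source ∧
      (∀ x ∈ B, ∀ x' ∈ B, ‖extChartAt (𝓡 d) q (f^[K] x) - extChartAt (𝓡 d) q (f^[K] x')
        - A (extChartAt (𝓡 d) q x - extChartAt (𝓡 d) q x')‖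
        ≤ η * ‖extChartAt (𝓡 d) q x - extChartAt (𝓡 d) q x'‖) ∧
      ∀ u : TangentBundle (𝓡 d) M, u.1 ∈ B →
        ‖coord q (tmap f K u) - A (coord q u)‖ ≤ η * ‖coord q u‖ := by
  obtain ⟨G, hG, hGφ⟩ := exists_contDiffAt_chart hK
  set φ := extChartAt (𝓡 d) q with hφ
  have hchain := fun u => fderiv_chart_coord (u := u) hGφ
  have hAG : fderiv ℝ G (φ q) = A := by
    ext1 w
    obtain ⟨v, rfl⟩ := chartD_surjective (mem_extChartAt_source (I := 𝓡 d) q) w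
    have h1 := hchain ⟨q, v⟩ (mem_extChartAt_source q) (by rw [hK]; exact mem_extChartAt_source q)
      (hG.differentiableAt one_ne_zero)
    exact h1.trans (hA v).symm
  have hstrict : HasStrictFDerivAt G A (φ q) := by
    rw [← hAG]; exact hG.hasStrictFDerivAt one_ne_zero
  have hcont : ContinuousAt φ q := continuousAt_extChartAt q
  have h1 : ∀ᶠ p in 𝓝 (φ q, φ q), ‖G p.1 - G p.2 - A (p.1 - p.2)‖ ≤ η * ‖p.1 - p.2‖ :=
    hstrict.isLittleO.def hη
  rw [nhds_prod_eq] at h1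
  obtain ⟨P, hP, Q, hQ, h1⟩ := eventually_prod_iff.1 h1
  have h2 : ∀ᶠ h in 𝓝 (φ q), ‖fderiv ℝ G h - A‖ ≤ η := by
    have h0 : ContDiffAt ℝ 0 (fderiv ℝ G) (φ q) := hG.fderiv_right (by simp)
    have := (h0.continuousAt.tendsto.sub_const A).norm
    rw [hAG, sub_self, norm_zero] at this
    exact this.eventually_le_const hη
  have h3 : ∀ᶠ h in 𝓝 (φ q), DifferentiableAt ℝ G h :=
    (hG.eventually (by simp)).mono fun h hh => hh.differentiableAt one_ne_zero
  have h4 : ∀ᶠ x in 𝓝 q, f^[K] x ∈ φ.source := by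
    refine (continuous_iterate f K).continuousAt.eventually_mem ?_
    rw [hK]; exact extChartAt_source_mem_nhds q
  have h5 : ∀ᶠ x in 𝓝 q, x ∈ φ.source := extChartAt_source_mem_nhds q
  obtain ⟨B, hB, hBP⟩ := ((hcont.eventually (hP.and hQ)).and ((hcont.eventually h2).and
    ((hcont.eventually h3).and (h4.and h5)))).exists_mem
  refine ⟨B, hB, fun x hx => (hBP x hx).2.2.2.2, fun x hx x' hx' => ?_, fun u hu => ?_⟩
  · have := h1 (hBP x hx).1.1 (hBP x' hx').1.2
    rwa [hGφ x (hBP x hx).2.2.2.2, hGφ x' (hBP x' hx').2.2.2.2] at this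
  · obtain ⟨-, hu2, hu3, hu4, hu5⟩ := hBP _ hu
    rw [← hchain u hu5 hu4 hu3, ← sub_apply]
    exact (ContinuousLinearMap.le_opNorm _ _).trans
      (mul_le_mul_of_nonneg_right hu2 (norm_nonneg _))

end Chart

variable {d : ℕ} {M : Type*} [EMetricSpace M] [ChartedSpace (EuclideanSpace ℝ (Fin d)) M]
  [IsManifold (𝓡 d) ∞ M] [RiemannianBundle (fun x : M => TangentSpace (𝓡 d) x)]
  [IsContinuousRiemannianBundle (EuclideanSpace ℝ (Fin d)) (fun x : M => TangentSpace (𝓡 d) x)]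

/-- Hyperbolic coordinates at a periodic point `q`: the derivative `A` of a suitable multiple of the
first return, read in the chart at `q`, contracts a projection `πs` and expands a projection `πu`,
which together are injective. -/
structure HyperbolicChart (f : Diff1 d M) (q : M) where
  /-- A period of `q`. -/
  K : ℕ
  K_pos : 0 < K
  map_eq : f^[K] q = q
  /-- The stable space. -/
  Es : Submodule ℝ (Tan d q)
  /-- The unstable space. -/
  Eu : Submodule ℝ (Tan d q)
  /-- The stable projection. -/
  πs : EuclideanSpace ℝ (Fin d) →L[ℝ] Es
  /-- The unstable projection. -/
  πu : EuclideanSpace ℝ (Fin d) →L[ℝ] Eu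
  /-- The derivative of `f^[K]` at `q`, read in the chart. -/
  A : EuclideanSpace ℝ (Fin d) →L[ℝ] EuclideanSpace ℝ (Fin d)
  /-- A constant comparing the norm with that of the two components. -/
  C : ℝ
  C_nonneg : 0 ≤ C
  norm_le : ∀ w, ‖w‖ ≤ C * (‖πs w‖ + ‖πu w‖)
  surjective_πu : Surjective πu
  A_coord : ∀ v : Tan d q, A (coord q ⟨q, v⟩) = coord q (tmap f K ⟨q, v⟩)
  norm_πs_A_le : ∀ w, ‖πs (A w)‖ ≤ 1 / 4 * ‖πs w‖
  le_norm_πu_A : ∀ w, 4 * ‖πu w‖ ≤ ‖πu (A w)‖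

/-- A family of subspaces that is invariant along the orbit of `q` only is invariant under the iterates
at `q`. -/
theorem dIter_mem_of_orbit {f : Diff1 d M} {q : M} {E : (x : M) → Submodule ℝ (Tan d x)}
    (h : ∀ x ∈ orbit f q,
      (E x).map (mfderiv (𝓡 d) (𝓡 d) f x : Tan d x →ₗ[ℝ] Tan d (f x)) = E (f x)) (n : ℕ)
    {v : Tan d q} (hv : v ∈ E q) : tmap f n ⟨q, v⟩ ∈ bundleSet E := by
  induction n with
  | zero => rwa [tmap_zero]
  | succ n ih =>
    rw [Nat.add_comm, tmap_add]
    have h1 : mfderiv (𝓡 d) (𝓡 d) f (f^[n] q) (dIter f n q v) ∈ E (f (f^[n] q)) := by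
      rw [← h (f^[n] q) ⟨n, rfl⟩]
      exact Submodule.mem_map.2 ⟨_, ih, rfl⟩
    exact h1

/-- A hyperbolic periodic point has hyperbolic coordinates: `K` is a large multiple of the period. -/
theorem IsHyperbolicPeriodic.nonempty_hyperbolicChart {f : Diff1 d M} {q : M}
    (hq : IsHyperbolicPeriodic f q) : Nonempty (HyperbolicChart f q) := by
  obtain ⟨⟨m, hm, hmq⟩, Es, Eu, hinv, ⟨Cs, ls, hCs, hls0, hls1, hs⟩, Cu, lu, hCu, hlu, hu⟩ := hq
  have hq0 : q ∈ orbit f q := ⟨0, rfl⟩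
  have hj := tendsto_id.const_mul_atTop' hm
  have h1 : ∀ᶠ j : ℕ in atTop, Cs * ls ^ (m * j) ≤ 1 / 4 := by
    have := ((tendsto_pow_atTop_nhds_zero_of_lt_one hls0.le hls1).comp hj).const_mul Cs
    rw [mul_zero] at this
    exact this.eventually_le_const (by norm_num)
  have h2 : ∀ᶠ j : ℕ in atTop, 4 ≤ Cu * lu ^ (m * j) :=
    (((tendsto_pow_atTop_atTop_of_one_lt hlu).comp hj).const_mul_atTop hCu).eventually_ge_atTop 4
  obtain ⟨j, h1, h2, hj0⟩ := (h1.and (h2.and (eventually_gt_atTop 0))).exists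
  obtain ⟨K, hK⟩ : ∃ K, K = m * j := ⟨_, rfl⟩
  rw [← hK] at h1 h2
  have hKq : f^[K] q = q := by rw [hK]; exact (hmq.mul_const j).eq
  obtain ⟨Θ, hΘ⟩ := isInvertible_chartD (mem_extChartAt_source (I := 𝓡 d) q)
  have hΘ' : ∀ v, Θ v = chartD d q q v := fun v => by rw [← hΘ]; rfl
  have hc := (hinv q hq0).1
  let A : EuclideanSpace ℝ (Fin d) →L[ℝ] EuclideanSpace ℝ (Fin d) :=
    (chartD d q (f^[K] q)).comp ((dIter f K q).comp (Θ.symm : EuclideanSpace ℝ (Fin d) →L[ℝ] Tan d q))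
  have hA : ∀ v, A (Θ v) = coord q (tmap f K ⟨q, v⟩) := fun v => by
    change chartD d q (f^[K] q) (dIter f K q (Θ.symm (Θ v))) = _
    rw [Θ.symm_apply_apply]; rfl
  -- transport from `f^[K] q` to `q`, which are equal but not by definition
  have hmove : ∀ u : TangentBundle (𝓡 d) M, u.1 = q → ∀ B : (x : M) → Submodule ℝ (Tan d x),
      u ∈ bundleSet B → ∃ v' ∈ B q, coord q u = Θ v' ∧ ‖v'‖ = nrm u := by
    rintro ⟨x, v⟩ hx B hB
    obtain rfl : x = q := hx
    exact ⟨v, hB, (hΘ' v).symm, rfl⟩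
  -- `A` acts on the stable and unstable components separately
  have key : ∀ w, ∃ vs : Es q, ∃ vu : Eu q, ∃ vs' : Es q, ∃ vu' : Eu q, w = Θ (vs + vu) ∧
      A w = Θ (vs' + vu') ∧ ‖vs'‖ ≤ 1 / 4 * ‖vs‖ ∧ 4 * ‖vu‖ ≤ ‖vu'‖ := by
    intro w
    have hmem : Θ.symm w ∈ Es q ⊔ Eu q := by rw [hc.sup_eq_top]; trivial
    obtain ⟨vs, hvs, vu, hvu, hadd⟩ := Submodule.mem_sup.1 hmem
    obtain ⟨vs', hvs', e1, n1⟩ := hmove _ hKq _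
      (dIter_mem_of_orbit (fun x hx => (hinv x hx).2.1) K hvs)
    obtain ⟨vu', hvu', e2, n2⟩ := hmove _ hKq _
      (dIter_mem_of_orbit (fun x hx => (hinv x hx).2.2) K hvu)
    have hw : w = Θ (vs + vu) := by rw [hadd, Θ.apply_symm_apply]
    refine ⟨⟨vs, hvs⟩, ⟨vu, hvu⟩, ⟨vs', hvs'⟩, ⟨vu', hvu'⟩, hw, ?_, ?_, ?_⟩
    · rw [hw, map_add, map_add, hA, hA, e1, e2, ← map_add]
    · change ‖vs'‖ ≤ 1 / 4 * ‖vs‖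
      rw [n1]
      exact (hs q hq0 vs hvs K).trans (mul_le_mul_of_nonneg_right h1 (norm_nonneg _))
    · change 4 * ‖vu‖ ≤ ‖vu'‖
      rw [n2]
      exact (mul_le_mul_of_nonneg_right h2 (norm_nonneg _)).trans (hu q hq0 vu hvu K)
  let Ps : Tan d q →L[ℝ] Es q := LinearMap.toContinuousLinearMap ((Es q).projectionOnto (Eu q) hc)
  let Pu : Tan d q →L[ℝ] Eu q :=
    LinearMap.toContinuousLinearMap ((Eu q).projectionOnto (Es q) hc.symm)
  have hPs : ∀ (vs : Es q) (vu : Eu q), Ps (Θ.symm (Θ (vs + vu))) = vs := fun vs vu => by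
    rw [Θ.symm_apply_apply]
    change (Es q).projectionOnto (Eu q) hc (vs + vu) = vs
    rw [map_add, Submodule.projectionOnto_apply_left, Submodule.projectionOnto_apply_right,
      add_zero]
  have hPu : ∀ (vs : Es q) (vu : Eu q), Pu (Θ.symm (Θ (vs + vu))) = vu := fun vs vu => by
    rw [Θ.symm_apply_apply]
    change (Eu q).projectionOnto (Es q) hc.symm (vs + vu) = vu
    rw [map_add, Submodule.projectionOnto_apply_left, Submodule.projectionOnto_apply_right,
      zero_add]
  refine ⟨⟨K, hK ▸ Nat.mul_pos hm hj0, hKq, Es q, Eu q,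
    Ps.comp (Θ.symm : EuclideanSpace ℝ (Fin d) →L[ℝ] Tan d q),
    Pu.comp (Θ.symm : EuclideanSpace ℝ (Fin d) →L[ℝ] Tan d q), A, ‖chartD d q q‖,
    ContinuousLinearMap.opNorm_nonneg _, fun w => ?_, fun v => ?_, fun v => ?_, fun w => ?_, fun w => ?_⟩⟩
  · obtain ⟨vs, vu, vs', vu', rfl, -⟩ := key w
    change _ ≤ _ * (‖Ps (Θ.symm (Θ (vs + vu)))‖ + ‖Pu (Θ.symm (Θ (vs + vu)))‖)
    rw [hPs, hPu, hΘ']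
    exact ((chartD d q q).le_opNorm _).trans
      (mul_le_mul_of_nonneg_left (norm_add_le _ _)
      (ContinuousLinearMap.opNorm_nonneg _))
  · refine ⟨Θ (((0 : Es q) : Tan d q) + v), hPu 0 v⟩
  · rw [← hA, hΘ']; rfl
  · obtain ⟨vs, vu, vs', vu', rfl, h3, h4, -⟩ := key w
    change ‖Ps (Θ.symm (A (Θ (vs + vu))))‖ ≤ 1 / 4 * ‖Ps (Θ.symm (Θ (vs + vu)))‖
    rwa [h3, hPs, hPs]
  · obtain ⟨vs, vu, vs', vu', rfl, h3, -, h4⟩ := key w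
    change 4 * ‖Pu (Θ.symm (Θ (vs + vu)))‖ ≤ ‖Pu (Θ.symm (A (Θ (vs + vu))))‖
    rwa [h3, hPu, hPu]

end

/-! ### Bounded vectors at a point attracted by a periodic orbit -/

section

section Derivative

/-- An inequality between increments gives the same inequality between derivatives. -/
theorem norm_deriv_le_of_increments {V V' : Type*} [NormedAddCommGroup V] [NormedSpace ℝ V]
    [NormedAddCommGroup V'] [NormedSpace ℝ V'] {g : ℝ → V} {h : ℝ → V'} {g' : V} {h' : V'} {t₀ C : ℝ}
    (hg : HasDerivAt g g' t₀) (hh : HasDerivAt h h' t₀)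
    (hle : ∀ t, ‖g t - g t₀‖ ≤ C * ‖h t - h t₀‖) : ‖g'‖ ≤ C * ‖h'‖ := by
  rw [hasDerivAt_iff_tendsto_slope] at hg hh
  refine le_of_tendsto_of_tendsto' hg.norm (hh.norm.const_mul C) fun t => ?_
  rw [slope_def_module, slope_def_module, norm_smul, norm_smul]
  have := mul_le_mul_of_nonneg_left (hle t) (norm_nonneg (t - t₀)⁻¹)
  linarith

end Derivative

variable {d : ℕ} {M : Type*} [EMetricSpace M] [ChartedSpace (EuclideanSpace ℝ (Fin d)) M]
  [IsManifold (𝓡 d) ∞ M] [RiemannianBundle (fun x : M => TangentSpace (𝓡 d) x)]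
  [IsContinuousRiemannianBundle (EuclideanSpace ℝ (Fin d)) (fun x : M => TangentSpace (𝓡 d) x)]
  {f : Diff1 d M} {E F : (x : M) → Submodule ℝ (Tan d x)} {q y : M}

/-- The step from `w` to `w'` is nearly hyperbolic: it satisfies the inequalities of the cone estimates
`cone_of_bounded` and `cone_of_bounded_backward`. -/
def HyperbolicChart.Step (c : HyperbolicChart f q) (w w' : EuclideanSpace ℝ (Fin d)) : Prop :=
  ‖c.πs w'‖ ≤ 1 / 4 * ‖c.πs w‖ + 1 / 8 * (‖c.πs w‖ + ‖c.πu w‖) ∧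
    4 * ‖c.πu w‖ - 1 / 8 * (‖c.πs w‖ + ‖c.πu w‖) ≤ ‖c.πu w'‖

/-- Small relative perturbations of the linear map `c.A` are nearly hyperbolic. -/
theorem HyperbolicChart.exists_step (c : HyperbolicChart f q) : ∃ η > 0, ∀ w w',
    ‖w' - c.A w‖ ≤ η * ‖w‖ → c.Step w w' := by
  set P := ‖c.πs‖ + ‖c.πu‖ + 1 with hP
  have hs := ContinuousLinearMap.opNorm_nonneg c.πs
  have hu := ContinuousLinearMap.opNorm_nonneg c.πu
  have hC := c.C_nonneg
  have hP0 : 0 < P := by linarith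
  refine ⟨1 / (8 * P * (c.C + 1)), by positivity, fun w w' h => ?_⟩
  have h1 : P * ‖w' - c.A w‖ ≤ 1 / 8 * (‖c.πs w‖ + ‖c.πu w‖) := by
    calc P * ‖w' - c.A w‖ ≤ P * (1 / (8 * P * (c.C + 1)) * ‖w‖) := by gcongr
      _ = 1 / 8 * (‖w‖ / (c.C + 1)) := by field_simp
      _ ≤ 1 / 8 * (‖c.πs w‖ + ‖c.πu w‖) := by
        gcongr
        rw [div_le_iff₀ (by linarith)]
        have := c.norm_le w
        have h0 : 0 ≤ ‖c.πs w‖ + ‖c.πu w‖ := by positivity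
        linarith
  have h2 : ‖c.πs (w' - c.A w)‖ ≤ P * ‖w' - c.A w‖ := (c.πs.le_opNorm _).trans (by gcongr; linarith)
  have h3 : ‖c.πu (w' - c.A w)‖ ≤ P * ‖w' - c.A w‖ := (c.πu.le_opNorm _).trans (by gcongr; linarith)
  rw [map_sub] at h2 h3
  have h4 := norm_le_insert' (c.πs w') (c.πs (c.A w))
  have h5 := norm_le_insert (c.πu w') (c.πu (c.A w))
  have h6 := c.norm_πs_A_le w
  have h7 := c.le_norm_πu_A w
  constructor <;> linarith

/-- A neighbourhood of `q` on which `f^[K]` is nearly hyperbolic, for the differences of points as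
well as for tangent vectors. -/
structure HyperbolicChart.IsAdapted (c : HyperbolicChart f q) (B : Set M) : Prop where
  mem_nhds : B ∈ 𝓝 q
  subset : B ⊆ (extChartAt (𝓡 d) q).source
  bounded : ∀ x ∈ B, ‖extChartAt (𝓡 d) q x - extChartAt (𝓡 d) q q‖ ≤ 1
  step_sub : ∀ x ∈ B, ∀ x' ∈ B, c.Step (extChartAt (𝓡 d) q x - extChartAt (𝓡 d) q x')
    (extChartAt (𝓡 d) q (f^[c.K] x) - extChartAt (𝓡 d) q (f^[c.K] x'))
  step_coord : ∀ u : TangentBundle (𝓡 d) M, u.1 ∈ B → c.Step (coord q u) (coord q (tmap f c.K u))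
  nrm_le : ∃ L, 0 ≤ L ∧ ∀ u : TangentBundle (𝓡 d) M, u.1 ∈ B → nrm u ≤ L * ‖coord q u‖

/-- Near `q` the Riemannian norms are bounded by one multiple of the norm of the coordinates. -/
theorem exists_nrm_le_coord (q : M) : ∃ L, 0 ≤ L ∧ ∀ᶠ x in 𝓝 q, ∀ v : Tan d x,
    ‖v‖ ≤ L * ‖coord q ⟨x, v⟩‖ := by
  obtain ⟨L, hL, h⟩ := eventually_norm_symmL_trivializationAt_lt (EuclideanSpace ℝ (Fin d))
    (fun x : M => TangentSpace (𝓡 d) x) q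
  refine ⟨L, hL.le, ?_⟩
  filter_upwards [h, extChartAt_source_mem_nhds (I := 𝓡 d) q] with x hx hxs v
  have h1 : (trivializationAt (EuclideanSpace ℝ (Fin d)) (TangentSpace (𝓡 d)) q).symmL ℝ x
      (coord q ⟨x, v⟩) = v := by
    rw [coord, chartD_eq hxs]
    refine Trivialization.symmL_continuousLinearMapAt _ ?_ _
    simpa using hxs
  have h2 := ContinuousLinearMap.le_opNorm
    ((trivializationAt (EuclideanSpace ℝ (Fin d)) (TangentSpace (𝓡 d)) q).symmL ℝ x)
    (coord q ⟨x, v⟩)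
  rw [h1] at h2
  exact h2.trans (mul_le_mul_of_nonneg_right hx.le (norm_nonneg _))

theorem HyperbolicChart.exists_isAdapted (c : HyperbolicChart f q) : ∃ B, c.IsAdapted B := by
  obtain ⟨η, hη, hstep⟩ := c.exists_step
  obtain ⟨B, hB, hBs, h1, h2⟩ := exists_nhds_approx c.map_eq c.A_coord hη
  obtain ⟨L, hL, h3⟩ := exists_nrm_le_coord (d := d) q
  have h4 : ∀ᶠ x in 𝓝 q, ‖extChartAt (𝓡 d) q x - extChartAt (𝓡 d) q q‖ ≤ 1 := by
    have := ((continuousAt_extChartAt (I := 𝓡 d) q).tendsto.sub_const (extChartAt (𝓡 d) q q)).norm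
    rw [sub_self, norm_zero] at this
    exact this.eventually_le_const one_pos
  obtain ⟨B', hB', h5⟩ := (h3.and h4).exists_mem
  exact ⟨B ∩ B', inter_mem hB hB', fun x hx => hBs hx.1, fun x hx => (h5 x hx.2).2,
    fun x hx x' hx' => hstep _ _ (h1 x hx.1 x' hx'.1), fun u hu => hstep _ _ (h2 u hu.1),
    L, hL, fun u hu => (h5 _ hu.2).1 u.2⟩

/-- The forward cone estimate for a bounded sequence of nearly hyperbolic steps. -/
theorem HyperbolicChart.cone (c : HyperbolicChart f q) {w : ℕ → EuclideanSpace ℝ (Fin d)}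
    (hw : ∀ n, c.Step (w n) (w (n + 1))) {R : ℝ} (hR : ∀ n, ‖w n‖ ≤ R) (n : ℕ) :
    ‖c.πu (w n)‖ ≤ ‖c.πs (w n)‖ ∧ ‖c.πs (w n)‖ ≤ ‖c.πs (w 0)‖ :=
  cone_of_bounded (s := fun n => ‖c.πs (w n)‖) (u := fun n => ‖c.πu (w n)‖)
    (fun _ => norm_nonneg _) (fun n => (hw n).1) (fun n => (hw n).2) (B := ‖c.πu‖ * R)
    (fun n => (c.πu.le_opNorm _).trans (mul_le_mul_of_nonneg_left (hR n)
      (ContinuousLinearMap.opNorm_nonneg _))) n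

/-- A bounded sequence of nearly hyperbolic steps is bounded by a multiple of its first term. The
constant does not depend on the bound `R`, so the estimate passes to derivatives. -/
theorem HyperbolicChart.norm_le_of_bounded (c : HyperbolicChart f q) : ∃ C, 0 ≤ C ∧
    ∀ w : ℕ → EuclideanSpace ℝ (Fin d), (∀ n, c.Step (w n) (w (n + 1))) →
    ∀ R, (∀ n, ‖w n‖ ≤ R) → ∀ n, ‖w n‖ ≤ C * ‖w 0‖ := by
  have h0 := ContinuousLinearMap.opNorm_nonneg c.πs
  have hC := c.C_nonneg
  refine ⟨c.C * (2 * ‖c.πs‖), by positivity, fun w hw R hR n => ?_⟩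
  obtain ⟨h1, h2⟩ := c.cone hw hR n
  have h3 := c.πs.le_opNorm (w 0)
  calc ‖w n‖ ≤ c.C * (‖c.πs (w n)‖ + ‖c.πu (w n)‖) := c.norm_le _
    _ ≤ c.C * (2 * (‖c.πs‖ * ‖w 0‖)) := by gcongr; linarith
    _ = _ := by ring

theorem tmap_mul_succ (f : Diff1 d M) (K n : ℕ) (u : TangentBundle (𝓡 d) M) :
    tmap f (K * (n + 1)) u = tmap f K (tmap f (K * n) u) := by
  rw [Nat.mul_succ, Nat.add_comm, tmap_add]

theorem iterate_mul_succ {X : Type*} (f : X → X) (K n : ℕ) (x : X) :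
    f^[K * (n + 1)] x = f^[K] (f^[K * n] x) := by
  rw [Nat.mul_succ, Nat.add_comm, Function.iterate_add_apply]

/-- The tangent vectors at `y` whose iterates under the multiples of `f^[K]` are eventually bounded in
the chart at `q`; meaningful if these iterates send `y` close to `q`. -/
def HyperbolicChart.boundedSpace (c : HyperbolicChart f q) (y : M) : Submodule ℝ (Tan d y) where
  carrier := {v | ∃ R, ∀ᶠ n : ℕ in atTop, ‖coord q (tmap f (c.K * n) ⟨y, v⟩)‖ ≤ R}
  zero_mem' := by
    refine ⟨0, Eventually.of_forall fun n => ?_⟩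
    change ‖chartD d q _ (dIter f (c.K * n) y 0)‖ ≤ 0
    rw [map_zero, map_zero, norm_zero]
  add_mem' := by
    rintro v w ⟨R, hR⟩ ⟨R', hR'⟩
    refine ⟨R + R', ?_⟩
    filter_upwards [hR, hR'] with n h h'
    change ‖chartD d q _ (dIter f (c.K * n) y (v + w))‖ ≤ R + R'
    rw [map_add, map_add]
    exact (norm_add_le _ _).trans (add_le_add h h')
  smul_mem' := by
    rintro a v ⟨R, hR⟩
    refine ⟨|a| * R, ?_⟩
    filter_upwards [hR] with n h
    change ‖chartD d q _ (dIter f (c.K * n) y (a • v))‖ ≤ |a| * R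
    rw [map_smul, map_smul, norm_smul, Real.norm_eq_abs]
    exact mul_le_mul_of_nonneg_left h (abs_nonneg a)

/-- The velocity of a curve whose iterates stay close to the periodic orbit is a bounded vector: the
iterates of its chords are uniformly bounded in terms of the chords. -/
theorem HyperbolicChart.velocity_mem_boundedSpace (c : HyperbolicChart f q) {B : Set M}
    (hB : c.IsAdapted B) {γ : ℝ → M} (hγ : ContMDiff 𝓘(ℝ, ℝ) (𝓡 d) 1 γ) {N : ℕ}
    (hN : ∀ n ≥ N, ∀ t, f^[c.K * n] (γ t) ∈ B) :
    mfderiv 𝓘(ℝ, ℝ) (𝓡 d) γ 0 (1 : ℝ) ∈ c.boundedSpace (γ 0) := by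
  obtain ⟨C, hC, hle⟩ := c.norm_le_of_bounded
  set u : TangentBundle (𝓡 d) M := ⟨γ 0, mfderiv 𝓘(ℝ, ℝ) (𝓡 d) γ 0 (1 : ℝ)⟩ with hu
  let g : ℕ → ℝ → EuclideanSpace ℝ (Fin d) := fun n t => extChartAt (𝓡 d) q (f^[c.K * n] (γ t))
  have hg : ∀ n ≥ N, HasDerivAt (g n) (coord q (tmap f (c.K * n) u)) 0 := by
    intro n hn
    have h1 : MDifferentiableAt 𝓘(ℝ, ℝ) (𝓡 d) (f^[c.K * n] ∘ γ) 0 :=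
      ((contMDiff_iterate f _).comp hγ).mdifferentiable one_ne_zero 0
    have h2 := (hasFDerivAt_extChartAt_comp h1 (hB.subset (hN n hn 0))).hasDerivAt
    refine h2.congr_deriv ?_
    rw [mfderiv_comp 0 (mdifferentiable_iterate f _ _) (hγ.mdifferentiable one_ne_zero 0)]
    rfl
  have hstep : ∀ t n, c.Step (g (N + n) t - g (N + n) 0) (g (N + (n + 1)) t - g (N + (n + 1)) 0) := by
    intro t n
    have := hB.step_sub _ (hN (N + n) (Nat.le_add_right _ _) t) _
      (hN (N + n) (Nat.le_add_right _ _) 0)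
    rwa [← iterate_mul_succ, ← iterate_mul_succ] at this
  have hbd : ∀ t n, ‖g (N + n) t - g (N + n) 0‖ ≤ 2 := by
    intro t n
    have h1 := hB.bounded _ (hN (N + n) (Nat.le_add_right _ _) t)
    have h2 := hB.bounded _ (hN (N + n) (Nat.le_add_right _ _) 0)
    have h3 := norm_sub_le_norm_sub_add_norm_sub (g (N + n) t) (extChartAt (𝓡 d) q q)
      (g (N + n) 0)
    rw [norm_sub_rev (extChartAt (𝓡 d) q q)] at h3
    change ‖g (N + n) t - _‖ ≤ 1 at h1
    change ‖g (N + n) 0 - _‖ ≤ 1 at h2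
    linarith
  refine ⟨C * ‖coord q (tmap f (c.K * N) u)‖, ?_⟩
  filter_upwards [eventually_ge_atTop N] with n hn
  obtain ⟨k, rfl⟩ := Nat.exists_eq_add_of_le hn
  exact norm_deriv_le_of_increments (hg _ hn) (hg N le_rfl)
    fun t => hle (fun n => g (N + n) t - g (N + n) 0) (hstep t) 2 (hbd t) k

/-- Vectors with bounded coordinates near the orbit of `q` have bounded norm, so they belong to `E` by
`IsWeaklyPartiallyHyperbolic.mem_left_of_bounded`. -/
theorem HyperbolicChart.boundedSpace_le (c : HyperbolicChart f q)
    (hw : IsWeaklyPartiallyHyperbolic f E F)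
    (hy : Tendsto (fun n : ℕ => f^[c.K * n] y) atTop (𝓝 q)) : c.boundedSpace y ≤ E y := by
  obtain ⟨B, hB⟩ := c.exists_isAdapted
  obtain ⟨L, hL, hnrm⟩ := hB.nrm_le
  rintro v ⟨R, hR⟩
  refine hw.mem_left_of_bounded c.K_pos (B := L * R) ?_
  filter_upwards [hR, hy.eventually hB.mem_nhds] with n hn hn'
  exact (hnrm (tmap f (c.K * n) ⟨y, v⟩) hn').trans (mul_le_mul_of_nonneg_left hn hL)

/-- The positive iterates of each vector of `E` at `q` are bounded. -/
def IsBoundedAt (f : Diff1 d M) (E : (x : M) → Submodule ℝ (Tan d x)) (q : M) : Prop :=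
  ∀ v ∈ E q, ∃ R, ∀ n, nrm (tmap f n ⟨q, v⟩) ≤ R

theorem IsBoundedAt.iterate (hinv : IsInvariantBundle f E) (h : IsBoundedAt f E q) (k : ℕ) :
    IsBoundedAt f E (f^[k] q) := by
  intro v hv
  have h1 := tmap_symm_mem_bundleSet hinv k (u := ⟨f^[k] q, v⟩) hv
  have h2 := tmap_tmap_symm f k ⟨f^[k] q, v⟩
  have h3 : (tmap f.symm k ⟨f^[k] q, v⟩).1 = q := symm_iterate_iterate f k q
  generalize tmap f.symm k ⟨f^[k] q, v⟩ = u at h1 h2 h3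
  obtain ⟨x, w⟩ := u
  obtain rfl : x = q := h3
  obtain ⟨R, hR⟩ := h w h1
  refine ⟨R, fun n => ?_⟩
  rw [← h2, ← tmap_add]
  exact hR _

/-- Along the orbit of a fixed point of `f^[K]`, boundedness needs to be checked for the multiples of
`K` only. -/
theorem exists_nrm_le_of_mul {K : ℕ} (hK : 0 < K) (hq : f^[K] q = q) {v : Tan d q} {R : ℝ}
    (hR : ∀ n, nrm (tmap f (K * n) ⟨q, v⟩) ≤ R) : ∃ R', ∀ n, nrm (tmap f n ⟨q, v⟩) ≤ R' := by
  have h1 : ∀ r, ∀ u : TangentBundle (𝓡 d) M, u.1 = q →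
      nrm (tmap f r u) ≤ ‖dIter f r q‖ * nrm u := by
    rintro r ⟨x, w⟩ hx
    obtain rfl : x = q := hx
    exact (dIter f r x).le_opNorm w
  have h0 : 0 ≤ R := (norm_nonneg _).trans (hR 0)
  refine ⟨(∑ r ∈ Finset.range K, ‖dIter f r q‖) * R, fun n => ?_⟩
  have h2 := h1 (n % K) (tmap f (K * (n / K)) ⟨q, v⟩)
    ((show IsPeriodicPt f K q from hq).mul_const (n / K)).eq
  rw [← tmap_add, Nat.mod_add_div] at h2
  have h3 : ‖dIter f (n % K) q‖ ≤ ∑ r ∈ Finset.range K, ‖dIter f r q‖ :=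
    Finset.single_le_sum (f := fun r => ‖dIter f r q‖)
      (fun r _ => ContinuousLinearMap.opNorm_nonneg _) (Finset.mem_range.2 (Nat.mod_lt n hK))
  exact h2.trans (mul_le_mul h3 (hR _) (norm_nonneg _)
    ((ContinuousLinearMap.opNorm_nonneg _).trans h3))

/-- If all vectors of `E` at a point `y` attracted by `q` are bounded, then so are those at `q`: the
former lie in the cone around the stable space, and `E` at `q` is the limit of `E` along the orbit
of `y`. -/
theorem HyperbolicChart.isBoundedAt (c : HyperbolicChart f q) (hE : IsSubbundle E)
    (hinv : IsInvariantBundle f E) (hy : Tendsto (fun n : ℕ => f^[c.K * n] y) atTop (𝓝 q))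
    (hle : E y ≤ c.boundedSpace y) : IsBoundedAt f E q := by
  obtain ⟨B, hB⟩ := c.exists_isAdapted
  obtain ⟨L, hL, hnrm⟩ := hB.nrm_le
  obtain ⟨fr⟩ := hE.nonempty_localFrame q
  obtain ⟨N, hN⟩ := eventually_atTop.1 (hy.eventually hB.mem_nhds)
  have hfy : ∀ n ≥ N, ∀ v ∈ E y, ‖c.πu (coord q (tmap f (c.K * n) ⟨y, v⟩))‖
      ≤ ‖c.πs (coord q (tmap f (c.K * n) ⟨y, v⟩))‖ := by
    intro n hn v hv
    obtain ⟨R, hR⟩ := hle hv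
    obtain ⟨N', hN'⟩ := eventually_atTop.1 hR
    -- the cone estimate at time `n` uses boundedness at all later times
    have h1 : ∃ R', ∀ k, ‖coord q (tmap f (c.K * (n + k)) ⟨y, v⟩)‖ ≤ R' := by
      refine ⟨R + ∑ k ∈ Finset.range N', ‖coord q (tmap f (c.K * (n + k)) ⟨y, v⟩)‖, fun k => ?_⟩
      have hs : 0 ≤ ∑ k ∈ Finset.range N', ‖coord q (tmap f (c.K * (n + k)) ⟨y, v⟩)‖ :=
        Finset.sum_nonneg fun _ _ => norm_nonneg _
      rcases lt_or_ge k N' with hk | hk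
      · have h2 := Finset.single_le_sum
          (f := fun k => ‖coord q (tmap f (c.K * (n + k)) ⟨y, v⟩)‖)
          (fun r _ => norm_nonneg _) (Finset.mem_range.2 hk)
        have h3 := (norm_nonneg _).trans (hN' N' le_rfl)
        linarith
      · have := hN' (n + k) (by omega)
        linarith
    obtain ⟨R', hR'⟩ := h1
    refine (c.cone (w := fun k => coord q (tmap f (c.K * (n + k)) ⟨y, v⟩)) (fun k => ?_) hR' 0).1
    have := hB.step_coord (tmap f (c.K * (n + k)) ⟨y, v⟩) (hN (n + k) (by omega))
    rwa [← tmap_mul_succ] at this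
  -- a vector of `E` at `q` is the limit of vectors `fr.j x e` at the points `x` of the orbit of `y`,
  -- which are images of vectors of `E` at `y`
  have hfq : ∀ v ∈ E q, ‖c.πu (coord q ⟨q, v⟩)‖ ≤ ‖c.πs (coord q ⟨q, v⟩)‖ := by
    intro v hv
    obtain ⟨e, he⟩ := (fr.bijective q fr.mem).2 ⟨v, hv⟩
    have h1 : Tendsto (fun x : M => (⟨x, fr.j x e⟩ : TangentBundle (𝓡 d) M)) (𝓝 q)
        (𝓝 ⟨q, v⟩) := by
      have h2 : Tendsto (fun x : M => (⟨x, fr.j x e⟩ : TangentBundle (𝓡 d) M)) (𝓝 q)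
          (𝓝 ⟨q, fr.j q e⟩) := (fr.continuousOn.continuousAt (x := (q, e))
        ((fr.isOpen.prod isOpen_univ).mem_nhds ⟨fr.mem, mem_univ _⟩)).tendsto.comp
        (f := fun x : M => (x, e)) (x := 𝓝 q) (by
          exact (continuous_id.prodMk continuous_const).tendsto' _ _ rfl)
      rwa [he] at h2
    have h3 := ((tendsto_tangentBundle_iff (mem_extChartAt_source q)).1 (h1.comp hy)).2
    refine le_of_tendsto_of_tendsto ((c.πu.continuous.tendsto _).comp h3).norm
      ((c.πs.continuous.tendsto _).comp h3).norm ?_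
    filter_upwards [eventually_ge_atTop N] with n hn
    have h4 := tmap_symm_mem_bundleSet hinv (c.K * n) (u := ⟨f^[c.K * n] y, fr.j (f^[c.K * n] y) e⟩)
      (fr.j (f^[c.K * n] y) e).2
    have h5 := tmap_tmap_symm f (c.K * n) ⟨f^[c.K * n] y, fr.j (f^[c.K * n] y) e⟩
    have h6 : (tmap f.symm (c.K * n) ⟨f^[c.K * n] y, (fr.j (f^[c.K * n] y) e : Tan d _)⟩).1 = y :=
      symm_iterate_iterate f _ y
    change ‖c.πu (coord q ⟨f^[c.K * n] y, _⟩)‖ ≤ ‖c.πs (coord q ⟨f^[c.K * n] y, _⟩)‖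
    generalize tmap f.symm (c.K * n) ⟨f^[c.K * n] y, (fr.j (f^[c.K * n] y) e : Tan d _)⟩ = u
      at h4 h5 h6
    obtain ⟨x, w⟩ := u
    obtain rfl : x = y := h6
    rw [← h5]
    exact hfy n hn w h4
  intro v hv
  have hKn : ∀ n, f^[c.K * n] q = q := fun n =>
    ((show IsPeriodicPt f c.K q from c.map_eq).mul_const n).eq
  have hA : ∀ u : TangentBundle (𝓡 d) M, u.1 = q → c.A (coord q u) = coord q (tmap f c.K u) := by
    rintro ⟨x, w⟩ hx
    obtain rfl : x = q := hx
    exact c.A_coord w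
  have hcone : ∀ u : TangentBundle (𝓡 d) M, u.1 = q → u ∈ bundleSet E →
      ‖c.πu (coord q u)‖ ≤ ‖c.πs (coord q u)‖ := by
    rintro ⟨x, w⟩ hx hu
    obtain rfl : x = q := hx
    exact hfq w hu
  -- the stable component is contracted, and by the cone condition it controls the unstable one
  have hs : ∀ n, ‖c.πs (coord q (tmap f (c.K * n) ⟨q, v⟩))‖ ≤ ‖c.πs (coord q ⟨q, v⟩)‖ := by
    intro n
    induction n with
    | zero => rw [Nat.mul_zero, tmap_zero]
    | succ n ih =>
      rw [tmap_mul_succ, ← hA _ (hKn n)]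
      have := c.norm_πs_A_le (coord q (tmap f (c.K * n) ⟨q, v⟩))
      have := norm_nonneg (c.πs (coord q (tmap f (c.K * n) ⟨q, v⟩)))
      linarith
  refine exists_nrm_le_of_mul c.K_pos c.map_eq
    (R := L * (c.C * (2 * ‖c.πs (coord q ⟨q, v⟩)‖))) fun n => ?_
  refine (hnrm _ (by rw [show (tmap f (c.K * n) ⟨q, v⟩).1 = q from hKn n]
                     exact mem_of_mem_nhds hB.mem_nhds)).trans
    (mul_le_mul_of_nonneg_left ((c.norm_le _).trans (mul_le_mul_of_nonneg_left ?_ c.C_nonneg)) hL)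
  have h1 := hcone (tmap f (c.K * n) ⟨q, v⟩) (hKn n) (tmap_mem_bundleSet hinv _ hv)
  have h2 := hs n
  linarith

end

/-! ### Boundedness on the bundle `E` at a periodic point and its unstable manifold -/

section

variable {d : ℕ} {M : Type*} [EMetricSpace M] [ChartedSpace (EuclideanSpace ℝ (Fin d)) M]
  [IsManifold (𝓡 d) ∞ M] [RiemannianBundle (fun x : M => TangentSpace (𝓡 d) x)]
  [IsContinuousRiemannianBundle (EuclideanSpace ℝ (Fin d)) (fun x : M => TangentSpace (𝓡 d) x)]
  {f : Diff1 d M} {E F : (x : M) → Submodule ℝ (Tan d x)}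
  {WE : (x : M) → E x → M} {W : (x : M) → F x → M} {q y : M}

theorem HyperbolicChart.tendsto_of_mem_stableManifold (c : HyperbolicChart f q)
    (hy : y ∈ stableManifold f q) : Tendsto (fun n : ℕ => f^[c.K * n] y) atTop (𝓝 q) :=
  ChainHyp.tendsto_of_mem_stableManifold c.K_pos c.map_eq hy

/-- If the plaque tangent to `E` at `q` is contained in the stable manifold, then the vectors of `E`
at `q` are bounded: by Baire's theorem the orbits of the points of some open piece of the plaque,
near the centre, come close to that of `q` simultaneously. -/
theorem HyperbolicChart.isBoundedAt_of_plaque (c : HyperbolicChart f q)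
    (hw : IsWeaklyPartiallyHyperbolic f E F) (hWE : IsPlaqueFamily E WE)
    (hs : range (WE q) ⊆ stableManifold f q) : IsBoundedAt f E q := by
  have hd := hw.dominated
  obtain ⟨B, hB⟩ := c.exists_isAdapted
  obtain ⟨B', hB', hB'c, hBB'⟩ := exists_mem_nhds_isClosed_subset hB.mem_nhds
  obtain ⟨fr⟩ := hd.subbundle_left.nonempty_localFrame q
  let S : ℕ → Set (E q) := fun N => ⋂ n ≥ N, {a | f^[c.K * n] (WE q a) ∈ B'}
  have hS : ∀ N, IsClosed (S N) := fun N => isClosed_biInter fun n _ =>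
    hB'c.preimage ((continuous_iterate f _).comp (hWE.contMDiff q).continuous)
  have hcover : ⋃ N, S N = univ := by
    refine eq_univ_of_forall fun a => ?_
    obtain ⟨N, hN⟩ := eventually_atTop.1
      ((c.tendsto_of_mem_stableManifold (hs ⟨a, rfl⟩)).eventually hB')
    exact mem_iUnion.2 ⟨N, mem_iInter₂.2 fun n hn => hN n hn⟩
  have hcW : Continuous (WE q) := (hWE.contMDiff q).continuous
  have hU : WE q ⁻¹' fr.U ∈ 𝓝 (0 : E q) := by
    refine hcW.continuousAt.preimage_mem_nhds ?_
    rw [hWE.map_zero]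
    exact fr.isOpen.mem_nhds fr.mem
  obtain ⟨a, haS, haU⟩ := (dense_iUnion_interior_of_closed hS hcover).inter_nhds_nonempty hU
  obtain ⟨N, haN⟩ := mem_iUnion.1 haS
  have hy := c.tendsto_of_mem_stableManifold (hs ⟨a, rfl⟩)
  let D : E q →L[ℝ] Tan d (WE q a) := mfderiv 𝓘(ℝ, E q) (𝓡 d) (WE q) a
  -- the vectors tangent to the plaque at `WE q a` are velocities of curves in `S N`
  have hD : (c.boundedSpace (WE q a)).comap (D : E q →ₗ[ℝ] Tan d (WE q a)) = ⊤ := by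
    refine Submodule.eq_top_of_nonempty_interior' _ ?_
    obtain ⟨r, hr, hball⟩ := Metric.isOpen_iff.1 isOpen_interior a haN
    refine ⟨0, mem_interior.2 ⟨Metric.ball 0 r, fun w hw' => ?_, Metric.isOpen_ball,
      Metric.mem_ball_self hr⟩⟩
    -- the curve `a + sin t • w` is defined on the whole line and stays in the ball of radius `r`
    have hw' : ‖w‖ < r := by simpa using hw'
    have hline : ContMDiff 𝓘(ℝ, ℝ) 𝓘(ℝ, E q) 1 (fun t : ℝ => a + Real.sin t • w) :=
      (contDiff_const.add (Real.contDiff_sin.smul contDiff_const)).contMDiff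
    have h1 := c.velocity_mem_boundedSpace hB (N := N)
      (γ := fun t : ℝ => WE q (a + Real.sin t • w)) ((hWE.contMDiff q).comp hline) (by
        intro n hn t
        refine hBB' (mem_iInter₂.1 (interior_subset (hball ?_)) n hn)
        rw [Metric.mem_ball, dist_eq_norm, add_sub_cancel_left, norm_smul, Real.norm_eq_abs]
        exact (mul_le_of_le_one_left (norm_nonneg w) (Real.abs_sin_le_one t)).trans_lt hw')
    have h2 := tangentMap_comp_at (I := 𝓘(ℝ, ℝ)) (I' := 𝓘(ℝ, E q)) (I'' := 𝓡 d)
      (g := WE q) (f := fun t : ℝ => a + Real.sin t • w)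
      ⟨(0 : ℝ), (1 : ℝ)⟩ ((hWE.contMDiff q).mdifferentiable one_ne_zero _)
      (hline.mdifferentiable one_ne_zero _)
    have h3 : HasDerivAt (fun t : ℝ => a + Real.sin t • w) w 0 := by
      simpa using ((Real.hasDerivAt_sin 0).smul_const w).const_add a
    have h4 : (mfderiv 𝓘(ℝ, ℝ) 𝓘(ℝ, E q) (fun t : ℝ => a + Real.sin t • w) 0 (1 : ℝ) : E q)
        = w := by
      have e1 : mfderiv 𝓘(ℝ, ℝ) 𝓘(ℝ, E q) (fun t : ℝ => a + Real.sin t • w) 0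
          = fderiv ℝ (fun t : ℝ => a + Real.sin t • w) 0 := mfderiv_eq_fderiv
      have e2 : (fderiv ℝ (fun t : ℝ => a + Real.sin t • w) 0 (1 : ℝ) : E q) = w :=
        fderiv_apply_one_eq_deriv.trans h3.deriv
      exact (congrArg (fun A : ℝ →L[ℝ] E q => A 1) e1).trans e2
    have h5 : tangentMap 𝓘(ℝ, E q) (𝓡 d) (WE q) (tangentMap 𝓘(ℝ, ℝ) 𝓘(ℝ, E q)
        (fun t : ℝ => a + Real.sin t • w) ⟨(0 : ℝ), (1 : ℝ)⟩)
        = plaqueD WE q (a + Real.sin 0 • w)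
          (mfderiv 𝓘(ℝ, ℝ) 𝓘(ℝ, E q) (fun t : ℝ => a + Real.sin t • w) 0 (1 : ℝ) : E q) := rfl
    rw [h5, h4, Real.sin_zero, zero_smul, add_zero] at h2
    have h6 : tangentMap 𝓘(ℝ, ℝ) (𝓡 d) (WE q ∘ fun t : ℝ => a + Real.sin t • w) ⟨(0 : ℝ), (1 : ℝ)⟩
        ∈ bundleSet c.boundedSpace := h1
    rw [h2] at h6
    exact h6
  have hDle : D.range ≤ c.boundedSpace (WE q a) := by
    rintro _ ⟨w, rfl⟩
    have : w ∈ (c.boundedSpace (WE q a)).comap (D : E q →ₗ[ℝ] Tan d (WE q a)) := by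
      rw [hD]; trivial
    exact this
  -- `D.range` is contained in the space of bounded vectors, which is contained in `E`; the first and
  -- the last have the same dimension
  have hle := c.boundedSpace_le hw hy
  have hrank : ∀ x ∈ fr.U, Module.finrank ℝ (E x) = fr.rank := fun x hx => by
    rw [← (LinearEquiv.ofBijective (fr.j x) (fr.bijective x hx)).finrank_eq]; simp
  have heq : D.range = E (WE q a) := by
    refine Submodule.eq_of_le_of_finrank_eq (hDle.trans hle) ?_
    rw [hrank _ haU, ← hrank q fr.mem]
    exact LinearMap.finrank_range_of_inj (f := (D : E q →ₗ[ℝ] Tan d (WE q a)))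
      (hWE.injective_mfderiv q a)
  exact c.isBoundedAt hd.subbundle_left hd.invariant_left hy (heq ▸ hDle)

/-- The curves that define the stable tangent space stay close to the orbit of `q`. -/
theorem HyperbolicChart.stableTangent_le (c : HyperbolicChart f q) (y : M) :
    stableTangent f q y ≤ c.boundedSpace y := by
  obtain ⟨B, hB⟩ := c.exists_isAdapted
  refine Submodule.span_le.2 ?_
  rintro v ⟨γ, hγ, hunif, hv⟩
  obtain ⟨ε, hε, hεB⟩ := EMetric.mem_nhds_iff.1 hB.mem_nhds
  obtain ⟨N, hN⟩ := hunif ε hε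
  have h1 := c.velocity_mem_boundedSpace hB hγ (N := N) (by
    intro n hn t
    have h2 := hN (c.K * n) (hn.trans (Nat.le_mul_of_pos_left n c.K_pos)) t
    rw [((show IsPeriodicPt f c.K q from c.map_eq).mul_const n).eq] at h2
    exact hεB h2)
  have h3 : (⟨γ 0, mfderiv 𝓘(ℝ, ℝ) (𝓡 d) γ 0 (1 : ℝ)⟩ : TangentBundle (𝓡 d) M)
      ∈ bundleSet c.boundedSpace := h1
  rw [hv] at h3
  exact h3

/-- If the stable manifold of `q` is transverse to `F` at one of its points, then the vectors of `E`
at `q` are bounded. -/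
theorem HyperbolicChart.isBoundedAt_of_transverse (c : HyperbolicChart f q)
    (hw : IsWeaklyPartiallyHyperbolic f E F) (hy : y ∈ stableManifold f q)
    (htr : stableTangent f q y ⊔ F y = ⊤) : IsBoundedAt f E q := by
  have hd := hw.dominated
  have hy' := c.tendsto_of_mem_stableManifold hy
  have hle := c.stableTangent_le y
  have hbE := c.boundedSpace_le hw hy'
  refine c.isBoundedAt hd.subbundle_left hd.invariant_left hy' fun v hv => ?_
  have hmem : v ∈ stableTangent f q y ⊔ F y := by rw [htr]; trivial
  obtain ⟨s, hs, φ, hφ, hadd⟩ := Submodule.mem_sup.1 hmem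
  have h1 : φ ∈ E y := by
    rw [show φ = v - s by rw [← hadd, add_sub_cancel_left]]
    exact (E y).sub_mem hv (hbE (hle hs))
  have h2 : φ = 0 := Submodule.disjoint_def.1 (hd.isCompl y).disjoint φ h1 hφ
  rw [h2, add_zero] at hadd
  exact hle (hadd ▸ hs)

/-- The unstable component of a vector with bounded iterates vanishes, since it grows at least like
`4 ^ n`. -/
theorem HyperbolicChart.πu_eq_zero (c : HyperbolicChart f q) (hb : IsBoundedAt f E q) {v : Tan d q}
    (hv : v ∈ E q) : c.πu (chartD d q q v) = 0 := by
  obtain ⟨R, hR⟩ := hb v hv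
  have hKn : ∀ n, f^[c.K * n] q = q := fun n =>
    ((show IsPeriodicPt f c.K q from c.map_eq).mul_const n).eq
  have hA : ∀ u : TangentBundle (𝓡 d) M, u.1 = q → c.A (coord q u) = coord q (tmap f c.K u) := by
    rintro ⟨x, w⟩ hx
    obtain rfl : x = q := hx
    exact c.A_coord w
  have hnrm : ∀ u : TangentBundle (𝓡 d) M, u.1 = q → ‖coord q u‖ ≤ ‖chartD d q q‖ * nrm u := by
    rintro ⟨x, w⟩ hx
    obtain rfl : x = q := hx
    exact (chartD d x x).le_opNorm w
  have h1 : ∀ n, 4 ^ n * ‖c.πu (coord q ⟨q, v⟩)‖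
      ≤ ‖c.πu (coord q (tmap f (c.K * n) ⟨q, v⟩))‖ := by
    intro n
    induction n with
    | zero => rw [Nat.mul_zero, tmap_zero, pow_zero, one_mul]
    | succ n ih =>
      rw [tmap_mul_succ, ← hA _ (hKn n), pow_succ]
      have := c.le_norm_πu_A (coord q (tmap f (c.K * n) ⟨q, v⟩))
      linarith
  have h2 : ∀ n : ℕ, 4 ^ n * ‖c.πu (coord q ⟨q, v⟩)‖ ≤ ‖c.πu‖ * (‖chartD d q q‖ * R) := by
    intro n
    refine (h1 n).trans ((c.πu.le_opNorm _).trans (mul_le_mul_of_nonneg_left ?_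
      (ContinuousLinearMap.opNorm_nonneg _)))
    exact (hnrm _ (hKn n)).trans (mul_le_mul_of_nonneg_left (hR _)
      (ContinuousLinearMap.opNorm_nonneg _))
  by_contra h0
  have h3 : 0 < ‖c.πu (coord q ⟨q, v⟩)‖ := norm_pos_iff.2 h0
  obtain ⟨n, hn⟩ := pow_unbounded_of_one_lt
    (‖c.πu‖ * (‖chartD d q q‖ * R) / ‖c.πu (coord q ⟨q, v⟩)‖) (by norm_num : (1 : ℝ) < 4)
  rw [div_lt_iff₀ h3] at hn
  exact absurd (h2 n) (not_le.2 hn)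

/-- If the vectors of `E` at `q` are bounded, then the plaque of `F` at `q` is a graph over the
unstable space. -/
theorem HyperbolicChart.eventually_exists_plaque (c : HyperbolicChart f q)
    (hd : IsDominatedSplitting f E F) (hW : IsPlaqueFamily F W) (hb : IsBoundedAt f E q) {δ : ℝ}
    (hδ : 0 < δ) : ∀ᶠ z in 𝓝 q, ∃ b : F q, plaqueSize W q b < δ ∧
      W q b ∈ (extChartAt (𝓡 d) q).source ∧
      c.πu (extChartAt (𝓡 d) q z) = c.πu (extChartAt (𝓡 d) q (W q b)) := by
  obtain ⟨fr⟩ := hd.subbundle_right.nonempty_localFrame q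
  let g : (Fin fr.rank → ℝ) → c.Eu := fun e => c.πu (plaqueMap W fr q e)
  let g' : (Fin fr.rank → ℝ) →L[ℝ] c.Eu := c.πu.comp (plaqueMapD W fr q 0)
  have h1 : HasStrictFDerivAt (plaqueMap W fr q) (plaqueMapD W fr q 0) 0 := by
    refine HasStrictFDerivAt.of_isLittleO (Asymptotics.isLittleO_iff.2 fun η hη => ?_)
    obtain ⟨r, hr, h⟩ := hW.exists_approx fr hη
    have h2 := Metric.closedBall_mem_nhds (0 : Fin fr.rank → ℝ) hr
    filter_upwards [prod_mem_nhds h2 h2] with p hp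
    exact h.self_of_nhds p.1 hp.1 p.2 hp.2
  have hg : HasStrictFDerivAt g g' 0 := c.πu.hasStrictFDerivAt.comp 0 h1
  -- the unstable coordinate vanishes on `E`, hence is onto when restricted to `F`
  have hsurj : g'.range = ⊤ := by
    rw [LinearMap.range_eq_top]
    intro w
    obtain ⟨h, rfl⟩ := c.surjective_πu w
    obtain ⟨v, rfl⟩ := chartD_surjective (mem_extChartAt_source (I := 𝓡 d) q) h
    have hv : v ∈ E q ⊔ F q := by rw [(hd.isCompl q).sup_eq_top]; trivial
    obtain ⟨e, he, φ, hφ, rfl⟩ := Submodule.mem_sup.1 hv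
    obtain ⟨a, ha⟩ := hW.exists_plaqueMapD_zero_eq fr fr.mem hφ
    refine ⟨a, ?_⟩
    change c.πu (plaqueMapD W fr q 0 a) = _
    rw [ha, map_add, map_add, c.πu_eq_zero hb he, zero_add]
  have hmap := hg.map_nhds_eq_of_surj hsurj
  have hV : ∀ᶠ e in 𝓝 (0 : Fin fr.rank → ℝ), frameSize W fr q e < δ ∧
      W q (fr.j q e) ∈ (extChartAt (𝓡 d) q).source := by
    refine ((hW.continuous_frameSize fr).continuousAt.eventually_lt_const
      (by rw [frameSize_zero]; exact hδ)).and ?_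
    have := (hW.contMDiff q).continuous.comp
      (LinearMap.continuous_of_finiteDimensional (fr.j q))
    refine this.continuousAt.eventually_mem ?_
    exact (isOpen_extChartAt_source q).mem_nhds (hW.mem_source_zero fr fr.mem)
  have himg := image_mem_map (m := g) hV
  rw [hmap] at himg
  have hg0 : g 0 = c.πu (extChartAt (𝓡 d) q q) := by
    simp only [g, plaqueMap, _root_.map_zero, hW.map_zero]
  have hcont : ContinuousAt (fun z => c.πu (extChartAt (𝓡 d) q z)) q :=
    c.πu.continuous.continuousAt.comp (continuousAt_extChartAt q)
  rw [hg0] at himg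
  filter_upwards [hcont.preimage_mem_nhds himg] with z hz
  obtain ⟨e, ⟨he1, he2⟩, he3⟩ := hz
  exact ⟨fr.j q e, he1, he2, he3.symm⟩

/-- If the vectors of `E` at `q` are bounded, then the points whose negative iterates stay close to
the orbit of `q` lie on the plaque of `F` at `q`: such a point and the point of the plaque with the
same unstable coordinate differ by a vector in the unstable cone. -/
theorem HyperbolicChart.exists_plaque_eq [CompactSpace M] (c : HyperbolicChart f q)
    (hw : IsWeaklyPartiallyHyperbolic f E F) (hW : IsPlaqueFamily F W)
    (htrap : IsTrapped f.symm W) (hb : IsBoundedAt f E q) {δ : ℝ} (hδ : 0 < δ) :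
    ∃ B ∈ 𝓝 q, ∀ z, (∀ n, f.symm^[c.K * n] z ∈ B) → ∃ b : F q, plaqueSize W q b < δ ∧ W q b = z := by
  have hd := hw.dominated
  obtain ⟨B, hB⟩ := c.exists_isAdapted
  obtain ⟨ε, hε, hεB⟩ : ∃ ε > 0, ∀ b : F q, plaqueSize W q b ≤ ε → W q b ∈ B := by
    have h1 := (hW.tendsto_of_plaqueSize q (b := fun b : F q => b)
      (l := comap (plaqueSize W q) (𝓝 0)) tendsto_comap).eventually hB.mem_nhds
    obtain ⟨t, ht, h2⟩ := mem_comap.1 h1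
    obtain ⟨ε, hε, h3⟩ := Metric.nhds_basis_closedBall.mem_iff.1 ht
    refine ⟨ε, hε, fun b hb => h2 (h3 ?_)⟩
    rw [mem_closedBall_zero_iff, Real.norm_eq_abs, abs_of_nonneg (plaqueSize_nonneg q b)]
    exact hb
  obtain ⟨δ', hδ', ρ, -, hρ, hback⟩ := hW.exists_backward_contraction hd.subbundle_right
    hd.invariant_right hw.expanded htrap hε
  have hgraph := c.eventually_exists_plaque hd hW hb (lt_min hδ hδ')
  refine ⟨_, inter_mem hB.mem_nhds hgraph, fun z hz => ?_⟩
  obtain ⟨b, hbδ, hbs, hbz⟩ := (hz 0).2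
  change c.πu (extChartAt (𝓡 d) q z) = _ at hbz
  refine ⟨b, hbδ.trans_le (min_le_left _ _), ?_⟩
  have hb' : ∀ n, f.symm^[c.K * n] (W q b) ∈ B := by
    intro n
    have h1 := hback q b (hbδ.le.trans (min_le_right _ _)) (c.K * n)
    rw [((isPeriodicPt_symm (show IsPeriodicPt f c.K q from c.map_eq)).mul_const n).eq] at h1
    obtain ⟨b', h2, h3⟩ := h1
    rw [← h2]
    exact hεB b' (h3.trans (hρ _))
  set φ := extChartAt (𝓡 d) q
  let w : ℕ → EuclideanSpace ℝ (Fin d) := fun n =>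
    φ (f.symm^[c.K * n] z) - φ (f.symm^[c.K * n] (W q b))
  -- the differences `w n` are nearly hyperbolic steps, read backwards in time
  have hstep : ∀ n, c.Step (w (n + 1)) (w n) := by
    intro n
    have h1 := hB.step_sub _ (hz (n + 1)).1 _ (hb' (n + 1))
    rw [iterate_mul_succ, iterate_mul_succ, iterate_symm_iterate, iterate_symm_iterate] at h1
    simpa only [w, iterate_mul_succ] using h1
  have hbd : ∀ n, ‖w n‖ ≤ 2 := by
    intro n
    have h1 := hB.bounded _ (hz n).1
    have h2 := hB.bounded _ (hb' n)
    have h3 := norm_sub_le_norm_sub_add_norm_sub (φ (f.symm^[c.K * n] z)) (φ q)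
      (φ (f.symm^[c.K * n] (W q b)))
    rw [norm_sub_rev (φ q)] at h3
    change ‖φ _ - φ _‖ ≤ 2
    linarith
  have hu0 : c.πu (w 0) = 0 := by
    change c.πu (φ z - φ (W q b)) = 0
    rw [map_sub, hbz, sub_self]
  have hs0 := cone_of_bounded_backward (s := fun n => ‖c.πs (w n)‖) (u := fun n => ‖c.πu (w n)‖)
    (fun _ => norm_nonneg _) (fun _ => norm_nonneg _) (fun n => (hstep n).1)
    (fun n => (hstep n).2) (B := ‖c.πs‖ * 2) (fun n => (c.πs.le_opNorm _).trans
      (mul_le_mul_of_nonneg_left (hbd n) (ContinuousLinearMap.opNorm_nonneg _)))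
  simp only [hu0, norm_zero] at hs0
  have hw0 : w 0 = 0 := by
    have h1 := c.norm_le (w 0)
    rw [hu0, norm_zero, add_zero] at h1
    exact norm_le_zero_iff.1 (h1.trans (mul_nonpos_of_nonneg_of_nonpos c.C_nonneg hs0))
  exact (φ.injOn (hB.subset (hz 0).1) hbs (sub_eq_zero.1 hw0)).symm

/-- If the vectors of `E` at `q` are bounded, then the unstable manifold of `q` is tangent to `F`. -/
theorem HyperbolicChart.unstableTangent_le [CompactSpace M] (c : HyperbolicChart f q)
    (hw : IsWeaklyPartiallyHyperbolic f E F) (hW : IsPlaqueFamily F W)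
    (htrap : IsTrapped f.symm W) (hb : IsBoundedAt f E q) (y : M) :
    unstableTangent f q y ≤ F y := by
  obtain ⟨δ, hδ, hδF⟩ := hw.exists_plaqueD_mem hW htrap
  obtain ⟨B, hB, hBW⟩ := c.exists_plaque_eq hw hW htrap hb hδ
  refine Submodule.span_le.2 ?_
  rintro v ⟨γ, hγ, hunif, hv⟩
  obtain ⟨ε, hε, hεB⟩ := EMetric.mem_nhds_iff.1 hB
  obtain ⟨N, hN⟩ := hunif ε hε
  have hper := isPeriodicPt_symm (show IsPeriodicPt f c.K q from c.map_eq)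
  -- a negative iterate of the curve is contained in the plaque at `q`, which is tangent to `F`
  have h1 : ∀ t, ∃ b : F q, plaqueSize W q b < δ ∧ W q b = f.symm^[c.K * N] (γ t) := by
    intro t
    refine hBW _ fun n => ?_
    rw [← Function.iterate_add_apply, ← Nat.mul_add]
    have h2 := hN (c.K * (n + N))
      ((Nat.le_add_left N n).trans (Nat.le_mul_of_pos_left _ c.K_pos)) t
    rw [(hper.mul_const _).eq] at h2
    exact hεB h2
  choose β hβs hβ using h1
  have hγ' : ContMDiff 𝓘(ℝ, ℝ) (𝓡 d) 1 (f.symm^[c.K * N] ∘ γ) :=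
    (contMDiff_iterate f.symm _).comp hγ
  obtain ⟨w, hw'⟩ := hW.exists_plaqueD_eq_velocity (t₀ := 0) hγ' hβ
  have h3 := hδF q (β 0) (hβs 0).le w
  rw [hw'] at h3
  have h4 := tangentMap_comp_at (I := 𝓘(ℝ, ℝ)) (I' := 𝓡 d) (I'' := 𝓡 d)
      (g := f.symm^[c.K * N]) (f := γ)
      ⟨(0 : ℝ), (1 : ℝ)⟩ ((mdifferentiable_iterate f.symm _) _)
      (hγ.mdifferentiable one_ne_zero _)
  have h5 : tangentMap 𝓘(ℝ, ℝ) (𝓡 d) (f.symm^[c.K * N] ∘ γ) ⟨(0 : ℝ), (1 : ℝ)⟩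
      ∈ bundleSet F := h3
  rw [h4, ← tmap_eq_tangentMap, show tangentMap 𝓘(ℝ, ℝ) (𝓡 d) γ ⟨(0 : ℝ), (1 : ℝ)⟩ = ⟨y, v⟩
    from hv] at h5
  have h6 := tmap_mem_bundleSet hw.dominated.invariant_right (c.K * N) h5
  rw [tmap_tmap_symm] at h6
  exact h6

/-- A closed invariant set saturated by small plaques of `F` contains the unstable manifold of each
of its hyperbolic periodic points at which the vectors of `E` are bounded. -/
theorem HyperbolicChart.unstableManifold_subset [CompactSpace M] (c : HyperbolicChart f q)
    (hw : IsWeaklyPartiallyHyperbolic f E F) (hW : IsPlaqueFamily F W)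
    (htrap : IsTrapped f.symm W) (hb : IsBoundedAt f E q) {δ : ℝ} (hδ : 0 < δ) {Λ : Set M}
    (hΛ : IsSaturatedBy f W δ Λ) (hq : q ∈ Λ) : unstableManifold f q ⊆ Λ := by
  intro y hy
  obtain ⟨B, hB, hBW⟩ := c.exists_plaque_eq hw hW htrap hb hδ
  have h1 := ChainHyp.tendsto_of_mem_stableManifold c.K_pos
    (isPeriodicPt_symm (show IsPeriodicPt f c.K q from c.map_eq)) hy
  obtain ⟨N, hN⟩ := eventually_atTop.1 (h1.eventually hB)
  obtain ⟨b, hbδ, hb⟩ := hBW (f.symm^[c.K * N] y) fun n => by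
    rw [← Function.iterate_add_apply, ← Nat.mul_add]
    exact hN _ (Nat.le_add_left N n)
  have h2 := iterate_mem_of_mapsTo hΛ.map (c.K * N) (hb ▸ hΛ.plaque q hq b hbδ)
  rwa [iterate_symm_iterate] at h2

end

/-! ### Saturated sets containing the distinguished periodic point -/

section

variable {d : ℕ} {M : Type*} [EMetricSpace M] [ChartedSpace (EuclideanSpace ℝ (Fin d)) M]
  [IsManifold (𝓡 d) ∞ M] [RiemannianBundle (fun x : M => TangentSpace (𝓡 d) x)]
  {f : Diff1 d M} {E F : (x : M) → Submodule ℝ (Tan d x)}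
  {WE : (x : M) → E x → M} {W : (x : M) → F x → M} {p q qs y : M}

theorem orbit_subset_of_mem {p' : M} (h : p' ∈ orbit f p) : orbit f p' ⊆ orbit f p := by
  obtain ⟨k, rfl⟩ := h
  rintro _ ⟨n, rfl⟩
  exact ⟨n + k, Function.iterate_add_apply f n k p⟩

theorem mem_orbit_of_mem_orbit {p' : M} (hp : p ∈ periodicPts f) (h : p' ∈ orbit f p) :
    p ∈ orbit f p' := by
  obtain ⟨m, hm, hmp⟩ := hp
  obtain ⟨k, rfl⟩ := h
  refine ⟨m * k - k, ?_⟩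
  change f^[m * k - k] (f^[k] p) = p
  rw [← Function.iterate_add_apply, Nat.sub_add_cancel (Nat.le_mul_of_pos_left k hm)]
  exact (hmp.mul_const k).eq

theorem IsHyperbolicPeriodic.of_mem_orbit {p' : M} (hp : IsHyperbolicPeriodic f p)
    (h : p' ∈ orbit f p) : IsHyperbolicPeriodic f p' := by
  have hsub := orbit_subset_of_mem h
  obtain ⟨⟨m, hm, hmp⟩, Es, Eu, h1, ⟨C, l, hC, hl, hl', h2⟩, C', l', hC', hl'', h3⟩ := hp
  exact ⟨⟨m, hm, isPeriodicPt_of_mem_orbit hmp h⟩, Es, Eu, fun x hx => h1 x (hsub hx),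
    ⟨C, l, hC, hl, hl', fun x hx => h2 x (hsub hx)⟩, C', l', hC', hl'', fun x hx => h3 x (hsub hx)⟩

variable [IsContinuousRiemannianBundle (EuclideanSpace ℝ (Fin d))
  (fun x : M => TangentSpace (𝓡 d) x)]

/-- A closed invariant set which is saturated by small plaques of `F` and contains `qs` is the whole
manifold. -/
theorem IsSaturatedBy.eq_univ [CompactSpace M] (hw : IsWeaklyPartiallyHyperbolic f E F)
    (hWE : IsPlaqueFamily E WE) (hW : IsPlaqueFamily F W) (htrap : IsTrapped f.symm W)
    (hp : homoclinicClass f p = univ) (hqs : HomoclinicallyRelated f p qs)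
    (hs : range (WE qs) ⊆ stableManifold f qs) {δ : ℝ} (hδ : 0 < δ) {Λ : Set M}
    (hΛ : IsSaturatedBy f W δ Λ) (hqΛ : qs ∈ Λ) : Λ = univ := by
  have hinv := hw.dominated.invariant_left
  have horb : ∀ x ∈ Λ, orbit f x ⊆ Λ := by
    rintro x hx _ ⟨n, rfl⟩
    exact iterate_mem_of_mapsTo hΛ.map n hx
  have hbqs : IsBoundedAt f E qs :=
    (hqs.2.1.nonempty_hyperbolicChart.some).isBoundedAt_of_plaque hw hWE hs
  obtain ⟨p', hp', qs', hqs', y, ⟨hy1, hy2⟩, htr⟩ := hqs.2.2.1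
  obtain ⟨cp'⟩ := (hqs.1.of_mem_orbit hp').nonempty_hyperbolicChart
  obtain ⟨cq'⟩ := (hqs.2.1.of_mem_orbit hqs').nonempty_hyperbolicChart
  have hbqs' : IsBoundedAt f E qs' := by
    obtain ⟨k, rfl⟩ := hqs'
    exact hbqs.iterate hinv k
  -- from `qs` to the orbit of `p`, along a heteroclinic point `y`
  have hyΛ : y ∈ Λ := cq'.unstableManifold_subset hw hW htrap hbqs' hδ hΛ (horb _ hqΛ hqs') hy2
  have hp'Λ : p' ∈ Λ := hΛ.isClosed.mem_of_tendsto (cp'.tendsto_of_mem_stableManifold hy1)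
    (Eventually.of_forall fun n => iterate_mem_of_mapsTo hΛ.map _ hyΛ)
  have hbp' : IsBoundedAt f E p' := cp'.isBoundedAt_of_transverse hw hy1
    (eq_top_iff.2 (htr ▸ sup_le_sup_left (cq'.unstableTangent_le hw hW htrap hbqs' y) _))
  have hp_orb := mem_orbit_of_mem_orbit hqs.1.1 hp'
  rw [← univ_subset_iff, ← hp]
  refine closure_minimal ?_ hΛ.isClosed
  -- from the orbit of `p` to that of a related point `q`, along a heteroclinic point `x`
  rintro q ⟨-, hq, -, q', hq', p'', hp'', x, ⟨hx1, hx2⟩, -⟩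
  have hp''o : p'' ∈ orbit f p' := orbit_subset_of_mem hp_orb hp''
  obtain ⟨cp''⟩ := (hqs.1.of_mem_orbit hp'').nonempty_hyperbolicChart
  obtain ⟨cq⟩ := (hq.of_mem_orbit hq').nonempty_hyperbolicChart
  have hbp'' : IsBoundedAt f E p'' := by
    obtain ⟨k, rfl⟩ := hp''o
    exact hbp'.iterate hinv k
  have hxΛ : x ∈ Λ := cp''.unstableManifold_subset hw hW htrap hbp'' hδ hΛ (horb _ hp'Λ hp''o) hx2
  have hq'Λ : q' ∈ Λ := hΛ.isClosed.mem_of_tendsto (cq.tendsto_of_mem_stableManifold hx1)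
    (Eventually.of_forall fun n => iterate_mem_of_mapsTo hΛ.map _ hxΛ)
  exact horb _ hq'Λ (mem_orbit_of_mem_orbit hq.1 hq')

end

end ChainHyp

end

theorem mainTheorem4 {d : ℕ} {M : Type*} [EMetricSpace M]
    [ChartedSpace (EuclideanSpace ℝ (Fin d)) M] [IsManifold (𝓡 d) ∞ M]
    [RiemannianBundle (fun x : M => TangentSpace (𝓡 d) x)]
    [IsContMDiffRiemannianBundle (𝓡 d) ∞ (EuclideanSpace ℝ (Fin d))
      (fun x : M => TangentSpace (𝓡 d) x)]
    [IsRiemannianManifold (𝓡 d) M] [CompactSpace M]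
    (f : ChainHyp.Diff1 d M)
    (E F : (x : M) → Submodule ℝ (TangentSpace (𝓡 d) x))
    (hwph : ChainHyp.IsWeaklyPartiallyHyperbolic f E F)
    (hch : ChainHyp.IsChainHyperbolic f E F) :
    ChainHyp.IsDynamicallyMinimal f F := by
  have : IsContinuousRiemannianBundle (EuclideanSpace ℝ (Fin d))
      (fun x : M => TangentSpace (𝓡 d) x) := by
    obtain ⟨g, g_smooth, hg⟩ := IsContMDiffRiemannianBundle.exists_contMDiff (IB := 𝓡 d) (n := ∞)
      (F := EuclideanSpace ℝ (Fin d)) (E := fun x : M => TangentSpace (𝓡 d) x)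
    exact ⟨g, g_smooth.continuous, hg⟩
  obtain ⟨p, -, hp, hd, WE, WF, hWE, htE, hWF, htF, qs, -, hqs, -, hs, -⟩ := hch
  obtain ⟨δ, hδ, hδF⟩ := hwph.exists_plaqueD_mem hWF htF
  intro x
  have hΛ := ChainHyp.isSaturatedBy_closure_iUnion_leaf (f := f) hd.subbundle_right
    hd.invariant_right hWF hδF x
  obtain ⟨y, hyx, hy⟩ := ChainHyp.exists_mem_leaf_mem_limitSet hd hWE htE hWF hδ hδF hqs.2.1.1 hs
    (ChainHyp.dense_setOf_mem_limitSet hwph hWE htE hWF htF hp hqs hs) x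
  have hyΛ := subset_closure (mem_iUnion.2 ⟨(0 : ℤ), hyx⟩ :
    y ∈ ⋃ n : ℤ, ChainHyp.leaf F ((f.toEquiv ^ n : Equiv.Perm M) x))
  rw [dense_iff_closure_eq]
  refine hΛ.eq_univ hwph hWE hWF htF hp hqs hs hδ ?_
  exact isClosed_iff_clusterPt.1 hΛ.isClosed qs (ClusterPt.mono (show ClusterPt qs _ from hy)
    (le_principal_iff.2 (mem_map.2 (Eventually.of_forall fun n : ℕ =>
      ChainHyp.iterate_mem_of_mapsTo hΛ.map n hyΛ))))
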